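/- **Setting.** Let $p\ge 1$ be an integer, $(a_0,\dots,a_p),(b_0,\dots,b_p)\in\mathbb R^{p+1}$, and let $(X_k)_{k\ge1}$ be real random variables on a probability space with, for all $n\ge 2^{p-1}$, $$X_{2n}=a_0+\sum_{k=1}^p a_kX_{\lfloor n/2^{k-1}\rfloor}+\varepsilon_{2n},\qquad X_{2n+1}=b_0+\sum_{k=1}^p b_kX_{\lfloor n/2^{k-1}\rfloor}+\varepsilon_{2n+1}.$$ The initial states satisfy $\mathbb E[X_k^8]<\infty$ for $1\le k\le 2^p-1$. Let $A$ (resp. $B$) be the $p\times p$ companion matrix with first row $(a_1,\dots,a_p)$ (resp. $(b_1,\dots,b_p)$), ones just below the diagonal and zeros elsewhere, and assume that $\max\{\|A\|,\|B\|\}<1$ for the operator norm induced by some norm on $\mathbb R^p$. Put $\mathbb G_n=\{2^n,\dots,2^{n+1}-1\}$, $\mathbb T_n=\bigcup_{k=0}^n\mathbb G_k$, $\mathbb T_{n,q}=\{k\in\mathbb T_n: k\ge 2^q\}$, $\mathcal F_n=\sigma(X_k,\,k\in\mathbb T_n)$, $\mathbb X_k=(X_k,X_{\lfloor k/2\rfloor},\dots,X_{\lfloor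 k/2^{p-1}\rfloor})^t$, $Y_k=(1,\mathbb X_k^t)^t\in\mathbb R^{p+1}$, and $$S_n=\sum_{k\in\mathbb T_{n,p-1}}Y_kY_k^t,\qquad M_n=\sum_{k\in\mathbb T_{n-1,p-1}}\begin{pmatrix}\varepsilon_{2k}Y_k\\ \varepsilon_{2k+1}Y_k\end{pmatrix}\in\mathbb R^{2(p+1)}\quad(n\ge p).$$ Let $\Sigma_n=\mathrm I_2\otimes\widetilde S_n$, where $\widetilde S_n$ is an invertible version of $S_n$: for each $n\ge p-1$ and each outcome, $\widetilde S_n$ is $S_n$ or $S_n+\mathrm I_{p+1}$, chosen in any way such that $\widetilde S_n$ is invertible. **Hypotheses.** * (H.1) There is $\sigma^2>0$ such that for all $n\ge p-1$ and $k\in\mathbb G_{n+1}$: $\varepsilon_k\in L^2$, $\mathbb E[\varepsilon_k|\mathcal F_n]=0$ and $\mathbb E[\varepsilon_k^2|\mathcal F_n]=\sigma^2$ a.s. * (H.2) There is $\rho$ with $|\rho|<\sigma^2$ such that for all $n\ge p-1$: $\mathbb E[\varepsilon_k\varepsilon_l|\mathcal F_n]=\rho$ a.s. for all different $k,l\in\mathbb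 G_{n+1}$ with $\lfloor k/2\rfloor=\lfloor l/2\rfloor$, and the sister pairs $(\varepsilon_{2k},\varepsilon_{2k+1})$, $k\in\mathbb G_n$, are (mutually) conditionally independent given $\mathcal F_n$. * (H.3) For all $n\ge p-1$ and $k\in\mathbb G_{n+1}$, $\varepsilon_k\in L^4$, and $\sup_{n\ge p-1}\sup_{k\in\mathbb G_{n+1}}\mathbb E[\varepsilon_k^4|\mathcal F_n]<\infty$ a.s. * (H.4) There are $\tau^4>0$ and $\nu^2<\tau^4$ such that for all $n\ge p-1$: $\mathbb E[\varepsilon_k^4|\mathcal F_n]=\tau^4$ a.s. for all $k\in\mathbb G_{n+1}$, and $\mathbb E[\varepsilon_k^2\varepsilon_l^2|\mathcal F_n]=\nu^2$ a.s. for all different $k,l\in\mathbb G_{n+1}$ with $\lfloor k/2\rfloor=\lfloor l/2\rfloor$. * (H.5) For all $n\ge p-1$ and $k\in\mathbb G_{n+1}$, $\varepsilon_k\in L^8$, and $\sup_{n\ge p-1}\sup_{k\in\mathbb G_{n+1}}\mathbb E[\varepsilon_k^8|\mathcal F_n]<\infty$ a.s. **Limiting matrices.** Let $\Gamma=\begin{pmatrix}\sigma^2&\rho\\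 \rho&\sigma^2\end{pmatrix}$, $e_1=(1,0,\dots,0)^t\in\mathbb R^p$, $\overline A=\frac12(A+B)$, $\lambda=\frac{a_0+b_0}2(\mathrm I_p-\overline A)^{-1}e_1$, $$T=\Big(\sigma^2+\tfrac{a_0^2+b_0^2}2\Big)e_1e_1^t+\tfrac12\Big(a_0(A\lambda e_1^t+e_1\lambda^tA^t)+b_0(B\lambda e_1^t+e_1\lambda^tB^t)\Big),$$ and $L=\begin{pmatrix}1&\lambda^t\\ \lambda&\ell\end{pmatrix}$, where $\ell$ is the unique solution of $\ell=T+\frac12(A\ell A^t+B\ell B^t)$. **Theorem 5.1.** Assume (H.1)–(H.3). Then $$M_n^t\Sigma_{n-1}^{-1}M_n=\mathcal O(n)\quad\text{a.s.}\qquad\text{and}\qquad \lim_{n\to\infty}\frac1n\sum_{k=p}^nM_k^t\Sigma_{k-1}^{-1}M_k=2(p+1)\sigma^2\quad\text{a.s.}$$ If (H.4) and (H.5) hold in addition, then the equation for $\ell$ has exactly one solution, $L$ is positive definite, and $$\frac1{\sqrt{|\mathbb T_{n-1}|}}M_n\ \longrightarrow\ \mathcal N(0,\Gamma\otimes L)\quad\text{in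 law}.$$ -/

import Mathlib

open MeasureTheory ProbabilityTheory Filter Topology
open scoped Matrix Kronecker

namespace BAR

noncomputable section

/-! ### The binary tree -/

/-- The `n`-th generation `{2^n, …, 2^(n+1) - 1}`. -/
def gen (n : ℕ) : Finset ℕ := Finset.Ico (2 ^ n) (2 ^ (n + 1))

/-- The sub-tree of all individuals up to generation `n`, the root being labelled `1`. -/
def tree (n : ℕ) : Finset ℕ := (Finset.range (n + 1)).biUnion gen

/-- The individuals of `tree n` with label at least `2^q`. -/
def subtree (n q : ℕ) : Finset ℕ := (tree n).filter (fun k => 2 ^ q ≤ k)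

/-! ### The autoregressive process -/

variable {Ω : Type*}

/-- The recursion of order `p`: the daughters of every `n ≥ 2^(p-1)` are given by
`X_{2n} = a_0 + ∑_{k=1}^p a_k X_{⌊n/2^{k-1}⌋} + ε_{2n}` and
`X_{2n+1} = b_0 + ∑_{k=1}^p b_k X_{⌊n/2^{k-1}⌋} + ε_{2n+1}`. -/
def IsBAR (p : ℕ) (a b : Fin (p + 1) → ℝ) (X ε : ℕ → Ω → ℝ) : Prop :=
  ∀ n, 2 ^ (p - 1) ≤ n → ∀ ω,
    X (2 * n) ω = a 0 + ∑ k : Fin p, a k.succ * X (n / 2 ^ (k : ℕ)) ω + ε (2 * n) ω ∧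
    X (2 * n + 1) ω = b 0 + ∑ k : Fin p, b k.succ * X (n / 2 ^ (k : ℕ)) ω + ε (2 * n + 1) ω

/-- The companion matrix with first row `(a_1, …, a_p)` and ones below the diagonal. -/
def companion {p : ℕ} (a : Fin (p + 1) → ℝ) : Matrix (Fin p) (Fin p) ℝ :=
  Matrix.of fun i j =>
    if (i : ℕ) = 0 then a j.succ else if (i : ℕ) = (j : ℕ) + 1 then 1 else 0

/-- For some norm `N` on `ℝ^p`, both induced operator norms `‖A‖` and `‖B‖` are at most some
`β < 1`. (For `p ≥ 2` the norm cannot be the Euclidean one: a companion matrix has Euclidean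
operator norm at least `1`.) -/
def Contracting {p : ℕ} (A B : Matrix (Fin p) (Fin p) ℝ) : Prop :=
  ∃ (N : Seminorm ℝ (Fin p → ℝ)) (β : ℝ), (∀ u, N u = 0 → u = 0) ∧ β < 1 ∧
    ∀ u, N (A *ᵥ u) ≤ β * N u ∧ N (B *ᵥ u) ≤ β * N u

/-- The sigma-algebra generated by all individuals up to generation `n`. -/
abbrev filt (X : ℕ → Ω → ℝ) (n : ℕ) : MeasurableSpace Ω :=
  ⨆ k ∈ tree n, MeasurableSpace.comap (X k) inferInstance

/-- `Y_k = (1, X_k, X_{⌊k/2⌋}, …, X_{⌊k/2^{p-1}⌋})`. -/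
def regressor (p : ℕ) (X : ℕ → Ω → ℝ) (k : ℕ) (ω : Ω) : Fin (p + 1) → ℝ :=
  Fin.cons 1 (fun i : Fin p => X (k / 2 ^ (i : ℕ)) ω)

/-- `S_n = ∑ Y_k Y_kᵗ` over the individuals of generations `p - 1, …, n`. -/
def S (p : ℕ) (X : ℕ → Ω → ℝ) (n : ℕ) (ω : Ω) : Matrix (Fin (p + 1)) (Fin (p + 1)) ℝ :=
  ∑ k ∈ subtree n (p - 1), Matrix.vecMulVec (regressor p X k ω) (regressor p X k ω)

/-- An invertible version of `S_n`: `S_n + c_n I`, where each `c_n(ω)` is `0` (nothing is added)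
or `1` (the identity is added). -/
def Sreg (p : ℕ) (X : ℕ → Ω → ℝ) (c : ℕ → Ω → ℝ) (n : ℕ) (ω : Ω) :
    Matrix (Fin (p + 1)) (Fin (p + 1)) ℝ :=
  S p X n ω + c n ω • (1 : Matrix (Fin (p + 1)) (Fin (p + 1)) ℝ)

/-- The choice `c` is admissible: `c_n(ω) ∈ {0, 1}` and `S_n + c_n I` is invertible for
`n ≥ p - 1`. -/
def IsRegularisation (p : ℕ) (X : ℕ → Ω → ℝ) (c : ℕ → Ω → ℝ) : Prop :=
  ∀ n, p - 1 ≤ n → ∀ ω, (c n ω = 0 ∨ c n ω = 1) ∧ IsUnit (Sreg p X c n ω)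

/-- `Σ_n = I_2 ⊗ S_n`, with the invertible version of `S_n`. -/
def bigSigma (p : ℕ) (X : ℕ → Ω → ℝ) (c : ℕ → Ω → ℝ) (n : ℕ) (ω : Ω) :
    Matrix (Fin 2 × Fin (p + 1)) (Fin 2 × Fin (p + 1)) ℝ :=
  (1 : Matrix (Fin 2) (Fin 2) ℝ) ⊗ₖ Sreg p X c n ω

/-- The martingale `M_n = ∑ (ε_{2k} Y_k, ε_{2k+1} Y_k)` over the individuals `k` of generations
`p - 1, …, n - 1`, for `n ≥ p`. The first index (in `Fin 2`) is that of the daughter. -/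
def M (p : ℕ) (X ε : ℕ → Ω → ℝ) (n : ℕ) (ω : Ω) : Fin 2 × Fin (p + 1) → ℝ :=
  fun i => ∑ k ∈ subtree (n - 1) (p - 1), ε (2 * k + (i.1 : ℕ)) ω * regressor p X k ω i.2

/-- `M_nᵗ Σ_{n-1}⁻¹ M_n`. -/
def V (p : ℕ) (X ε : ℕ → Ω → ℝ) (c : ℕ → Ω → ℝ) (n : ℕ) (ω : Ω) : ℝ :=
  M p X ε n ω ⬝ᵥ ((bigSigma p X c (n - 1) ω)⁻¹ *ᵥ M p X ε n ω)

/-! ### Hypotheses on the noise -/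

variable [MeasurableSpace Ω]

/-- The random variables `f_k`, `k ∈ s`, are (mutually) conditionally independent given the
sigma-algebra `m`. (Taking some of the `B_k` to be the whole space gives the product formula for
sub-families; no assumption on the underlying probability space is needed.) -/
def CondIndepFamily {E : Type*} [MeasurableSpace E] (μ : Measure Ω) (m : MeasurableSpace Ω)
    (s : Finset ℕ) (f : ℕ → Ω → E) : Prop :=
  ∀ B : ℕ → Set E, (∀ k ∈ s, MeasurableSet (B k)) →
    μ⟦⋂ k ∈ s, f k ⁻¹' B k | m⟧ =ᵐ[μ] ∏ k ∈ s, μ⟦f k ⁻¹' B k | m⟧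

/-- Conditionally centred noise with constant conditional variance `σ²`. -/
def H1 (p : ℕ) (X ε : ℕ → Ω → ℝ) (μ : Measure Ω) (σ : ℝ) : Prop :=
  0 < σ ^ 2 ∧ ∀ n, p - 1 ≤ n → ∀ k ∈ gen (n + 1),
    MemLp (ε k) 2 μ ∧
    μ[ε k | filt X n] =ᵐ[μ] (fun _ => 0) ∧
    μ[fun ω => ε k ω ^ 2 | filt X n] =ᵐ[μ] (fun _ => σ ^ 2)

/-- Sisters have conditional covariance `ρ`; the sister pairs of a generation are conditionally
independent given the past generations. -/
def H2 (p : ℕ) (X ε : ℕ → Ω → ℝ) (μ : Measure Ω) (σ ρ : ℝ) : Prop :=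
  |ρ| < σ ^ 2 ∧ ∀ n, p - 1 ≤ n →
    (∀ k ∈ gen (n + 1), ∀ l ∈ gen (n + 1), k ≠ l → k / 2 = l / 2 →
      μ[fun ω => ε k ω * ε l ω | filt X n] =ᵐ[μ] (fun _ => ρ)) ∧
    CondIndepFamily μ (filt X n) (gen n) (fun k ω => (ε (2 * k) ω, ε (2 * k + 1) ω))

/-- The `q`-th moments are finite and the conditional `q`-th moments are almost surely bounded,
by a bound that may be random. Used with `q = 4` and `q = 8`. -/
def CondMomentBound (p : ℕ) (X ε : ℕ → Ω → ℝ) (μ : Measure Ω) (q : ℕ) : Prop :=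
  (∀ n, p - 1 ≤ n → ∀ k ∈ gen (n + 1), MemLp (ε k) q μ) ∧
  ∀ᵐ ω ∂μ, ∃ C : ℝ, ∀ n, p - 1 ≤ n → ∀ k ∈ gen (n + 1),
    (μ[fun ω' => ε k ω' ^ q | filt X n]) ω ≤ C

/-- Almost surely bounded conditional fourth moments. -/
def H3 (p : ℕ) (X ε : ℕ → Ω → ℝ) (μ : Measure Ω) : Prop := CondMomentBound p X ε μ 4

/-- Constant conditional fourth moments `τ⁴` and `ν²`. -/
def H4 (p : ℕ) (X ε : ℕ → Ω → ℝ) (μ : Measure Ω) (τ ν : ℝ) : Prop :=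
  0 < τ ^ 4 ∧ ν ^ 2 < τ ^ 4 ∧ ∀ n, p - 1 ≤ n →
    (∀ k ∈ gen (n + 1), μ[fun ω => ε k ω ^ 4 | filt X n] =ᵐ[μ] (fun _ => τ ^ 4)) ∧
    (∀ k ∈ gen (n + 1), ∀ l ∈ gen (n + 1), k ≠ l → k / 2 = l / 2 →
      μ[fun ω => ε k ω ^ 2 * ε l ω ^ 2 | filt X n] =ᵐ[μ] (fun _ => ν ^ 2))

/-- Almost surely bounded conditional eighth moments. -/
def H5 (p : ℕ) (X ε : ℕ → Ω → ℝ) (μ : Measure Ω) : Prop := CondMomentBound p X ε μ 8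

/-! ### The limiting matrices -/

/-- The conditional covariance matrix `Γ` of a sister pair. -/
def Γ (σ ρ : ℝ) : Matrix (Fin 2) (Fin 2) ℝ := !![σ ^ 2, ρ; ρ, σ ^ 2]

/-- The first vector of the canonical basis of `ℝ^p`. -/
def e1 (p : ℕ) : Fin p → ℝ := fun i => if (i : ℕ) = 0 then 1 else 0

/-- `λ = ā (I - Ā)⁻¹ e_1` with `ā = (a_0 + b_0)/2` and `Ā = (A + B)/2`. -/
def lam {p : ℕ} (a b : Fin (p + 1) → ℝ) : Fin p → ℝ :=
  ((a 0 + b 0) / 2) •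
    ((1 - (1 / 2 : ℝ) • (companion a + companion b))⁻¹ *ᵥ e1 p)

/-- `T = (σ² + (a_0² + b_0²)/2) e_1 e_1ᵗ
  + ½ (a_0 (A λ e_1ᵗ + e_1 λᵗ Aᵗ) + b_0 (B λ e_1ᵗ + e_1 λᵗ Bᵗ))`. -/
def T {p : ℕ} (a b : Fin (p + 1) → ℝ) (σ : ℝ) : Matrix (Fin p) (Fin p) ℝ :=
  (σ ^ 2 + (a 0 ^ 2 + b 0 ^ 2) / 2) • Matrix.vecMulVec (e1 p) (e1 p) +
    (1 / 2 : ℝ) •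
      (a 0 • (Matrix.vecMulVec (companion a *ᵥ lam a b) (e1 p) +
          Matrix.vecMulVec (e1 p) (companion a *ᵥ lam a b)) +
       b 0 • (Matrix.vecMulVec (companion b *ᵥ lam a b) (e1 p) +
          Matrix.vecMulVec (e1 p) (companion b *ᵥ lam a b)))

/-- The equation `ℓ = T + ½ (A ℓ Aᵗ + B ℓ Bᵗ)`. -/
def IsEll {p : ℕ} (a b : Fin (p + 1) → ℝ) (σ : ℝ) (ℓ : Matrix (Fin p) (Fin p) ℝ) : Prop :=
  ℓ = T a b σ + (1 / 2 : ℝ) •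
    (companion a * ℓ * (companion a)ᵀ + companion b * ℓ * (companion b)ᵀ)

/-- The block matrix `L` with rows `(1, λᵗ)` and `(λ, ℓ)`. -/
def L {p : ℕ} (a b : Fin (p + 1) → ℝ) (ℓ : Matrix (Fin p) (Fin p) ℝ) :
    Matrix (Fin (p + 1)) (Fin (p + 1)) ℝ :=
  Matrix.of (Fin.cons (Fin.cons 1 (lam a b)) (fun i => Fin.cons (lam a b i) (ℓ i)))

end

end BAR

/-!
# Limit theorems for bifurcating autoregressive processes

Let `q = p - 1`. Conditionally on the past of generation `n ≥ q`, the sister pairs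
`(ε_{2k}, ε_{2k+1})`, `k ∈ gen n`, are independent. `exists_noiseKernel` turns this into a statement
on laws: the joint law of the past and of the noise of a generation is a composition-product with a
kernel whose values are product measures. Every probabilistic estimate is therefore a computation
with finitely many independent centred pairs, whose coefficients are constants.

*Averages.* For a vector `u`, put `mart u n = u ⬝ᵥ M_n`. Its increment `incr u n` has second moment
`O(2^n)`, so that `incr u n / 2^n → 0` almost surely by Borel–Cantelli; after truncation to an event
of the past on which the conditional fourth moments are bounded, so do the averages of
`ε² - σ²`. The averages over a generation of the states `𝕏_k` and of `𝕏_k 𝕏_kᵗ` then satisfy, up to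
errors that vanish, the affine recursions whose fixed points are `λ` and `ℓ`. These recursions
contract, because the companion matrices do: `Setting.ae_tendsto_genAvg`. Hence
`S_{n-1} / 2^n → L`, and the conditional variance of `incr u n`, divided by `2^n`, tends to
`uᵗ (Γ ⊗ L) u`.

*Quadratic strong law.* With `x_n = (mart u n)² / 2^n` one has
`x_{n+1} = x_n / 2 + (D_n + W_n) / 2`, where `W_n` is the normalised conditional variance and `D_n` is
a normalised martingale increment. Truncated to the past, the `D_n` are orthogonal and bounded in
`L²`, so their averages tend to `0` (`ae_tendsto_average_of_orthogonal`), and those of `x_n` to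
`uᵗ (Γ ⊗ L) u`. By polarisation the averages of `M_n M_nᵗ / 2^n` tend to `Γ ⊗ L`, and
`2^n Σ_{n-1}⁻¹` tends to `I ⊗ L⁻¹`, which gives the limit `tr (Γ ⊗ I) = 2 (p + 1) σ²` for the
averages of `V_n`. As `V_n ≥ 0`, each `V_n` is at most the sum, hence `O(n)`. Only pathwise arguments
involve the regularisation of `S_n`, which need not be measurable.

*Central limit theorem.* Write `E_n(u)` for the distance at `u` between the characteristic function
of `M_n / √2 ^ n` and that of `𝒩(0, Γ ⊗ L)`. A Taylor expansion conditionally on the past gives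
`E_{n+1}(√2 u) ≤ E_n(u) + o(1)` (`Setting.charErr_succ_le`). Going back `k` generations replaces `u`
by `u / √2 ^ k`, where `E_n` is small uniformly in `n`; so `E_n → 0`, and Lévy's theorem concludes.
Here (H.4) bounds the fourth moments of the regressors.

*Limiting matrices.* The equation for `ℓ` is uniquely solvable because the powers of
`x ↦ (A x Aᵗ + B x Bᵗ) / 2` tend to `0`. The Schur complement `ℓ - λ λᵗ` of `L` solves a similar
equation whose right-hand side dominates `σ² e_1 e_1ᵗ`, and it is definite because the vectors
`Aᵏ e_1`, `k < p`, span the space (`posDef_L`).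
-/

set_option linter.unusedSectionVars false

namespace BAR

/-! ### Conditional laws of conditionally independent families -/

section CondProduct

variable {Ω Ω' ι E : Type*} [MeasurableSpace Ω] [MeasurableSpace Ω'] [Fintype ι]
  [MeasurableSpace E]

/-- The kernel whose value at `x` is the product of the probability measures `κ i x`. -/
noncomputable def piKernel (κ : ι → Kernel Ω' E) [∀ i, IsMarkovKernel (κ i)] :
    Kernel Ω' (ι → E) where
  toFun x := Measure.pi fun i => κ i x
  measurable' := by
    refine Measurable.measure_of_isPiSystem_of_isProbabilityMeasure generateFrom_pi.symm
      isPiSystem_pi ?_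
    rintro _ ⟨s, hs, rfl⟩
    simp only [Measure.pi_pi]
    exact Finset.measurable_prod _ fun i _ => (κ i).measurable_coe (hs i (Set.mem_univ i))

lemma piKernel_apply (κ : ι → Kernel Ω' E) [∀ i, IsMarkovKernel (κ i)] (x : Ω') :
    piKernel κ x = Measure.pi fun i => κ i x := rfl

instance (κ : ι → Kernel Ω' E) [∀ i, IsMarkovKernel (κ i)] : IsMarkovKernel (piKernel κ) :=
  ⟨fun x => by rw [piKernel_apply]; infer_instance⟩

variable {μ : Measure Ω} [IsProbabilityMeasure μ] {X : Ω → Ω'} {ξ : ι → Ω → E}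

/-- For a family which is conditionally independent given `X`, the joint law of `X` and the family
is obtained from the law of `X` and the product of the conditional laws of the members. -/
theorem map_eq_compProd_piKernel [StandardBorelSpace E] [Nonempty E]
    (hX : Measurable X) (hξ : ∀ i, Measurable (ξ i))
    (hind : ∀ B : ι → Set E, (∀ i, MeasurableSet (B i)) →
      μ⟦⋂ i, ξ i ⁻¹' B i | MeasurableSpace.comap X inferInstance⟧ =ᵐ[μ]
        ∏ i, μ⟦ξ i ⁻¹' B i | MeasurableSpace.comap X inferInstance⟧) :
    μ.map (fun ω => (X ω, fun i => ξ i ω)) =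
      μ.map X ⊗ₘ piKernel fun i => condDistrib (ξ i) X μ := by
  have hmeas : Measurable fun ω => (X ω, fun i => ξ i ω) :=
    hX.prodMk (measurable_pi_lambda _ hξ)
  have : IsProbabilityMeasure (μ.map fun ω => (X ω, fun i => ξ i ω)) :=
    Measure.isProbabilityMeasure_map hmeas.aemeasurable
  have : IsProbabilityMeasure (μ.map X) := Measure.isProbabilityMeasure_map hX.aemeasurable
  refine ext_of_generate_finite
    (Set.image2 (· ×ˢ ·) {s : Set Ω' | MeasurableSet s}
      (Set.univ.pi '' Set.univ.pi fun _ : ι => {s : Set E | MeasurableSet s}))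
    (generateFrom_eq_prod MeasurableSpace.generateFrom_measurableSet generateFrom_pi
      isCountablySpanning_measurableSet
      (IsCountablySpanning.pi fun _ => isCountablySpanning_measurableSet)).symm
    (IsPiSystem.prod MeasurableSpace.isPiSystem_measurableSet isPiSystem_pi) ?_ (by simp)
  rintro _ ⟨A, hA, _, ⟨B, hB, rfl⟩, rfl⟩
  have hA : MeasurableSet A := hA
  have hB : ∀ i, MeasurableSet (B i) := fun i => hB i (Set.mem_univ i)
  rw [Measure.compProd_apply_prod hA (MeasurableSet.univ_pi hB),
    Measure.map_apply hmeas (hA.prod (MeasurableSet.univ_pi hB))]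
  have hpre : (fun ω => (X ω, fun i => ξ i ω)) ⁻¹' (A ×ˢ Set.univ.pi B) =
      (⋂ i, ξ i ⁻¹' B i) ∩ X ⁻¹' A := by
    ext ω; simp [and_comm]
  have hI : MeasurableSet (⋂ i, ξ i ⁻¹' B i) := MeasurableSet.iInter fun i => hξ i (hB i)
  rw [hpre, setLIntegral_map hA (Kernel.measurable_coe _ (MeasurableSet.univ_pi hB)) hX]
  have hae : ∀ᵐ ω ∂μ, piKernel (fun i => condDistrib (ξ i) X μ) (X ω) (Set.univ.pi B) =
      ENNReal.ofReal ((μ⟦⋂ i, ξ i ⁻¹' B i | MeasurableSpace.comap X inferInstance⟧) ω) := by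
    have h1 : ∀ i, (fun a => (condDistrib (ξ i) X μ (X a)).real (B i)) =ᵐ[μ]
        μ⟦ξ i ⁻¹' B i | MeasurableSpace.comap X inferInstance⟧ :=
      fun i => condDistrib_ae_eq_condExp hX (hξ i) (hB i)
    filter_upwards [hind B hB, ae_all_iff.2 h1] with ω h2 h3
    rw [h2, Finset.prod_apply, piKernel_apply, Measure.pi_pi,
      ENNReal.ofReal_prod_of_nonneg fun i _ => by rw [← h3 i]; exact measureReal_nonneg]
    refine Finset.prod_congr rfl fun i _ => ?_
    rw [← h3 i, ofReal_measureReal]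
  rw [lintegral_congr_ae (ae_restrict_of_ae hae), ← ofReal_integral_eq_lintegral_ofReal
    integrable_condExp.integrableOn (ae_restrict_of_ae (condExp_nonneg (by
      exact Filter.Eventually.of_forall fun ω => Set.indicator_nonneg (by simp) _)))]
  rw [setIntegral_condExp hX.comap_le ((integrable_const _).indicator hI) ⟨A, hA, rfl⟩,
    setIntegral_indicator hI]
  simp [Set.inter_comm]

variable {κ : ι → Kernel Ω' E} [∀ i, IsMarkovKernel (κ i)]

/-- Integration of a nonnegative function of `X` and the family, in two steps: if the inner
integrals are dominated by an integrable function, then the function is integrable. -/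
theorem integrable_and_integral_le_of_condLaw (hX : Measurable X) (hξ : ∀ i, Measurable (ξ i))
    (hκ : μ.map (fun ω => (X ω, fun i => ξ i ω)) = μ.map X ⊗ₘ piKernel κ)
    {f : Ω' × (ι → E) → ℝ} (hf : Measurable f) (hf0 : ∀ z, 0 ≤ f z) {g : Ω → ℝ}
    (hg : Integrable g μ)
    (hfg : ∀ᵐ ω ∂μ, Integrable (fun x => f (X ω, x)) (Measure.pi fun i => κ i (X ω)) ∧
      ∫ x, f (X ω, x) ∂(Measure.pi fun i => κ i (X ω)) ≤ g ω) :
    Integrable (fun ω => f (X ω, fun i => ξ i ω)) μ ∧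
      ∫ ω, f (X ω, fun i => ξ i ω) ∂μ ≤ ∫ ω, g ω ∂μ := by
  have hmeas : Measurable fun ω => (X ω, fun i => ξ i ω) :=
    hX.prodMk (measurable_pi_lambda _ hξ)
  have : IsProbabilityMeasure (μ.map X) := Measure.isProbabilityMeasure_map hX.aemeasurable
  have hfi : Measurable fun ω => f (X ω, fun i => ξ i ω) := hf.comp hmeas
  have hg0 : 0 ≤ᵐ[μ] g := by
    filter_upwards [hfg] with ω h using (integral_nonneg fun x => hf0 _).trans h.2
  have key : ∫⁻ ω, ENNReal.ofReal (f (X ω, fun i => ξ i ω)) ∂μ ≤ ∫⁻ ω, ENNReal.ofReal (g ω) ∂μ := by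
    have h1 : ∫⁻ ω, ENNReal.ofReal (f (X ω, fun i => ξ i ω)) ∂μ =
        ∫⁻ z, ENNReal.ofReal (f z) ∂(μ.map fun ω => (X ω, fun i => ξ i ω)) :=
      (lintegral_map hf.ennreal_ofReal hmeas).symm
    rw [h1, hκ, Measure.lintegral_compProd hf.ennreal_ofReal,
      lintegral_map hf.ennreal_ofReal.lintegral_kernel_prod_right' hX]
    refine lintegral_mono_ae ?_
    filter_upwards [hfg] with ω h
    rw [piKernel_apply, ← ofReal_integral_eq_lintegral_ofReal h.1
      (Eventually.of_forall fun x => hf0 _)]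
    exact ENNReal.ofReal_le_ofReal h.2
  have hint : Integrable (fun ω => f (X ω, fun i => ξ i ω)) μ := by
    refine ⟨hfi.aestronglyMeasurable, ?_⟩
    rw [hasFiniteIntegral_iff_ofReal (Eventually.of_forall fun ω => hf0 _)]
    refine key.trans_lt ?_
    rw [← hasFiniteIntegral_iff_ofReal hg0]
    exact hg.2
  refine ⟨hint, ?_⟩
  rw [integral_eq_lintegral_of_nonneg_ae (Eventually.of_forall fun ω => hf0 _) hint.1,
    integral_eq_lintegral_of_nonneg_ae hg0 hg.1]
  refine ENNReal.toReal_mono ?_ key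
  rw [← lt_top_iff_ne_top, ← hasFiniteIntegral_iff_ofReal hg0]
  exact hg.2

/-- Integration in two steps of a function of `X` and the family. -/
theorem integral_eq_of_condLaw {F : Type*} [NormedAddCommGroup F] [NormedSpace ℝ F]
    [MeasurableSpace F] [BorelSpace F] [SecondCountableTopology F]
    (hX : Measurable X) (hξ : ∀ i, Measurable (ξ i))
    (hκ : μ.map (fun ω => (X ω, fun i => ξ i ω)) = μ.map X ⊗ₘ piKernel κ)
    {f : Ω' × (ι → E) → F} (hf : Measurable f)
    (hint : Integrable (fun ω => f (X ω, fun i => ξ i ω)) μ) :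
    ∫ ω, f (X ω, fun i => ξ i ω) ∂μ =
      ∫ ω, ∫ x, f (X ω, x) ∂(Measure.pi fun i => κ i (X ω)) ∂μ := by
  have hmeas : Measurable fun ω => (X ω, fun i => ξ i ω) :=
    hX.prodMk (measurable_pi_lambda _ hξ)
  have : IsProbabilityMeasure (μ.map X) := Measure.isProbabilityMeasure_map hX.aemeasurable
  have hfs : StronglyMeasurable f := hf.stronglyMeasurable
  have h1 : ∫ ω, f (X ω, fun i => ξ i ω) ∂μ =
      ∫ z, f z ∂(μ.map fun ω => (X ω, fun i => ξ i ω)) :=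
    (integral_map hmeas.aemeasurable hfs.aestronglyMeasurable).symm
  have h2 : Integrable f (μ.map fun ω => (X ω, fun i => ξ i ω)) :=
    (integrable_map_measure hfs.aestronglyMeasurable hmeas.aemeasurable).2 hint
  rw [h1]
  rw [hκ] at h2 ⊢
  rw [Measure.integral_compProd h2, integral_map hX.aemeasurable]
  · rfl
  · exact (hfs.integral_kernel_prod_right' (κ := piKernel κ)).aestronglyMeasurable

end CondProduct

/-! ### Moments and characteristic functions of independent sums -/

section IndepSums

variable {ι : Type*} [Fintype ι] {E : Type*} [MeasurableSpace E] {ν : ι → Measure E}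
  [∀ i, IsProbabilityMeasure (ν i)] {h : ι → E → ℝ}

lemma memLp_sum_pi {q : ENNReal} (hq : ∀ i, MemLp (h i) q (ν i)) :
    MemLp (fun x : ι → E => ∑ i, h i (x i)) q (Measure.pi ν) :=
  memLp_finsetSum _ fun i _ => (hq i).comp_measurePreserving (measurePreserving_eval ν i)

lemma integral_sum_pi (hint : ∀ i, Integrable (h i) (ν i)) (h0 : ∀ i, ∫ e, h i e ∂(ν i) = 0) :
    ∫ x : ι → E, ∑ i, h i (x i) ∂(Measure.pi ν) = 0 := by
  rw [integral_finsetSum _ fun i _ => integrable_comp_eval (hint i)]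
  exact Finset.sum_eq_zero fun i _ => by rw [integral_comp_eval (hint i).1, h0 i]

lemma integral_sum_sq_pi (h2 : ∀ i, MemLp (h i) 2 (ν i)) (h0 : ∀ i, ∫ e, h i e ∂(ν i) = 0) :
    ∫ x : ι → E, (∑ i, h i (x i)) ^ 2 ∂(Measure.pi ν) = ∑ i, ∫ e, h i e ^ 2 ∂(ν i) := by
  have hv := variance_sum_pi h2
  have hsum : (∑ i, fun x : ι → E => h i (x i)) = fun x => ∑ i, h i (x i) := by
    ext x; simp
  rw [hsum, variance_of_integral_eq_zero (memLp_sum_pi h2).1.aemeasurable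
    (integral_sum_pi (fun i => (h2 i).integrable (by norm_num)) h0)] at hv
  rw [hv]
  exact Finset.sum_congr rfl fun i _ =>
    variance_of_integral_eq_zero (h2 i).1.aemeasurable (h0 i)

end IndepSums

section IndepSums

variable {ι : Type*} [Fintype ι] {E : Type*} [MeasurableSpace E] {ν : ι → Measure E}
  [∀ i, IsProbabilityMeasure (ν i)] {h : ι → E → ℝ}

lemma integrable_pow_of_memLp_four {Ω : Type*} [MeasurableSpace Ω] {P : Measure Ω}
    [IsProbabilityMeasure P] {f : Ω → ℝ} (hf : MemLp f 4 P) {j : ℕ} (hj : j ≤ 4) :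
    Integrable (fun ω => f ω ^ j) P := by
  have : MemLp f (j : ENNReal) P := hf.mono_exponent (by exact_mod_cast hj)
  have h := this.integrable_norm_pow'
  refine (h.mono' (hf.1.pow j) (Eventually.of_forall fun ω => ?_))
  simp [norm_pow]

/-- The second moment is at most the square root of the fourth. -/
lemma integral_sq_le_of_integral_pow_four_le {Ω : Type*} [MeasurableSpace Ω] {P : Measure Ω}
    [IsProbabilityMeasure P] {f : Ω → ℝ} (hf : MemLp f 4 P) {c : ℝ} (hc : 0 ≤ c)
    (h4 : ∫ ω, f ω ^ 4 ∂P ≤ c ^ 2) : ∫ ω, f ω ^ 2 ∂P ≤ c := by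
  have h2i := integrable_pow_of_memLp_four hf (j := 2) (by norm_num)
  have h4i := integrable_pow_of_memLp_four hf (j := 4) le_rfl
  set m := ∫ ω, f ω ^ 2 ∂P with hm
  have h0 : 0 ≤ ∫ ω, (f ω ^ 4 - 2 * m * f ω ^ 2 + m ^ 2) ∂P :=
    integral_nonneg fun ω => by
      have : f ω ^ 4 - 2 * m * f ω ^ 2 + m ^ 2 = (f ω ^ 2 - m) ^ 2 := by ring
      simp only [Pi.zero_apply, this]; positivity
  have hi : Integrable (fun ω => f ω ^ 4 - 2 * m * f ω ^ 2) P := h4i.sub (h2i.const_mul _)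
  rw [integral_add hi (integrable_const _),
    integral_sub h4i (h2i.const_mul _), integral_const_mul, ← hm] at h0
  simp only [integral_const, probReal_univ, smul_eq_mul, one_mul] at h0
  exact abs_le_of_sq_le_sq' (by nlinarith) hc |>.2

/-- The fourth moment of a sum of independent centred variables is of the order of the square of
its variance. -/
lemma integral_sum_pow_four_pi_le (h4 : ∀ i, MemLp (h i) 4 (ν i))
    (h0 : ∀ i, ∫ e, h i e ∂(ν i) = 0) {c : ι → ℝ} (hc : ∀ i, 0 ≤ c i)
    (hc4 : ∀ i, ∫ e, h i e ^ 4 ∂(ν i) ≤ c i ^ 2) :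
    ∫ x : ι → E, (∑ i, h i (x i)) ^ 4 ∂(Measure.pi ν) ≤ 3 * (∑ i, c i) ^ 2 := by
  classical
  set P := Measure.pi ν
  let Z : ι → (ι → E) → ℝ := fun i x => h i (x i)
  have hind : iIndepFun Z P := iIndepFun_pi fun i => (h4 i).1.aemeasurable
  have hZ4 : ∀ i, MemLp (Z i) 4 P := fun i =>
    (h4 i).comp_measurePreserving (measurePreserving_eval ν i)
  have hZ0 : ∀ i, ∫ x, Z i x ∂P = 0 := fun i => by
    rw [← h0 i]; exact integral_comp_eval (h4 i).1
  have hZc4 : ∀ i, ∫ x, Z i x ^ 4 ∂P ≤ c i ^ 2 := fun i => by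
    refine le_of_eq_of_le ?_ (hc4 i)
    exact integral_comp_eval (μ := ν) (f := fun e => h i e ^ 4) ((h4 i).1.pow 4)
  have hZc2 : ∀ i, ∫ x, Z i x ^ 2 ∂P ≤ c i := fun i =>
    integral_sq_le_of_integral_pow_four_le (hZ4 i) (hc i) (hZc4 i)
  suffices H : ∀ s : Finset ι, MemLp (fun x => ∑ i ∈ s, Z i x) 4 P ∧
      ∫ x, (∑ i ∈ s, Z i x) ∂P = 0 ∧ ∫ x, (∑ i ∈ s, Z i x) ^ 2 ∂P ≤ ∑ i ∈ s, c i ∧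
      ∫ x, (∑ i ∈ s, Z i x) ^ 4 ∂P ≤ 3 * (∑ i ∈ s, c i) ^ 2 from (H Finset.univ).2.2.2
  intro s
  induction s using Finset.induction_on with
  | empty => simp
  | insert a s ha ih =>
    obtain ⟨ih4, ih0, ihc2, ihc4⟩ := ih
    set S : (ι → E) → ℝ := fun x => ∑ i ∈ s, Z i x with hS
    have hSZ : IndepFun S (Z a) P := by
      have := hind.indepFun_finsetSum_of_notMem₀ (fun i => (hZ4 i).1.aemeasurable) ha
      convert this using 1
      ext x; simp [hS]
    have hmul : ∀ j k : ℕ, ∫ x, S x ^ j * Z a x ^ k ∂P =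
        (∫ x, S x ^ j ∂P) * ∫ x, Z a x ^ k ∂P := fun j k => by
      have := hSZ.comp (φ := fun t => t ^ j) (ψ := fun t => t ^ k) (by fun_prop) (by fun_prop)
      exact this.integral_mul_eq_mul_integral (ih4.1.pow j) ((hZ4 a).1.pow k)
    have hSp : ∀ {j : ℕ}, j ≤ 4 → Integrable (fun x => S x ^ j) P :=
      fun hj => integrable_pow_of_memLp_four ih4 hj
    have hZp : ∀ {j : ℕ}, j ≤ 4 → Integrable (fun x => Z a x ^ j) P :=
      fun hj => integrable_pow_of_memLp_four (hZ4 a) hj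
    have hmi : ∀ {j k : ℕ}, j ≤ 4 → k ≤ 4 → Integrable (fun x => S x ^ j * Z a x ^ k) P :=
      fun {j k} hj hk => by
        have := hSZ.comp (φ := fun t => t ^ j) (ψ := fun t => t ^ k) (by fun_prop) (by fun_prop)
        exact this.integrable_mul (hSp hj) (hZp hk)
    have hZa1 : ∫ x, Z a x ^ 1 ∂P = 0 := by simpa using hZ0 a
    have hS1 : ∫ x, S x ^ 1 ∂P = 0 := by simpa using ih0
    have hci : 0 ≤ ∑ i ∈ s, c i := Finset.sum_nonneg fun i _ => hc i
    have hS20 : 0 ≤ ∫ x, S x ^ 2 ∂P := integral_nonneg fun x => sq_nonneg _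
    have hZ20 : 0 ≤ ∫ x, Z a x ^ 2 ∂P := integral_nonneg fun x => sq_nonneg _
    simp only [Finset.sum_insert ha]
    refine ⟨(hZ4 a).add ih4, ?_, ?_, ?_⟩
    · rw [integral_add ((hZ4 a).integrable (by norm_num)) (ih4.integrable (by norm_num)), ih0,
        hZ0 a, add_zero]
    · have e : ∀ x, (Z a x + ∑ i ∈ s, Z i x) ^ 2 =
          Z a x ^ 2 + 2 * (S x ^ 1 * Z a x ^ 1) + S x ^ 2 := fun x => by simp only [hS]; ring
      simp_rw [e]
      have i1 := (hmi (j := 1) (k := 1) (by norm_num) (by norm_num)).const_mul 2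
      have i2 : Integrable (fun x => Z a x ^ 2 + 2 * (S x ^ 1 * Z a x ^ 1)) P :=
        (hZp (by norm_num)).add i1
      rw [integral_add i2 (hSp (by norm_num)), integral_add (hZp (by norm_num)) i1,
        integral_const_mul, hmul, hS1]
      linarith [hZc2 a]
    · have e : ∀ x, (Z a x + ∑ i ∈ s, Z i x) ^ 4 =
          Z a x ^ 4 + (4 * (S x ^ 1 * Z a x ^ 3) + (6 * (S x ^ 2 * Z a x ^ 2) +
            (4 * (S x ^ 3 * Z a x ^ 1) + S x ^ 4))) := fun x => by simp only [hS]; ring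
      simp_rw [e]
      have i1 := (hmi (j := 1) (k := 3) (by norm_num) (by norm_num)).const_mul 4
      have i2 := (hmi (j := 2) (k := 2) (by norm_num) (by norm_num)).const_mul 6
      have i3 := (hmi (j := 3) (k := 1) (by norm_num) (by norm_num)).const_mul 4
      have i4 := hSp (j := 4) le_rfl
      have i34 : Integrable (fun x => 4 * (S x ^ 3 * Z a x ^ 1) + S x ^ 4) P := i3.add i4
      have i234 : Integrable (fun x => 6 * (S x ^ 2 * Z a x ^ 2) +
          (4 * (S x ^ 3 * Z a x ^ 1) + S x ^ 4)) P := i2.add i34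
      have i1234 : Integrable (fun x => 4 * (S x ^ 1 * Z a x ^ 3) + (6 * (S x ^ 2 * Z a x ^ 2) +
          (4 * (S x ^ 3 * Z a x ^ 1) + S x ^ 4))) P := i1.add i234
      rw [integral_add (hZp le_rfl) i1234, integral_add i1 i234, integral_add i2 i34,
        integral_add i3 i4]
      simp only [integral_const_mul, hmul, hS1, hZa1]
      have := mul_le_mul ihc2 (hZc2 a) hZ20 hci
      nlinarith [hZc4 a]

/-- A Taylor bound whose error involves only the second and fourth powers: the natural third power
is split between them by means of a free parameter `δ`. -/
lemma norm_cexp_I_mul_sub_le (x : ℝ) {δ : ℝ} (hδ : 0 < δ) :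
    ‖Complex.exp (Complex.I * x) - (1 + Complex.I * x - (x : ℂ) ^ 2 / 2)‖ ≤
      2 * (δ * x ^ 2 + x ^ 4 / δ) := by
  have hx3 : 4 * |x| ^ 3 ≤ 2 * (δ * x ^ 2 + x ^ 4 / δ) := by
    have h : δ * x ^ 2 + x ^ 4 / δ - 2 * |x| ^ 3 = (δ - |x|) ^ 2 * x ^ 2 / δ := by
      rw [← sq_abs x, show x ^ 4 = |x| ^ 4 by rw [← abs_pow, abs_of_nonneg (by positivity)]]
      field_simp; ring
    have : 0 ≤ (δ - |x|) ^ 2 * x ^ 2 / δ := by positivity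
    linarith
  refine le_trans ?_ hx3
  have hnx : ‖Complex.I * (x : ℂ)‖ = |x| := by simp
  rcases le_or_gt |x| 1 with h | h
  · have := Complex.exp_bound (x := Complex.I * x) (by rw [hnx]; exact h) (n := 3) (by norm_num)
    rw [hnx] at this
    simp only [Finset.sum_range_succ, Finset.sum_range_zero, Nat.factorial] at this
    have e : Complex.exp (Complex.I * x) - (1 + Complex.I * x - (x : ℂ) ^ 2 / 2) =
        Complex.exp (Complex.I * x) - (0 + (Complex.I * x) ^ 0 / ((1 : ℕ) : ℂ) +
          (Complex.I * x) ^ 1 / ((0 + 1) * 1 : ℕ) +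
          (Complex.I * x) ^ 2 / ((1 + 1) * ((0 + 1) * 1) : ℕ)) := by
      push_cast; rw [mul_pow Complex.I (x : ℂ) 2, Complex.I_sq]; ring
    rw [e]
    refine this.trans ?_
    have : 0 ≤ |x| ^ 3 := by positivity
    norm_num
    linarith
  · have h1 : ‖Complex.exp (Complex.I * x) - (1 + Complex.I * x - (x : ℂ) ^ 2 / 2)‖ ≤
        1 + (1 + |x| + |x| ^ 2 / 2) := by
      refine (norm_sub_le _ _).trans (add_le_add (by rw [Complex.norm_exp_I_mul_ofReal]) ?_)
      refine (norm_sub_le _ _).trans (add_le_add ((norm_add_le _ _).trans ?_) ?_)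
      · simp
      · simp
    refine h1.trans ?_
    have h2 : |x| ≤ |x| ^ 3 := by nlinarith [sq_nonneg (|x|)]
    have h3 : |x| ^ 2 ≤ |x| ^ 3 := by nlinarith [sq_nonneg (|x|)]
    nlinarith

lemma norm_prod_sub_prod_le {ι : Type*} (s : Finset ι) (a b : ι → ℂ) (ha : ∀ i, ‖a i‖ ≤ 1)
    (hb : ∀ i, ‖b i‖ ≤ 1) : ‖∏ i ∈ s, a i - ∏ i ∈ s, b i‖ ≤ ∑ i ∈ s, ‖a i - b i‖ := by
  classical
  induction s using Finset.induction_on with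
  | empty => simp
  | insert j s hj ih =>
    rw [Finset.prod_insert hj, Finset.prod_insert hj, Finset.sum_insert hj]
    have e : a j * ∏ i ∈ s, a i - b j * ∏ i ∈ s, b i =
        (a j - b j) * ∏ i ∈ s, a i + b j * (∏ i ∈ s, a i - ∏ i ∈ s, b i) := by ring
    rw [e]
    refine (norm_add_le _ _).trans (add_le_add ?_ ?_)
    · rw [norm_mul, norm_prod]
      exact mul_le_of_le_one_right (norm_nonneg _)
        (Finset.prod_le_one (fun _ _ => norm_nonneg _) fun i _ => ha i)
    · rw [norm_mul]
      exact (mul_le_of_le_one_left (norm_nonneg _) (hb j)).trans ih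

lemma abs_exp_neg_sub_le {y : ℝ} (hy : 0 ≤ y) : |Real.exp (-y) - (1 - y)| ≤ y ^ 2 := by
  rw [abs_of_nonneg (by linarith [Real.add_one_le_exp (-y)])]
  rcases le_or_gt y 1 with h | h
  · have := Real.abs_exp_sub_one_sub_id_le (x := -y) (by rwa [abs_neg, abs_of_nonneg hy])
    have h2 := le_abs_self (Real.exp (-y) - 1 - -y)
    nlinarith
  · have : Real.exp (-y) ≤ 1 := Real.exp_le_one_iff.2 (by linarith)
    nlinarith

/-- A centred variable has almost the characteristic function of a Gaussian variable with the same
variance, up to an error controlled by its second and fourth moments. -/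
lemma norm_integral_cexp_sub_le {Ω : Type*} [MeasurableSpace Ω] {P : Measure Ω}
    [IsProbabilityMeasure P] {f : Ω → ℝ} (hf : MemLp f 4 P) (h0 : ∫ ω, f ω ∂P = 0) {δ : ℝ}
    (hδ : 0 < δ) :
    ‖∫ ω, Complex.exp (Complex.I * f ω) ∂P - (Real.exp (-(∫ ω, f ω ^ 2 ∂P) / 2) : ℂ)‖ ≤
      2 * δ * (∫ ω, f ω ^ 2 ∂P) + (2 / δ + 1) * ∫ ω, f ω ^ 4 ∂P := by
  have h1i : Integrable f P := hf.integrable (by norm_num)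
  have h2i := integrable_pow_of_memLp_four hf (j := 2) (by norm_num)
  have h4i := integrable_pow_of_memLp_four hf (j := 4) le_rfl
  set w := ∫ ω, f ω ^ 2 ∂P with hw
  set m := ∫ ω, f ω ^ 4 ∂P with hm
  have hw0 : 0 ≤ w := integral_nonneg fun ω => sq_nonneg _
  have hm0 : 0 ≤ m := integral_nonneg fun ω => by positivity
  have hwm : w ^ 2 ≤ m := by
    have := integral_sq_le_of_integral_pow_four_le hf (Real.sqrt_nonneg m)
      (by rw [Real.sq_sqrt hm0])
    calc w ^ 2 ≤ (Real.sqrt m) ^ 2 := pow_le_pow_left₀ hw0 this 2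
      _ = m := Real.sq_sqrt hm0
  have hexp : Integrable (fun ω => Complex.exp (Complex.I * f ω)) P := by
    refine (integrable_const (1 : ℝ)).mono' ?_ (Eventually.of_forall fun ω => ?_)
    · exact (by fun_prop : Continuous fun t : ℝ => Complex.exp (Complex.I * t)).comp_aestronglyMeasurable hf.1
    · rw [Complex.norm_exp_I_mul_ofReal]
  have hci : Integrable (fun ω => (f ω : ℂ)) P := h1i.ofReal
  have hci2 : Integrable (fun ω => ((f ω : ℂ)) ^ 2) P := by
    have := h2i.ofReal (𝕜 := ℂ)
    simpa using this
  have hpoly : ∫ ω, (1 + Complex.I * f ω - (f ω : ℂ) ^ 2 / 2) ∂P = ((1 - w / 2 : ℝ) : ℂ) := by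
    have hi : Integrable (fun ω => 1 + Complex.I * (f ω : ℂ)) P :=
      (integrable_const _).add (hci.const_mul _)
    rw [integral_sub hi (hci2.div_const _), integral_add (integrable_const _) (hci.const_mul _), integral_const_mul, integral_div,
      integral_complex_ofReal, h0]
    have : ∫ ω, (f ω : ℂ) ^ 2 ∂P = (w : ℂ) := by
      rw [hw, ← integral_complex_ofReal]; simp
    rw [this]; simp
  have hA : ‖∫ ω, Complex.exp (Complex.I * f ω) ∂P - ((1 - w / 2 : ℝ) : ℂ)‖ ≤
      2 * (δ * w + m / δ) := by
    have hi : Integrable (fun ω => 1 + Complex.I * (f ω : ℂ) - (f ω : ℂ) ^ 2 / 2) P :=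
      ((integrable_const _).add (hci.const_mul _)).sub (hci2.div_const _)
    rw [← hpoly, ← integral_sub hexp hi]
    refine (norm_integral_le_integral_norm _).trans ?_
    have : ∫ ω, 2 * (δ * f ω ^ 2 + f ω ^ 4 / δ) ∂P = 2 * (δ * w + m / δ) := by
      rw [integral_const_mul, integral_add (h2i.const_mul _) (h4i.div_const _),
        integral_const_mul, integral_div]
    rw [← this]
    exact integral_mono_of_nonneg (Eventually.of_forall fun ω => norm_nonneg _)
      (((h2i.const_mul _).add (h4i.div_const _)).const_mul _)
      (Eventually.of_forall fun ω => norm_cexp_I_mul_sub_le (f ω) hδ)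
  have hB : ‖((1 - w / 2 : ℝ) : ℂ) - (Real.exp (-w / 2) : ℂ)‖ ≤ m := by
    rw [← Complex.ofReal_sub, Complex.norm_real, Real.norm_eq_abs, abs_sub_comm, neg_div]
    refine (abs_exp_neg_sub_le (by positivity)).trans ?_
    nlinarith
  calc _ ≤ _ := norm_sub_le_norm_sub_add_norm_sub _ ((1 - w / 2 : ℝ) : ℂ) _
    _ ≤ 2 * (δ * w + m / δ) + m := add_le_add hA hB
    _ = _ := by ring

/-- Lindeberg's comparison: the characteristic function of a sum of independent centred variables
is close to that of a Gaussian variable with the same variance. -/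
lemma norm_integral_cexp_sum_pi_sub_le (h4 : ∀ i, MemLp (h i) 4 (ν i))
    (h0 : ∀ i, ∫ e, h i e ∂(ν i) = 0) {δ : ℝ} (hδ : 0 < δ) :
    ‖∫ x : ι → E, Complex.exp (Complex.I * (∑ i, h i (x i) : ℝ)) ∂(Measure.pi ν) -
        (Real.exp (-(∑ i, ∫ e, h i e ^ 2 ∂(ν i)) / 2) : ℂ)‖ ≤
      ∑ i, (2 * δ * (∫ e, h i e ^ 2 ∂(ν i)) + (2 / δ + 1) * ∫ e, h i e ^ 4 ∂(ν i)) := by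
  have e1 : ∀ x : ι → E, Complex.exp (Complex.I * (∑ i, h i (x i) : ℝ)) =
      ∏ i, Complex.exp (Complex.I * (h i (x i))) := fun x => by
    rw [← Complex.exp_sum]; push_cast; rw [Finset.mul_sum]
  simp_rw [e1]
  rw [integral_fintype_prod_eq_prod (fun i e => Complex.exp (Complex.I * (h i e)))]
  have e2 : (Real.exp (-(∑ i, ∫ e, h i e ^ 2 ∂(ν i)) / 2) : ℂ) =
      ∏ i, (Real.exp (-(∫ e, h i e ^ 2 ∂(ν i)) / 2) : ℂ) := by
    rw [← Complex.ofReal_prod, ← Real.exp_sum, ← Finset.sum_div, Finset.sum_neg_distrib]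
  rw [e2]
  refine (norm_prod_sub_prod_le _ _ _ (fun i => ?_) fun i => ?_).trans
    (Finset.sum_le_sum fun i _ => norm_integral_cexp_sub_le (h4 i) (h0 i) hδ)
  · refine (norm_integral_le_integral_norm _).trans ?_
    simp [Complex.norm_exp_I_mul_ofReal]
  · rw [Complex.norm_real, Real.norm_eq_abs, Real.abs_exp, Real.exp_le_one_iff]
    have : 0 ≤ ∫ e, h i e ^ 2 ∂(ν i) := integral_nonneg fun e => sq_nonneg _
    linarith

end IndepSums

/-! ### One generation of noise -/

/-- The moments of the conditional law of a sister pair: fourth moments are finite, the pair is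
centred with variances `σ²` and covariance `ρ`. -/
structure PairMoments (ν : Measure (ℝ × ℝ)) (σ ρ : ℝ) : Prop where
  fst4 : MemLp Prod.fst 4 ν
  snd4 : MemLp Prod.snd 4 ν
  fst0 : ∫ e, e.1 ∂ν = 0
  snd0 : ∫ e, e.2 ∂ν = 0
  fst2 : ∫ e, e.1 ^ 2 ∂ν = σ ^ 2
  snd2 : ∫ e, e.2 ^ 2 ∂ν = σ ^ 2
  cov : ∫ e, e.1 * e.2 ∂ν = ρ

/-- The quadratic form of the matrix `Γ`. -/
def quadΓ (σ ρ α β : ℝ) : ℝ := σ ^ 2 * α ^ 2 + 2 * ρ * (α * β) + σ ^ 2 * β ^ 2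

lemma quadΓ_nonneg {σ ρ : ℝ} (h : |ρ| < σ ^ 2) (α β : ℝ) : 0 ≤ quadΓ σ ρ α β := by
  unfold quadΓ
  obtain ⟨h1, h2⟩ := abs_lt.1 h
  nlinarith [mul_nonneg (by linarith : 0 ≤ σ ^ 2 + ρ) (sq_nonneg (α + β)),
    mul_nonneg (by linarith : 0 ≤ σ ^ 2 - ρ) (sq_nonneg (α - β))]

lemma quadΓ_le {σ ρ : ℝ} (h : |ρ| < σ ^ 2) (α β : ℝ) :
    quadΓ σ ρ α β ≤ 2 * σ ^ 2 * (α ^ 2 + β ^ 2) := by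
  unfold quadΓ
  obtain ⟨h1, h2⟩ := abs_lt.1 h
  nlinarith [mul_nonneg (by linarith : 0 ≤ σ ^ 2 + ρ) (sq_nonneg (α - β)),
    mul_nonneg (by linarith : 0 ≤ σ ^ 2 - ρ) (sq_nonneg (α + β))]

namespace PairMoments

variable {ν : Measure (ℝ × ℝ)} [IsProbabilityMeasure ν] {σ ρ : ℝ} (hν : PairMoments ν σ ρ)
include hν

lemma memLp_lin (α β : ℝ) : MemLp (fun e : ℝ × ℝ => α * e.1 + β * e.2) 4 ν :=
  (hν.fst4.const_mul α).add (hν.snd4.const_mul β)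

lemma integral_lin (α β : ℝ) : ∫ e, (α * e.1 + β * e.2) ∂ν = 0 := by
  rw [integral_add ((hν.fst4.integrable (by norm_num)).const_mul α)
    ((hν.snd4.integrable (by norm_num)).const_mul β), integral_const_mul, integral_const_mul,
    hν.fst0, hν.snd0]
  simp

lemma integral_lin_sq (α β : ℝ) : ∫ e, (α * e.1 + β * e.2) ^ 2 ∂ν = quadΓ σ ρ α β := by
  have i1 : Integrable (fun e : ℝ × ℝ => α ^ 2 * e.1 ^ 2) ν :=
    (integrable_pow_of_memLp_four hν.fst4 (j := 2) (by norm_num)).const_mul _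
  have i2 : Integrable (fun e : ℝ × ℝ => β ^ 2 * e.2 ^ 2) ν :=
    (integrable_pow_of_memLp_four hν.snd4 (j := 2) (by norm_num)).const_mul _
  have i3 : Integrable (fun e : ℝ × ℝ => 2 * (α * β) * (e.1 * e.2)) ν :=
    ((hν.fst4.mono_exponent (p := 2) (by norm_num)).integrable_mul
      (hν.snd4.mono_exponent (p := 2) (by norm_num))).const_mul _
  have i12 : Integrable (fun e : ℝ × ℝ => α ^ 2 * e.1 ^ 2 + 2 * (α * β) * (e.1 * e.2)) ν :=
    i1.add i3
  have e : ∀ e : ℝ × ℝ, (α * e.1 + β * e.2) ^ 2 =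
      α ^ 2 * e.1 ^ 2 + 2 * (α * β) * (e.1 * e.2) + β ^ 2 * e.2 ^ 2 := fun e => by ring
  simp_rw [e]
  rw [integral_add i12 i2, integral_add i1 i3, integral_const_mul, integral_const_mul,
    integral_const_mul, hν.fst2, hν.snd2, hν.cov, quadΓ]
  ring

lemma integral_lin_pow_four_le {K : ℝ} (h1 : ∫ e, e.1 ^ 4 ∂ν ≤ K) (h2 : ∫ e, e.2 ^ 4 ∂ν ≤ K)
    (α β : ℝ) :
    ∫ e, (α * e.1 + β * e.2) ^ 4 ∂ν ≤ 8 * K * (α ^ 2 + β ^ 2) ^ 2 := by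
  have i1 : Integrable (fun e : ℝ × ℝ => 8 * α ^ 4 * e.1 ^ 4) ν :=
    (integrable_pow_of_memLp_four hν.fst4 le_rfl).const_mul _
  have i2 : Integrable (fun e : ℝ × ℝ => 8 * β ^ 4 * e.2 ^ 4) ν :=
    (integrable_pow_of_memLp_four hν.snd4 le_rfl).const_mul _
  have hK : 0 ≤ K := le_trans (integral_nonneg fun e => by positivity) h1
  have i12 : Integrable (fun e : ℝ × ℝ => 8 * α ^ 4 * e.1 ^ 4 + 8 * β ^ 4 * e.2 ^ 4) ν :=
    i1.add i2
  calc ∫ e, (α * e.1 + β * e.2) ^ 4 ∂ν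
      ≤ ∫ e, (8 * α ^ 4 * e.1 ^ 4 + 8 * β ^ 4 * e.2 ^ 4) ∂ν := by
        refine integral_mono (integrable_pow_of_memLp_four (hν.memLp_lin α β) le_rfl) i12 fun e => ?_
        have := (even_two_mul 2).add_pow_le (R := ℝ) (a := α * e.1) (b := β * e.2)
        norm_num at this
        simp only
        nlinarith
    _ = 8 * α ^ 4 * ∫ e, e.1 ^ 4 ∂ν + 8 * β ^ 4 * ∫ e, e.2 ^ 4 ∂ν := by
        rw [integral_add i1 i2, integral_const_mul, integral_const_mul]
    _ ≤ 8 * α ^ 4 * K + 8 * β ^ 4 * K := by gcongr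
    _ ≤ _ := by nlinarith [mul_nonneg hK (mul_nonneg (sq_nonneg α) (sq_nonneg β))]

end PairMoments

section OneStep

variable {Ω Ω' ι : Type*} [MeasurableSpace Ω] [MeasurableSpace Ω'] [Fintype ι]
  {μ : Measure Ω} [IsProbabilityMeasure μ] {X : Ω → Ω'} {ξ : ι → Ω → ℝ × ℝ}
  {κ : ι → Kernel Ω' (ℝ × ℝ)} [∀ i, IsMarkovKernel (κ i)] {σ ρ : ℝ}

/-- The linear combination of a generation of noise with coefficients depending on the past. -/
def linNoise (α β : ι → Ω' → ℝ) (x : Ω') (e : ι → ℝ × ℝ) : ℝ :=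
  ∑ i, (α i x * (e i).1 + β i x * (e i).2)

/-- The conditional variance of `linNoise`. -/
def linVar (σ ρ : ℝ) (α β : ι → Ω' → ℝ) (x : Ω') : ℝ := ∑ i, quadΓ σ ρ (α i x) (β i x)

lemma linVar_nonneg (hρ : |ρ| < σ ^ 2) (α β : ι → Ω' → ℝ) (x : Ω') : 0 ≤ linVar σ ρ α β x :=
  Finset.sum_nonneg fun _ _ => quadΓ_nonneg hρ _ _

lemma linVar_le (hρ : |ρ| < σ ^ 2) (α β : ι → Ω' → ℝ) (x : Ω') :
    linVar σ ρ α β x ≤ 2 * σ ^ 2 * ∑ i, (α i x ^ 2 + β i x ^ 2) := by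
  rw [Finset.mul_sum]
  exact Finset.sum_le_sum fun _ _ => quadΓ_le hρ _ _

variable {α β : ι → Ω' → ℝ}

lemma measurable_linNoise (hα : ∀ i, Measurable (α i)) (hβ : ∀ i, Measurable (β i)) :
    Measurable fun z : Ω' × (ι → ℝ × ℝ) => linNoise α β z.1 z.2 := by
  unfold linNoise; fun_prop

lemma measurable_linVar (hα : ∀ i, Measurable (α i)) (hβ : ∀ i, Measurable (β i)) :
    Measurable (linVar σ ρ α β) := by
  unfold linVar quadΓ; fun_prop

section Pointwise

variable {x : Ω'} (hm : ∀ i, PairMoments (κ i x) σ ρ)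
include hm

lemma memLp_linNoise : MemLp (linNoise α β x) 4 (Measure.pi fun i => κ i x) :=
  memLp_sum_pi (h := fun i (e : ℝ × ℝ) => α i x * e.1 + β i x * e.2) fun i => (hm i).memLp_lin _ _

lemma integral_linNoise : ∫ e, linNoise α β x e ∂(Measure.pi fun i => κ i x) = 0 :=
  integral_sum_pi (h := fun i (e : ℝ × ℝ) => α i x * e.1 + β i x * e.2)
    (fun i => ((hm i).memLp_lin _ _).integrable (by norm_num)) fun i => (hm i).integral_lin _ _

lemma integral_linNoise_sq :
    ∫ e, linNoise α β x e ^ 2 ∂(Measure.pi fun i => κ i x) = linVar σ ρ α β x := by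
  unfold linNoise linVar
  rw [integral_sum_sq_pi (h := fun i (e : ℝ × ℝ) => α i x * e.1 + β i x * e.2)
    (fun i => ((hm i).memLp_lin _ _).mono_exponent (by norm_num)) fun i => (hm i).integral_lin _ _]
  exact Finset.sum_congr rfl fun i _ => (hm i).integral_lin_sq _ _

lemma integral_linNoise_pow_four_le {K : ℝ} (hK : 0 ≤ K) (h1 : ∀ i, ∫ e, e.1 ^ 4 ∂(κ i x) ≤ K)
    (h2 : ∀ i, ∫ e, e.2 ^ 4 ∂(κ i x) ≤ K) :
    ∫ e, linNoise α β x e ^ 4 ∂(Measure.pi fun i => κ i x) ≤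
      24 * K * (∑ i, (α i x ^ 2 + β i x ^ 2)) ^ 2 := by
  have := integral_sum_pow_four_pi_le (h := fun i (e : ℝ × ℝ) => α i x * e.1 + β i x * e.2)
    (ν := fun i => κ i x) (c := fun i => Real.sqrt (8 * K) * (α i x ^ 2 + β i x ^ 2))
    (fun i => (hm i).memLp_lin _ _) (fun i => (hm i).integral_lin _ _) (fun i => by positivity)
    (fun i => by
      rw [mul_pow, Real.sq_sqrt (by positivity)]
      exact (hm i).integral_lin_pow_four_le (h1 i) (h2 i) _ _)
  refine this.trans (le_of_eq ?_)
  rw [← Finset.mul_sum, mul_pow, Real.sq_sqrt (by positivity)]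
  ring

/-- The compensated increment of the square of a martingale with increment `linNoise`. -/
lemma integral_sq_increment_le (hρ : |ρ| < σ ^ 2) {K : ℝ} (hK : 0 ≤ K)
    (h1 : ∀ i, ∫ e, e.1 ^ 4 ∂(κ i x) ≤ K) (h2 : ∀ i, ∫ e, e.2 ^ 4 ∂(κ i x) ≤ K) {C : ℝ}
    (hC : ∑ i, (α i x ^ 2 + β i x ^ 2) ≤ C) (m : ℝ) :
    Integrable (fun e => (2 * m * linNoise α β x e +
        (linNoise α β x e ^ 2 - linVar σ ρ α β x)) ^ 2) (Measure.pi fun i => κ i x) ∧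
      ∫ e, (2 * m * linNoise α β x e + (linNoise α β x e ^ 2 - linVar σ ρ α β x)) ^ 2
        ∂(Measure.pi fun i => κ i x) ≤ 16 * σ ^ 2 * C * m ^ 2 + 48 * K * C ^ 2 := by
  set P := Measure.pi fun i => κ i x
  have hL : MemLp (linNoise α β x) 4 P := memLp_linNoise hm
  set W := linVar σ ρ α β x with hW
  have hW0 : 0 ≤ W := linVar_nonneg hρ α β x
  have i2 := integrable_pow_of_memLp_four hL (j := 2) (by norm_num)
  have i4 := integrable_pow_of_memLp_four hL (j := 4) le_rfl
  have hdom : ∀ e, (2 * m * linNoise α β x e + (linNoise α β x e ^ 2 - W)) ^ 2 ≤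
      8 * m ^ 2 * linNoise α β x e ^ 2 + 2 * (linNoise α β x e ^ 4 - 2 * W * linNoise α β x e ^ 2
        + W ^ 2) := fun e => by
    nlinarith [sq_nonneg (2 * m * linNoise α β x e - (linNoise α β x e ^ 2 - W))]
  have j1 : Integrable (fun e => linNoise α β x e ^ 4 - 2 * W * linNoise α β x e ^ 2) P :=
    i4.sub (i2.const_mul _)
  have j2 : Integrable (fun e => linNoise α β x e ^ 4 - 2 * W * linNoise α β x e ^ 2 + W ^ 2) P :=
    j1.add (integrable_const _)
  have j3 : Integrable (fun e => 8 * m ^ 2 * linNoise α β x e ^ 2 + 2 * (linNoise α β x e ^ 4 -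
      2 * W * linNoise α β x e ^ 2 + W ^ 2)) P := (i2.const_mul _).add (j2.const_mul _)
  refine ⟨j3.mono' ?_ (Eventually.of_forall fun e => ?_), ?_⟩
  · exact ((hL.1.const_mul _).add ((hL.1.pow 2).sub aestronglyMeasurable_const)).pow 2
  · rw [Real.norm_of_nonneg (sq_nonneg _)]; exact hdom e
  · refine (integral_mono_of_nonneg (Eventually.of_forall fun e => sq_nonneg _) j3
      (Eventually.of_forall hdom)).trans ?_
    rw [integral_add (i2.const_mul _) (j2.const_mul _), integral_const_mul, integral_const_mul,
      integral_add j1 (integrable_const _), integral_sub i4 (i2.const_mul _), integral_const_mul]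
    have e2 : ∫ e, linNoise α β x e ^ 2 ∂P = W := integral_linNoise_sq hm
    have e4 := integral_linNoise_pow_four_le (α := α) (β := β) hm hK h1 h2
    rw [e2]
    simp only [integral_const, probReal_univ, smul_eq_mul, one_mul]
    have hs0 : 0 ≤ ∑ i, (α i x ^ 2 + β i x ^ 2) := Finset.sum_nonneg fun i _ => by positivity
    have hWC : W ≤ 2 * σ ^ 2 * C := (linVar_le hρ α β x).trans (by gcongr)
    have hCC : (∑ i, (α i x ^ 2 + β i x ^ 2)) ^ 2 ≤ C ^ 2 := pow_le_pow_left₀ hs0 hC 2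
    have := mul_le_mul_of_nonneg_left hWC (by positivity : 0 ≤ 8 * m ^ 2)
    have := mul_le_mul_of_nonneg_left hCC (by positivity : 0 ≤ 24 * K)
    have e4' : ∫ e, linNoise α β x e ^ 4 ∂P ≤ 24 * K * C ^ 2 := e4.trans this
    nlinarith [sq_nonneg W]

end Pointwise

variable (hX : Measurable X) (hξ : ∀ i, Measurable (ξ i))
  (hκ : μ.map (fun ω => (X ω, fun i => ξ i ω)) = μ.map X ⊗ₘ piKernel κ)
  (hm : ∀ᵐ ω ∂μ, ∀ i, PairMoments (κ i (X ω)) σ ρ)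
  (hα : ∀ i, Measurable (α i)) (hβ : ∀ i, Measurable (β i))
include hX hξ hκ hm hα hβ

lemma integral_linNoise_sq_le (hint : Integrable (fun ω => linVar σ ρ α β (X ω)) μ) :
    Integrable (fun ω => linNoise α β (X ω) (fun i => ξ i ω) ^ 2) μ ∧
      ∫ ω, linNoise α β (X ω) (fun i => ξ i ω) ^ 2 ∂μ ≤ ∫ ω, linVar σ ρ α β (X ω) ∂μ := by
  refine integrable_and_integral_le_of_condLaw hX hξ hκ
    (f := fun z => linNoise α β z.1 z.2 ^ 2) ((measurable_linNoise hα hβ).pow_const 2)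
    (fun z => sq_nonneg _) hint ?_
  filter_upwards [hm] with ω h
  exact ⟨integrable_pow_of_memLp_four (memLp_linNoise h) (by norm_num),
    (integral_linNoise_sq h).le⟩

/-- Truncated compensated increments of the square of a martingale have bounded variance. The
event `A` belongs to the past. -/
lemma integral_sq_increment_indicator_le (hρ : |ρ| < σ ^ 2) {A : Set Ω'} (hA : MeasurableSet A)
    {K C : ℝ} (hK : 0 ≤ K)
    (hAK : ∀ᵐ ω ∂μ, X ω ∈ A → ∀ i, ∫ e, e.1 ^ 4 ∂(κ i (X ω)) ≤ K ∧ ∫ e, e.2 ^ 4 ∂(κ i (X ω)) ≤ K)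
    (hC0 : 0 ≤ C) (hAC : ∀ x ∈ A, ∑ i, (α i x ^ 2 + β i x ^ 2) ≤ C)
    {m : Ω' → ℝ} (hmm : Measurable m) (hm2 : Integrable (fun ω => m (X ω) ^ 2) μ) :
    Integrable (fun ω => (A.indicator (fun x => 2 * m x * linNoise α β x (fun i => ξ i ω) +
        (linNoise α β x (fun i => ξ i ω) ^ 2 - linVar σ ρ α β x)) (X ω)) ^ 2) μ ∧
      ∫ ω, (A.indicator (fun x => 2 * m x * linNoise α β x (fun i => ξ i ω) +
        (linNoise α β x (fun i => ξ i ω) ^ 2 - linVar σ ρ α β x)) (X ω)) ^ 2 ∂μ ≤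
      16 * σ ^ 2 * C * ∫ ω, m (X ω) ^ 2 ∂μ + 48 * K * C ^ 2 := by
  classical
  have hg : Integrable (fun ω => 16 * σ ^ 2 * C * m (X ω) ^ 2 + 48 * K * C ^ 2) μ :=
    (hm2.const_mul _).add (integrable_const _)
  have h := integrable_and_integral_le_of_condLaw hX hξ hκ
    (f := fun z => (A.indicator (fun x => 2 * m x * linNoise α β x z.2 +
        (linNoise α β x z.2 ^ 2 - linVar σ ρ α β x)) z.1) ^ 2) ?_ (fun z => sq_nonneg _) hg ?_
  · refine ⟨h.1, h.2.trans (le_of_eq ?_)⟩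
    rw [integral_add (hm2.const_mul _) (integrable_const _), integral_const_mul]
    simp
  · have e : (fun z : Ω' × (ι → ℝ × ℝ) => (A.indicator (fun x => 2 * m x * linNoise α β x z.2 +
        (linNoise α β x z.2 ^ 2 - linVar σ ρ α β x)) z.1) ^ 2) =
      (Prod.fst ⁻¹' A).indicator (fun z => (2 * m z.1 * linNoise α β z.1 z.2 +
        (linNoise α β z.1 z.2 ^ 2 - linVar σ ρ α β z.1)) ^ 2) := by
      ext z
      by_cases hz : z.1 ∈ A <;> simp [Set.indicator, hz]
    rw [e]
    have := measurable_linNoise hα hβ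
    have := measurable_linVar (σ := σ) (ρ := ρ) hα hβ
    exact Measurable.indicator (by fun_prop) (measurable_fst hA)
  · filter_upwards [hm, hAK] with ω h hAω
    by_cases hω : X ω ∈ A
    · simp only [Set.indicator_of_mem hω]
      exact integral_sq_increment_le h hρ hK (fun i => (hAω hω i).1) (fun i => (hAω hω i).2)
        (hAC _ hω) _
    · simp only [Set.indicator_of_notMem hω]
      refine ⟨by simp, ?_⟩
      simp only [ne_eq, OfNat.ofNat_ne_zero, not_false_eq_true, zero_pow, integral_zero]
      positivity

/-- The truncated compensated increments are orthogonal to the past. -/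
lemma integral_mul_increment_indicator_eq_zero {A : Set Ω'} (hA : MeasurableSet A)
    {m g : Ω' → ℝ} (hmm : Measurable m) (hg : Measurable g)
    (hint : Integrable (fun ω => g (X ω) * A.indicator (fun x => 2 * m x *
      linNoise α β x (fun i => ξ i ω) +
        (linNoise α β x (fun i => ξ i ω) ^ 2 - linVar σ ρ α β x)) (X ω)) μ) :
    ∫ ω, g (X ω) * A.indicator (fun x => 2 * m x * linNoise α β x (fun i => ξ i ω) +
        (linNoise α β x (fun i => ξ i ω) ^ 2 - linVar σ ρ α β x)) (X ω) ∂μ = 0 := by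
  classical
  rw [integral_eq_of_condLaw hX hξ hκ (f := fun z => g z.1 * A.indicator (fun x => 2 * m x *
    linNoise α β x z.2 + (linNoise α β x z.2 ^ 2 - linVar σ ρ α β x)) z.1) ?_ hint]
  · refine integral_eq_zero_of_ae ?_
    filter_upwards [hm] with ω h
    rw [integral_const_mul]
    by_cases hω : X ω ∈ A
    · simp only [Set.indicator_of_mem hω]
      have hL := memLp_linNoise (α := α) (β := β) h
      have i1 := (hL.integrable (by norm_num)).const_mul (2 * m (X ω))
      have i2 := integrable_pow_of_memLp_four hL (j := 2) (by norm_num)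
      have i3 : Integrable (fun e => linNoise α β (X ω) e ^ 2 - linVar σ ρ α β (X ω))
        (Measure.pi fun i => κ i (X ω)) := i2.sub (integrable_const _)
      rw [integral_add i1 i3, integral_const_mul, integral_linNoise h,
        integral_sub i2 (integrable_const _), integral_linNoise_sq h]
      simp
    · simp [Set.indicator_of_notMem hω]
  · have e : (fun z : Ω' × (ι → ℝ × ℝ) => A.indicator (fun x => 2 * m x * linNoise α β x z.2 +
        (linNoise α β x z.2 ^ 2 - linVar σ ρ α β x)) z.1) =
      (Prod.fst ⁻¹' A).indicator (fun z => (2 * m z.1 * linNoise α β z.1 z.2 +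
        (linNoise α β z.1 z.2 ^ 2 - linVar σ ρ α β z.1))) := by
      ext z
      by_cases hz : z.1 ∈ A <;> simp [Set.indicator, hz]
    refine (hg.comp measurable_fst).mul ?_
    rw [e]
    have := measurable_linNoise hα hβ
    have := measurable_linVar (σ := σ) (ρ := ρ) hα hβ
    exact Measurable.indicator (by fun_prop) (measurable_fst hA)

/-- One step of the central limit theorem: the increment `linNoise` may be replaced by an
independent Gaussian variable of variance `v`. -/
lemma norm_integral_cexp_add_linNoise_sub_le (hρ : |ρ| < σ ^ 2) {K : ℝ}
    (h4 : ∀ᵐ ω ∂μ, ∀ i, ∫ e, e.1 ^ 4 ∂(κ i (X ω)) ≤ K ∧ ∫ e, e.2 ^ 4 ∂(κ i (X ω)) ≤ K)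
    (h1i : Integrable (fun ω => linVar σ ρ α β (X ω)) μ)
    (h2i : Integrable (fun ω => ∑ i, (α i (X ω) ^ 2 + β i (X ω) ^ 2) ^ 2) μ)
    {m : Ω' → ℝ} (hmm : Measurable m) {v : ℝ} (hv : 0 ≤ v) {δ : ℝ} (hδ : 0 < δ) :
    ‖∫ ω, Complex.exp (Complex.I * (m (X ω) + linNoise α β (X ω) (fun i => ξ i ω) : ℝ)) ∂μ -
        (Real.exp (-v / 2) : ℂ) * ∫ ω, Complex.exp (Complex.I * m (X ω)) ∂μ‖ ≤
      2 * δ * (∫ ω, linVar σ ρ α β (X ω) ∂μ) +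
        (2 / δ + 1) * (8 * K) * (∫ ω, ∑ i, (α i (X ω) ^ 2 + β i (X ω) ^ 2) ^ 2 ∂μ) +
        ∫ ω, |Real.exp (-linVar σ ρ α β (X ω) / 2) - Real.exp (-v / 2)| ∂μ := by
  have hmL := measurable_linNoise hα hβ
  have hmV := measurable_linVar (σ := σ) (ρ := ρ) hα hβ
  have hmξ : Measurable fun ω => fun i => ξ i ω := measurable_pi_lambda _ hξ
  have hexp : ∀ t : ℝ, Real.exp (-t / 2) = Real.exp (-(t / 2)) := fun t => by rw [neg_div]
  have hiexp : Integrable (fun ω => |Real.exp (-linVar σ ρ α β (X ω) / 2) - Real.exp (-v / 2)|) μ := by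
    have hmVX : Measurable fun ω => linVar σ ρ α β (X ω) := hmV.comp hX
    refine (integrable_const (1 : ℝ)).mono' (Measurable.aestronglyMeasurable (by fun_prop))
      (Eventually.of_forall fun ω => ?_)
    rw [Real.norm_eq_abs, abs_abs, abs_le]
    have := linVar_nonneg hρ α β (X ω)
    have h1 : Real.exp (-linVar σ ρ α β (X ω) / 2) ≤ 1 := Real.exp_le_one_iff.2 (by linarith)
    have h2 : Real.exp (-v / 2) ≤ 1 := Real.exp_le_one_iff.2 (by linarith)
    constructor <;> linarith [Real.exp_pos (-linVar σ ρ α β (X ω) / 2), Real.exp_pos (-v / 2)]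
  have hbint : ∀ f : Ω → ℝ, Measurable f → Integrable (fun ω => Complex.exp (Complex.I * f ω)) μ :=
    fun f hf => (integrable_const (1 : ℝ)).mono'
      ((by fun_prop : Measurable fun ω => Complex.exp (Complex.I * f ω)).aestronglyMeasurable)
      (Eventually.of_forall fun ω => by rw [Complex.norm_exp_I_mul_ofReal])
  have hmΔ : Measurable fun ω => m (X ω) + linNoise α β (X ω) (fun i => ξ i ω) :=
    (hmm.comp hX).add (hmL.comp (hX.prodMk hmξ))
  have hstep := integral_eq_of_condLaw hX hξ hκ (f := fun z : Ω' × (ι → ℝ × ℝ) =>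
    Complex.exp (Complex.I * (m z.1 + linNoise α β z.1 z.2 : ℝ))) (by fun_prop) (hbint _ hmΔ)
  have hsplit : ∀ ω, ∫ e, Complex.exp (Complex.I * (m (X ω) + linNoise α β (X ω) e : ℝ))
      ∂(Measure.pi fun i => κ i (X ω)) = Complex.exp (Complex.I * m (X ω)) *
      ∫ e, Complex.exp (Complex.I * (linNoise α β (X ω) e : ℝ))
        ∂(Measure.pi fun i => κ i (X ω)) := fun ω => by
    rw [← integral_const_mul]
    refine integral_congr_ae (Eventually.of_forall fun e => ?_)
    simp only
    rw [← Complex.exp_add]; push_cast; ring_nf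
  simp only at hstep
  simp_rw [hsplit] at hstep
  rw [hstep, ← integral_const_mul]
  have hint1 : Integrable (fun ω => Complex.exp (Complex.I * m (X ω)) *
      ∫ e, Complex.exp (Complex.I * (linNoise α β (X ω) e : ℝ))
        ∂(Measure.pi fun i => κ i (X ω))) μ := by
    refine (integrable_const (1 : ℝ)).mono' ?_ (Eventually.of_forall fun ω => ?_)
    · refine AEStronglyMeasurable.mul (hbint _ (hmm.comp hX)).1 ?_
      have hs : StronglyMeasurable fun z : Ω' × (ι → ℝ × ℝ) =>
          Complex.exp (Complex.I * (linNoise α β z.1 z.2 : ℝ)) :=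
        Measurable.stronglyMeasurable (by fun_prop)
      exact ((hs.integral_kernel_prod_right' (κ := piKernel κ)).comp_measurable
        hX).aestronglyMeasurable
    · rw [norm_mul, Complex.norm_exp_I_mul_ofReal, one_mul]
      refine (norm_integral_le_integral_norm _).trans ?_
      simp [Complex.norm_exp_I_mul_ofReal]
  have hint2 : Integrable (fun ω => (Real.exp (-v / 2) : ℂ) * Complex.exp (Complex.I * m (X ω))) μ :=
    (hbint _ (hmm.comp hX)).const_mul _
  rw [← integral_sub hint1 hint2]
  refine (norm_integral_le_integral_norm _).trans ?_
  have hi12 : Integrable (fun ω => 2 * δ * linVar σ ρ α β (X ω) +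
      (2 / δ + 1) * (8 * K) * ∑ i, (α i (X ω) ^ 2 + β i (X ω) ^ 2) ^ 2) μ :=
    (h1i.const_mul _).add (h2i.const_mul _)
  have hi3 : Integrable (fun ω => 2 * δ * linVar σ ρ α β (X ω) +
      (2 / δ + 1) * (8 * K) * ∑ i, (α i (X ω) ^ 2 + β i (X ω) ^ 2) ^ 2 +
      |Real.exp (-linVar σ ρ α β (X ω) / 2) - Real.exp (-v / 2)|) μ := hi12.add hiexp
  rw [← integral_const_mul, ← integral_const_mul, ← integral_add (h1i.const_mul _)
    (h2i.const_mul _), ← integral_add hi12 hiexp]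
  refine integral_mono_ae (hint1.sub hint2).norm hi3 ?_
  filter_upwards [hm, h4] with ω h h4ω
  have e1 : Complex.exp (Complex.I * m (X ω)) * (∫ e, Complex.exp (Complex.I *
      (linNoise α β (X ω) e : ℝ)) ∂(Measure.pi fun i => κ i (X ω))) -
      (Real.exp (-v / 2) : ℂ) * Complex.exp (Complex.I * m (X ω)) =
      Complex.exp (Complex.I * m (X ω)) * ((∫ e, Complex.exp (Complex.I *
      (linNoise α β (X ω) e : ℝ)) ∂(Measure.pi fun i => κ i (X ω))) - (Real.exp (-v / 2) : ℂ)) := by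
    ring
  rw [e1, norm_mul, Complex.norm_exp_I_mul_ofReal, one_mul]
  refine (norm_sub_le_norm_sub_add_norm_sub _
    (Real.exp (-linVar σ ρ α β (X ω) / 2) : ℂ) _).trans (add_le_add ?_ ?_)
  · have hc := norm_integral_cexp_sum_pi_sub_le (ν := fun i => κ i (X ω))
      (h := fun i e => α i (X ω) * e.1 + β i (X ω) * e.2) (fun i => (h i).memLp_lin _ _)
      (fun i => (h i).integral_lin _ _) hδ
    simp only [fun i => (h i).integral_lin_sq (α i (X ω)) (β i (X ω))] at hc
    refine hc.trans ?_
    rw [Finset.sum_add_distrib, linVar, Finset.mul_sum, Finset.mul_sum]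
    refine add_le_add le_rfl (Finset.sum_le_sum fun i _ => ?_)
    have := (h i).integral_lin_pow_four_le (h4ω i).1 (h4ω i).2 (α i (X ω)) (β i (X ω))
    have := mul_le_mul_of_nonneg_left this (by positivity : 0 ≤ 2 / δ + 1)
    linarith
  · rw [← Complex.ofReal_sub, Complex.norm_real, Real.norm_eq_abs]

omit hα hβ in
/-- Truncated centred squares of the noise satisfy a variance bound. -/
lemma integral_sum_sq_sub_indicator_le {A : Set Ω'} (hA : MeasurableSet A) {K : ℝ} (hK : 0 ≤ K)
    {π : ℝ × ℝ → ℝ} (hπ : Measurable π)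
    (hπ4 : ∀ᵐ ω ∂μ, ∀ i, MemLp π 4 (κ i (X ω)) ∧ ∫ e, π e ^ 2 ∂(κ i (X ω)) = σ ^ 2)
    (hAK : ∀ᵐ ω ∂μ, X ω ∈ A → ∀ i, ∫ e, π e ^ 4 ∂(κ i (X ω)) ≤ K) :
    Integrable (fun ω => (A.indicator (fun _ => ∑ i, (π (ξ i ω) ^ 2 - σ ^ 2)) (X ω)) ^ 2) μ ∧
    ∫ ω, (A.indicator (fun _ => ∑ i, (π (ξ i ω) ^ 2 - σ ^ 2)) (X ω)) ^ 2 ∂μ ≤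
      Fintype.card ι * K := by
  classical
  have h := integrable_and_integral_le_of_condLaw hX hξ hκ
    (f := fun z : Ω' × (ι → ℝ × ℝ) =>
      (A.indicator (fun _ => ∑ i, (π (z.2 i) ^ 2 - σ ^ 2)) z.1) ^ 2)
    (g := fun _ => Fintype.card ι * K) ?_ (fun z => sq_nonneg _) (integrable_const _) ?_
  · exact ⟨h.1, h.2.trans (le_of_eq (by simp))⟩
  · have e : (fun z : Ω' × (ι → ℝ × ℝ) => (A.indicator (fun _ => ∑ i, (π (z.2 i) ^ 2 - σ ^ 2))
        z.1) ^ 2) = (Prod.fst ⁻¹' A).indicator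
          (fun z : Ω' × (ι → ℝ × ℝ) => (∑ i, (π (z.2 i) ^ 2 - σ ^ 2)) ^ 2) := by
      ext z
      by_cases hz : z.1 ∈ A <;> simp [Set.indicator, hz]
    rw [e]
    exact Measurable.indicator (by fun_prop) (measurable_fst hA)
  · filter_upwards [hπ4, hAK] with ω h hAω
    by_cases hω : X ω ∈ A
    · simp only [Set.indicator_of_mem hω]
      have i2 : ∀ i, Integrable (fun e => π e ^ 2) (κ i (X ω)) :=
        fun i => integrable_pow_of_memLp_four (h i).1 (by norm_num)
      have i4 : ∀ i, Integrable (fun e => π e ^ 4) (κ i (X ω)) :=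
        fun i => integrable_pow_of_memLp_four (h i).1 le_rfl
      have e4 : ∀ e, (π e ^ 2 - σ ^ 2) ^ 2 = π e ^ 4 - 2 * σ ^ 2 * π e ^ 2 + (σ ^ 2) ^ 2 :=
        fun e => by ring
      have j1 : ∀ i, Integrable (fun e => π e ^ 4 - 2 * σ ^ 2 * π e ^ 2) (κ i (X ω)) :=
        fun i => (i4 i).sub ((i2 i).const_mul _)
      have hmem : ∀ i, MemLp (fun e => π e ^ 2 - σ ^ 2) 2 (κ i (X ω)) := fun i => by
        rw [memLp_two_iff_integrable_sq (by fun_prop)]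
        simp_rw [e4]
        exact (j1 i).add (integrable_const _)
      have hz : ∀ i, ∫ e, (π e ^ 2 - σ ^ 2) ∂(κ i (X ω)) = 0 := fun i => by
        rw [integral_sub (i2 i) (integrable_const _), (h i).2]; simp
      refine ⟨(memLp_two_iff_integrable_sq ?_).1 (memLp_sum_pi hmem), ?_⟩
      · exact (memLp_sum_pi hmem).1
      · rw [integral_sum_sq_pi hmem hz]
        refine (Finset.sum_le_card_nsmul _ _ K fun i _ => ?_).trans (le_of_eq (by simp))
        simp_rw [e4]
        rw [integral_add (j1 i) (integrable_const _), integral_sub (i4 i) ((i2 i).const_mul _),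
          integral_const_mul, (h i).2]
        simp only [integral_const, probReal_univ, smul_eq_mul, one_mul]
        nlinarith [hAω hω i, sq_nonneg (σ ^ 2)]
    · simp only [Set.indicator_of_notMem hω]
      refine ⟨by simp, ?_⟩
      simp only [ne_eq, OfNat.ofNat_ne_zero, not_false_eq_true, zero_pow, integral_zero]
      positivity

end OneStep

section CondMoments

variable {Ω Ω' : Type*} [MeasurableSpace Ω] [MeasurableSpace Ω'] {μ : Measure Ω}
  [IsProbabilityMeasure μ] {X : Ω → Ω'} {ξ : Ω → ℝ × ℝ} {σ ρ : ℝ}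

/-- Conditional expectations given `X` are integrals against the conditional law. -/
lemma ae_integral_condDistrib_eq {E : Type*} [MeasurableSpace E] [StandardBorelSpace E]
    [Nonempty E] {ζ : Ω → E} (hX : Measurable X) (hζ : Measurable ζ) {f : E → ℝ}
    (hf : Measurable f) (hint : Integrable (fun ω => f (ζ ω)) μ) {g : Ω → ℝ}
    (hg : μ[fun ω => f (ζ ω) | MeasurableSpace.comap X inferInstance] =ᵐ[μ] g) :
    ∀ᵐ ω ∂μ, Integrable f (condDistrib ζ X μ (X ω)) ∧ ∫ e, f e ∂(condDistrib ζ X μ (X ω)) = g ω := by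
  have h1 := condExp_ae_eq_integral_condDistrib hX hζ.aemeasurable hf.stronglyMeasurable hint
  have h2 : ∀ᵐ ω ∂μ, Integrable (fun e => f e) (condDistrib ζ X μ (X ω)) :=
    Integrable.condDistrib_ae (f := fun z : Ω' × E => f z.2) hX.aemeasurable hζ.aemeasurable
      ((integrable_map_measure (hf.comp measurable_snd).aestronglyMeasurable
        (hX.prodMk hζ).aemeasurable).2 hint)
  filter_upwards [h1, h2, hg] with ω h h' h''
  exact ⟨h', by rw [← h, h'']⟩

lemma memLp_four_of_integrable_pow {E : Type*} [MeasurableSpace E] {ν : Measure E} {f : E → ℝ}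
    (hf : Measurable f) (h : Integrable (fun e => f e ^ 4) ν) : MemLp f 4 ν := by
  rw [← integrable_norm_rpow_iff hf.aestronglyMeasurable (by norm_num) (by norm_num)]
  refine h.congr (Eventually.of_forall fun e => ?_)
  have : (4 : ENNReal).toReal = ((4 : ℕ) : ℝ) := by norm_num
  simp only [this, Real.rpow_natCast, Real.norm_eq_abs]
  rw [Even.pow_abs (by decide)]

lemma pairMoments_condDistrib (hX : Measurable X) (hξ : Measurable ξ)
    (h1 : MemLp (fun ω => (ξ ω).1) 4 μ) (h2 : MemLp (fun ω => (ξ ω).2) 4 μ)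
    (e1 : μ[fun ω => (ξ ω).1 | MeasurableSpace.comap X inferInstance] =ᵐ[μ] fun _ => 0)
    (e2 : μ[fun ω => (ξ ω).2 | MeasurableSpace.comap X inferInstance] =ᵐ[μ] fun _ => 0)
    (e11 : μ[fun ω => (ξ ω).1 ^ 2 | MeasurableSpace.comap X inferInstance] =ᵐ[μ] fun _ => σ ^ 2)
    (e22 : μ[fun ω => (ξ ω).2 ^ 2 | MeasurableSpace.comap X inferInstance] =ᵐ[μ] fun _ => σ ^ 2)
    (e12 : μ[fun ω => (ξ ω).1 * (ξ ω).2 | MeasurableSpace.comap X inferInstance] =ᵐ[μ]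
      fun _ => ρ) :
    ∀ᵐ ω ∂μ, PairMoments (condDistrib ξ X μ (X ω)) σ ρ := by
  have i12 : Integrable (fun ω => (ξ ω).1 * (ξ ω).2) μ :=
    (h1.mono_exponent (p := 2) (by norm_num)).integrable_mul
      (h2.mono_exponent (p := 2) (by norm_num))
  filter_upwards [
    ae_integral_condDistrib_eq hX hξ (f := fun e => e.1) (by fun_prop)
      (h1.integrable (by norm_num)) e1,
    ae_integral_condDistrib_eq hX hξ (f := fun e => e.2) (by fun_prop)
      (h2.integrable (by norm_num)) e2,
    ae_integral_condDistrib_eq hX hξ (f := fun e => e.1 ^ 2) (by fun_prop)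
      (integrable_pow_of_memLp_four h1 (by norm_num)) e11,
    ae_integral_condDistrib_eq hX hξ (f := fun e => e.2 ^ 2) (by fun_prop)
      (integrable_pow_of_memLp_four h2 (by norm_num)) e22,
    ae_integral_condDistrib_eq hX hξ (f := fun e => e.1 * e.2) (by fun_prop) i12 e12,
    ae_integral_condDistrib_eq hX hξ (f := fun e => e.1 ^ 4) (by fun_prop)
      (integrable_pow_of_memLp_four h1 le_rfl) EventuallyEq.rfl,
    ae_integral_condDistrib_eq hX hξ (f := fun e => e.2 ^ 4) (by fun_prop)
      (integrable_pow_of_memLp_four h2 le_rfl) EventuallyEq.rfl] with ω a1 a2 a3 a4 a5 a6 a7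
  exact ⟨memLp_four_of_integrable_pow measurable_fst a6.1,
    memLp_four_of_integrable_pow measurable_snd a7.1, a1.2, a2.2, a3.2, a4.2, a5.2⟩

end CondMoments

/-! ### The binary tree -/

lemma mem_gen {n k : ℕ} : k ∈ gen n ↔ 2 ^ n ≤ k ∧ k < 2 ^ (n + 1) := Finset.mem_Ico

lemma card_gen (n : ℕ) : (gen n).card = 2 ^ n := by
  rw [gen, Nat.card_Ico, pow_succ]; omega

lemma mem_tree {n k : ℕ} : k ∈ tree n ↔ 1 ≤ k ∧ k < 2 ^ (n + 1) := by
  induction n with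
  | zero => simp [tree, mem_gen]
  | succ n ih =>
    have : k ∈ tree (n + 1) ↔ k ∈ tree n ∨ k ∈ gen (n + 1) := by
      simp only [tree, Finset.mem_biUnion, Finset.mem_range]
      constructor
      · rintro ⟨i, hi, hk⟩
        rcases (Nat.lt_succ_iff_lt_or_eq.1 hi) with h | rfl
        · exact Or.inl ⟨i, h, hk⟩
        · exact Or.inr hk
      · rintro (⟨i, hi, hk⟩ | hk)
        · exact ⟨i, by omega, hk⟩
        · exact ⟨n + 1, by omega, hk⟩
    rw [this, ih, mem_gen]
    have := Nat.one_le_two_pow (n := n + 1)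
    have := pow_succ 2 (n + 1)
    omega

lemma card_tree (n : ℕ) : ((tree n).card : ℝ) = 2 ^ (n + 1) - 1 := by
  have : tree n = Finset.Ico 1 (2 ^ (n + 1)) := by ext k; rw [mem_tree, Finset.mem_Ico]
  rw [this, Nat.card_Ico, Nat.cast_sub Nat.one_le_two_pow]
  push_cast; ring

lemma sum_gen_succ {E : Type*} [AddCommMonoid E] (n : ℕ) (f : ℕ → E) :
    ∑ k ∈ gen (n + 1), f k = ∑ k ∈ gen n, (f (2 * k) + f (2 * k + 1)) := by
  have hp : 2 ^ (n + 1) = 2 * 2 ^ n := by ring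
  have hp' : 2 ^ (n + 2) = 2 * 2 ^ (n + 1) := by ring
  have hd : Set.PairwiseDisjoint (gen n : Set ℕ) fun k => ({2 * k, 2 * k + 1} : Finset ℕ) := by
    intro i _ j _ hij
    simp only [Function.onFun]
    rw [Finset.disjoint_left]
    intro x hx hx'
    simp only [Finset.mem_insert, Finset.mem_singleton] at hx hx'
    omega
  have : gen (n + 1) = (gen n).disjiUnion _ hd := by
    ext k
    simp only [Finset.mem_disjiUnion, mem_gen, Finset.mem_insert, Finset.mem_singleton]
    constructor
    · rintro ⟨h1, h2⟩
      exact ⟨k / 2, ⟨by omega, by omega⟩, by omega⟩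
    · rintro ⟨j, ⟨h1, h2⟩, h3⟩
      constructor <;> omega
  rw [this, Finset.sum_disjiUnion]
  exact Finset.sum_congr rfl fun k _ => Finset.sum_pair (by omega)

lemma mem_subtree {n q k : ℕ} : k ∈ subtree n q ↔ (1 ≤ k ∧ k < 2 ^ (n + 1)) ∧ 2 ^ q ≤ k := by
  rw [subtree, Finset.mem_filter, mem_tree]

lemma sum_subtree_succ {E : Type*} [AddCommMonoid E] {n q : ℕ} (h : q ≤ n + 1) (f : ℕ → E) :
    ∑ k ∈ subtree (n + 1) q, f k = ∑ k ∈ subtree n q, f k + ∑ k ∈ gen (n + 1), f k := by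
  rw [← Finset.sum_union]
  · refine Finset.sum_congr ?_ fun _ _ => rfl
    ext k
    rw [Finset.mem_union, mem_subtree, mem_subtree, mem_gen]
    have := Nat.one_le_two_pow (n := n + 1)
    have := pow_succ 2 (n + 1)
    have := Nat.pow_le_pow_right (n := 2) (by norm_num) h
    omega
  · rw [Finset.disjoint_left]
    intro k hk hk'
    rw [mem_subtree] at hk
    rw [mem_gen] at hk'
    omega

/-- The sample space with the sigma-algebra of the past up to generation `n`. -/
def Past {Ω : Type*} (_ : ℕ → Ω → ℝ) (_ : ℕ) : Type _ := Ω

instance {Ω : Type*} (X : ℕ → Ω → ℝ) (n : ℕ) : MeasurableSpace (Past X n) := filt X n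

/-- The identity map, as a map to `Past X n`. -/
def toPast {Ω : Type*} (X : ℕ → Ω → ℝ) (n : ℕ) : Ω → Past X n := id

lemma comap_toPast {Ω : Type*} (X : ℕ → Ω → ℝ) (n : ℕ) :
    MeasurableSpace.comap (toPast X n) inferInstance = filt X n := MeasurableSpace.comap_id

section Autoregression

variable {Ω : Type*} {X ε : ℕ → Ω → ℝ} {p : ℕ} {a b : Fin (p + 1) → ℝ}

lemma two_pow_eq {p : ℕ} (hp : 1 ≤ p) : 2 ^ p = 2 * 2 ^ (p - 1) := by
  obtain ⟨q, rfl⟩ : ∃ q, p = q + 1 := ⟨p - 1, by omega⟩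
  simp [pow_succ, mul_comm]

lemma measurable_filt {n k : ℕ} (hk : k ∈ tree n) : Measurable[filt X n] (X k) := by
  have : MeasurableSpace.comap (X k) inferInstance ≤ filt X n :=
    le_iSup₂ (f := fun k (_ : k ∈ tree n) => MeasurableSpace.comap (X k) inferInstance) k hk
  exact Measurable.of_comap_le this

lemma filt_mono {m n : ℕ} (h : m ≤ n) : filt X m ≤ filt X n := by
  refine iSup₂_le fun k hk => ?_
  refine le_iSup₂ (f := fun k (_ : k ∈ tree n) => MeasurableSpace.comap (X k) inferInstance) k ?_
  rw [mem_tree] at hk ⊢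
  exact ⟨hk.1, hk.2.trans_le (Nat.pow_le_pow_right (by norm_num) (by omega))⟩

lemma ancestor_pos {k i : ℕ} (hk : 2 ^ (p - 1) ≤ k) (hi : i < p) : 1 ≤ k / 2 ^ i := by
  rw [Nat.one_le_div_iff (by positivity)]
  exact (Nat.pow_le_pow_right (by norm_num) (by omega)).trans hk

lemma measurable_regressor_filt {n k : ℕ} (hk : 2 ^ (p - 1) ≤ k) (hkn : k < 2 ^ (n + 1))
    (j : Fin (p + 1)) : Measurable[filt X n] fun ω => regressor p X k ω j := by
  refine Fin.cases ?_ (fun i => ?_) j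
  · simp only [regressor, Fin.cons_zero]
    exact measurable_const
  · simp only [regressor, Fin.cons_succ]
    exact measurable_filt (mem_tree.2 ⟨ancestor_pos hk i.2, (Nat.div_le_self _ _).trans_lt hkn⟩)

lemma measurable_noise_filt (hp : 1 ≤ p) (hBAR : IsBAR p a b X ε) {n k : ℕ} (hk : 2 ^ p ≤ k)
    (hkn : k < 2 ^ (n + 1)) : Measurable[filt X n] (ε k) := by
  have hpp := two_pow_eq hp
  have hXk : Measurable[filt X n] (X k) :=
    measurable_filt (mem_tree.2 ⟨(Nat.one_le_two_pow).trans hk, hkn⟩)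
  have hj : 2 ^ (p - 1) ≤ k / 2 := by omega
  have hXj : ∀ i : Fin p, Measurable[filt X n] (X (k / 2 / 2 ^ (i : ℕ))) := fun i =>
    measurable_filt (mem_tree.2 ⟨ancestor_pos hj i.2,
      ((Nat.div_le_self _ _).trans (Nat.div_le_self _ _)).trans_lt hkn⟩)
  rcases Nat.even_or_odd' k with ⟨j, rfl | rfl⟩
  · have hj' : 2 * j / 2 = j := by omega
    rw [hj'] at hj hXj
    have : ε (2 * j) = fun ω => X (2 * j) ω - (a 0 + ∑ i : Fin p, a i.succ * X (j / 2 ^ (i : ℕ)) ω) := by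
      ext ω; rw [(hBAR j hj ω).1]; ring
    rw [this]
    exact hXk.sub (measurable_const.add (Finset.measurable_sum _ fun i _ => (hXj i).const_mul _))
  · have hj' : (2 * j + 1) / 2 = j := by omega
    rw [hj'] at hj hXj
    have : ε (2 * j + 1) = fun ω =>
        X (2 * j + 1) ω - (b 0 + ∑ i : Fin p, b i.succ * X (j / 2 ^ (i : ℕ)) ω) := by
      ext ω; rw [(hBAR j hj ω).2]; ring
    rw [this]
    exact hXk.sub (measurable_const.add (Finset.measurable_sum _ fun i _ => (hXj i).const_mul _))

lemma measurable_M_filt (hp : 1 ≤ p) (hBAR : IsBAR p a b X ε) {n : ℕ} (hn : 1 ≤ n)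
    (i : Fin 2 × Fin (p + 1)) : Measurable[filt X n] fun ω => M p X ε n ω i := by
  unfold M
  refine Finset.measurable_sum _ fun k hk => ?_
  rw [mem_subtree, Nat.sub_add_cancel hn] at hk
  have h2 : 2 ^ (n + 1) = 2 * 2 ^ n := by ring
  have hpp := two_pow_eq hp
  have hi : (i.1 : ℕ) < 2 := i.1.2
  exact (measurable_noise_filt hp hBAR (by omega) (by omega)).mul
    (measurable_regressor_filt hk.2 (by omega) i.2)

variable [MeasurableSpace Ω]

lemma filt_le (hX : ∀ k, 1 ≤ k → Measurable (X k)) (n : ℕ) : filt X n ≤ ‹MeasurableSpace Ω› :=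
  iSup₂_le fun k hk => (hX k (mem_tree.1 hk).1).comap_le

lemma measurable_toPast (hX : ∀ k, 1 ≤ k → Measurable (X k)) (n : ℕ) : Measurable (toPast X n) :=
  fun s hs => filt_le hX n s hs

lemma measurable_noise (hp : 1 ≤ p) (hX : ∀ k, 1 ≤ k → Measurable (X k))
    (hBAR : IsBAR p a b X ε) {k : ℕ} (hk : 2 ^ p ≤ k) : Measurable (ε k) :=
  (measurable_noise_filt (n := k) hp hBAR hk
    (k.lt_two_pow_self.trans_le (Nat.pow_le_pow_right (by norm_num) (by omega)))).mono
    (filt_le hX k) le_rfl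

/-- The sister pair born from `k`. -/
def sisters (ε : ℕ → Ω → ℝ) (k : ℕ) (ω : Ω) : ℝ × ℝ := (ε (2 * k) ω, ε (2 * k + 1) ω)

lemma daughters_mem_gen {n k : ℕ} (hk : k ∈ gen n) : 2 * k ∈ gen (n + 1) ∧ 2 * k + 1 ∈ gen (n + 1) := by
  rw [mem_gen] at hk
  have h1 : 2 ^ (n + 1) = 2 * 2 ^ n := by ring
  have h2 : 2 ^ (n + 1 + 1) = 2 * 2 ^ (n + 1) := by ring
  simp only [mem_gen]
  omega

lemma le_of_mem_gen {n k : ℕ} (hn : p - 1 ≤ n) (hk : k ∈ gen n) : 2 ^ (p - 1) ≤ k :=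
  (Nat.pow_le_pow_right (by norm_num) hn).trans (mem_gen.1 hk).1

lemma measurable_sisters (hp : 1 ≤ p) (hX : ∀ k, 1 ≤ k → Measurable (X k))
    (hBAR : IsBAR p a b X ε) {k : ℕ} (hk : 2 ^ (p - 1) ≤ k) : Measurable (sisters ε k) := by
  have := two_pow_eq hp
  exact (measurable_noise hp hX hBAR (by omega)).prodMk (measurable_noise hp hX hBAR (by omega))

variable {μ : Measure Ω} [IsProbabilityMeasure μ] {σ ρ : ℝ}

/-- The conditional law of a generation of noise given the past is a product of laws on `ℝ²`, whose
moments are prescribed by the hypotheses on the noise. -/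
theorem exists_noiseKernel (hp : 1 ≤ p) (hX : ∀ k, 1 ≤ k → Measurable (X k))
    (hBAR : IsBAR p a b X ε) (h1 : H1 p X ε μ σ) (h2 : H2 p X ε μ σ ρ) (h3 : H3 p X ε μ)
    {n : ℕ} (hn : p - 1 ≤ n) :
    ∃ (κ : gen n → Kernel (Past X n) (ℝ × ℝ)) (_ : ∀ i, IsMarkovKernel (κ i)),
      μ.map (fun ω => (toPast X n ω, fun i : gen n => sisters ε i ω)) =
        μ.map (toPast X n) ⊗ₘ piKernel κ ∧
      (∀ᵐ ω ∂μ, ∀ i, PairMoments (κ i (toPast X n ω)) σ ρ) ∧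
      (∀ᵐ ω ∂μ, ∀ i : gen n,
        ∫ e, e.1 ^ 4 ∂(κ i (toPast X n ω)) = μ[fun ω => ε (2 * i) ω ^ 4 | filt X n] ω ∧
        ∫ e, e.2 ^ 4 ∂(κ i (toPast X n ω)) = μ[fun ω => ε (2 * i + 1) ω ^ 4 | filt X n] ω) := by
  have hmX := measurable_toPast hX n
  have hms : ∀ i : gen n, Measurable (sisters ε i) := fun i =>
    measurable_sisters hp hX hBAR (le_of_mem_gen hn i.2)
  have hL : ∀ k ∈ gen (n + 1), MemLp (ε k) 4 μ := fun k hk => by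
    exact_mod_cast h3.1 n hn k hk
  refine ⟨fun i => condDistrib (sisters ε i) (toPast X n) μ, fun i => inferInstance, ?_, ?_, ?_⟩
  · refine map_eq_compProd_piKernel hmX hms fun B hB => ?_
    rw [comap_toPast]
    classical
    have hc := (h2.2 n hn).2 (fun k => if h : k ∈ gen n then B ⟨k, h⟩ else Set.univ)
      (fun k hk => by simp only [hk, dif_pos]; exact hB _)
    have e1 : (⋂ k ∈ gen n, (fun ω => (ε (2 * k) ω, ε (2 * k + 1) ω)) ⁻¹'
        (if h : k ∈ gen n then B ⟨k, h⟩ else Set.univ)) =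
        ⋂ i : gen n, sisters ε i ⁻¹' B i := by
      ext ω
      simp only [Set.mem_iInter, Set.mem_preimage, sisters, Subtype.forall]
      refine forall₂_congr fun k hk => ?_
      rw [dif_pos hk]
    rw [e1] at hc
    refine hc.trans (Eq.eventuallyEq ?_)
    rw [← Finset.prod_coe_sort]
    refine Finset.prod_congr rfl fun i _ => ?_
    simp only [dif_pos i.2]
    rfl
  · rw [ae_all_iff]
    intro i
    obtain ⟨hi1, hi2⟩ := daughters_mem_gen i.2
    refine pairMoments_condDistrib hmX (hms i) (hL _ hi1) (hL _ hi2) ?_ ?_ ?_ ?_ ?_ <;>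
      rw [comap_toPast]
    · exact (h1.2 n hn _ hi1).2.1
    · exact (h1.2 n hn _ hi2).2.1
    · exact (h1.2 n hn _ hi1).2.2
    · exact (h1.2 n hn _ hi2).2.2
    · exact (h2.2 n hn).1 _ hi1 _ hi2 (by omega) (by omega)
  · rw [ae_all_iff]
    intro i
    obtain ⟨hi1, hi2⟩ := daughters_mem_gen i.2
    filter_upwards [ae_integral_condDistrib_eq hmX (hms i) (f := fun e => e.1 ^ 4) (by fun_prop)
        (integrable_pow_of_memLp_four (hL _ hi1) le_rfl) (by rw [comap_toPast]),
      ae_integral_condDistrib_eq hmX (hms i) (f := fun e => e.2 ^ 4) (by fun_prop)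
        (integrable_pow_of_memLp_four (hL _ hi2) le_rfl) (by rw [comap_toPast])] with ω ha hb
    exact ⟨ha.2, hb.2⟩

end Autoregression

/-! ### Contractions and the equation for the limiting second moments -/

/-- A contraction perturbed by a vanishing error tends to zero. -/
lemma tendsto_zero_of_contraction {x e : ℕ → ℝ} {β : ℝ} (hβ0 : 0 ≤ β) (hβ : β < 1)
    (hx : ∀ n, 0 ≤ x n) (hrec : ∀ n, x (n + 1) ≤ β * x n + e n) (he : Tendsto e atTop (𝓝 0)) :
    Tendsto x atTop (𝓝 0) := by
  rw [Metric.tendsto_atTop]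
  intro r hr
  have hη : 0 < (1 - β) * (r / 2) := mul_pos (by linarith) (by linarith)
  obtain ⟨n₀, hn₀⟩ := (Metric.tendsto_atTop.1 he) _ hη
  have hk : ∀ k, x (n₀ + k) ≤ β ^ k * x n₀ + r / 2 := by
    intro k
    induction k with
    | zero => simp; linarith
    | succ k ih =>
      have h1 := hrec (n₀ + k)
      have h2 := hn₀ (n₀ + k) (by omega)
      rw [Real.dist_eq, sub_zero] at h2
      have h3 := le_abs_self (e (n₀ + k))
      have h4 := mul_le_mul_of_nonneg_left ih hβ0
      rw [← add_assoc, pow_succ]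
      nlinarith
  have hlim : Tendsto (fun k => β ^ k * x n₀) atTop (𝓝 0) := by
    simpa using (tendsto_pow_atTop_nhds_zero_of_lt_one hβ0 hβ).mul_const (x n₀)
  obtain ⟨k₀, hk₀⟩ := (Metric.tendsto_atTop.1 hlim) (r / 2) (by linarith)
  refine ⟨n₀ + k₀, fun n hn => ?_⟩
  obtain ⟨k, rfl⟩ : ∃ k, n = n₀ + k := ⟨n - n₀, by omega⟩
  have h1 := hk₀ k (by omega)
  rw [Real.dist_eq, sub_zero] at h1 ⊢
  have h2 := le_abs_self (β ^ k * x n₀)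
  rw [abs_of_nonneg (hx _)]
  linarith [hk k]

/-- A linear recursion whose linear part has geometrically decaying iterates, perturbed by a
vanishing error, tends to zero. -/
lemma tendsto_zero_of_linear_recursion {E : Type*} [AddCommGroup E] [Module ℝ E] (F : E →ₗ[ℝ] E)
    (s : E → ℝ) (hs0 : ∀ x, 0 ≤ s x) (hs : ∀ x y, s (x + y) ≤ s x + s y) {D γ : ℝ} (hγ0 : 0 ≤ γ)
    (hγ : γ < 1) (hF : ∀ k x, s ((F ^ k) x) ≤ D * γ ^ k * s x) (hD : 0 ≤ D) {x e : ℕ → E}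
    (hrec : ∀ n, x (n + 1) = F (x n) + e n)
    (he : Tendsto (fun n => s (e n)) atTop (𝓝 0)) : Tendsto (fun n => s (x n)) atTop (𝓝 0) := by
  let y : ℕ → ℝ := fun n => Nat.rec (D * s (x 0)) (fun n r => γ * r + D * s (e n)) n
  have hy1 : ∀ n, y (n + 1) = γ * y n + D * s (e n) := fun n => rfl
  have hy0 : ∀ n, 0 ≤ y n := fun n => by
    induction n with
    | zero => exact mul_nonneg hD (hs0 _)
    | succ n ih => rw [hy1]; have := hs0 (e n); positivity
  have hle : ∀ n k, s ((F ^ k) (x n)) ≤ γ ^ k * y n := by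
    intro n
    induction n with
    | zero =>
      intro k
      have hy00 : y 0 = D * s (x 0) := rfl
      rw [hy00]
      exact (hF k (x 0)).trans (le_of_eq (by ring))
    | succ n ih =>
      intro k
      rw [hrec, map_add, hy1]
      refine (hs _ _).trans ?_
      have h1 := ih (k + 1)
      rw [pow_succ F k] at h1
      have h2 := hF k (e n)
      simp only [Module.End.mul_apply] at h1
      rw [pow_succ] at h1
      nlinarith
  have hylim : Tendsto y atTop (𝓝 0) := by
    refine tendsto_zero_of_contraction hγ0 hγ hy0 (fun n => (hy1 n).le) ?_
    simpa using he.const_mul D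
  refine squeeze_zero (fun n => hs0 _) (fun n => ?_) hylim
  simpa using hle n 0

section Seminorm

variable {p : ℕ} (N : Seminorm ℝ (Fin p → ℝ))

lemma seminorm_le_sum (u : Fin p → ℝ) : N u ≤ ∑ i, |u i| * N (Pi.single i 1) := by
  conv_lhs => rw [pi_eq_sum_univ' u]
  refine (Finset.le_sum_of_subadditive N (map_zero N).le (map_add_le_add N) _ _).trans (Finset.sum_le_sum fun i _ => ?_)
  rw [map_smul_eq_mul, Real.norm_eq_abs]

lemma continuous_seminorm_pi : Continuous N := by
  have hb : ∀ u v, |N u - N v| ≤ ∑ i, |(u - v) i| * N (Pi.single i 1) := fun u v =>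
    (abs_sub_map_le_sub N u v).trans (seminorm_le_sum N _)
  rw [continuous_iff_continuousAt]
  intro v
  rw [ContinuousAt, tendsto_iff_dist_tendsto_zero]
  refine squeeze_zero (fun u => dist_nonneg) (fun u => hb u v) ?_
  have : Continuous fun u : Fin p → ℝ => ∑ i, |(u - v) i| * N (Pi.single i 1) := by fun_prop
  simpa using this.tendsto v

lemma exists_abs_le_mul_seminorm (hN : ∀ u, N u = 0 → u = 0) :
    ∃ c : ℝ, 0 ≤ c ∧ ∀ u i, |u i| ≤ c * N u := by
  rcases isEmpty_or_nonempty (Fin p) with h | h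
  · exact ⟨0, le_rfl, fun u i => h.elim i⟩
  have : Nontrivial (Fin p → ℝ) := Function.nontrivial
  obtain ⟨x, hx, hmin⟩ := (isCompact_sphere (0 : Fin p → ℝ) 1).exists_isMinOn
    ((NormedSpace.sphere_nonempty).2 zero_le_one) (continuous_seminorm_pi N).continuousOn
  have hx1 : ‖x‖ = 1 := by simpa using hx
  have hpos : 0 < N x := lt_of_le_of_ne (apply_nonneg N x) fun h0 => by
    have := hN x h0.symm
    rw [this] at hx1; simp at hx1
  refine ⟨(N x)⁻¹, by positivity, fun u i => ?_⟩
  rcases eq_or_ne u 0 with rfl | hu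
  · simp
  have hu' : 0 < ‖u‖ := norm_pos_iff.2 hu
  have h1 : N x ≤ N (‖u‖⁻¹ • u) := hmin (by simp [norm_smul, hu'.ne'])
  rw [map_smul_eq_mul, norm_inv, norm_norm, inv_mul_eq_div, le_div_iff₀ hu'] at h1
  have h2 : |u i| ≤ ‖u‖ := norm_le_pi_norm u i
  rw [inv_mul_eq_div, le_div_iff₀ hpos]
  nlinarith [abs_nonneg (u i)]

end Seminorm

/-- The map `ℓ ↦ ½ (A ℓ Aᵗ + B ℓ Bᵗ)`. -/
noncomputable def lyap {p : ℕ} (A B : Matrix (Fin p) (Fin p) ℝ) :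
    Matrix (Fin p) (Fin p) ℝ →ₗ[ℝ] Matrix (Fin p) (Fin p) ℝ where
  toFun ℓ := (1 / 2 : ℝ) • (A * ℓ * Aᵀ + B * ℓ * Bᵀ)
  map_add' x y := by simp only [Matrix.mul_add, Matrix.add_mul, smul_add]; abel
  map_smul' r x := by
    simp only [Matrix.mul_smul, Matrix.smul_mul, RingHom.id_apply, smul_add, smul_comm r]

lemma lyap_apply {p : ℕ} (A B ℓ : Matrix (Fin p) (Fin p) ℝ) :
    lyap A B ℓ = (1 / 2 : ℝ) • (A * ℓ * Aᵀ + B * ℓ * Bᵀ) := rfl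

/-- The sum of the absolute values of the entries. -/
def entrySum {p : ℕ} (x : Matrix (Fin p) (Fin p) ℝ) : ℝ := ∑ i, ∑ j, |x i j|

lemma entrySum_nonneg {p : ℕ} (x : Matrix (Fin p) (Fin p) ℝ) : 0 ≤ entrySum x :=
  Finset.sum_nonneg fun _ _ => Finset.sum_nonneg fun _ _ => abs_nonneg _

lemma entrySum_add {p : ℕ} (x y : Matrix (Fin p) (Fin p) ℝ) :
    entrySum (x + y) ≤ entrySum x + entrySum y := by
  unfold entrySum
  rw [← Finset.sum_add_distrib]
  refine Finset.sum_le_sum fun i _ => ?_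
  rw [← Finset.sum_add_distrib]
  exact Finset.sum_le_sum fun j _ => abs_add_le _ _

lemma abs_le_entrySum {p : ℕ} (x : Matrix (Fin p) (Fin p) ℝ) (i j : Fin p) :
    |x i j| ≤ entrySum x :=
  (Finset.single_le_sum (f := fun j => |x i j|) (fun _ _ => abs_nonneg _) (Finset.mem_univ j)).trans
    (Finset.single_le_sum (f := fun i => ∑ j, |x i j|)
      (fun _ _ => Finset.sum_nonneg fun _ _ => abs_nonneg _) (Finset.mem_univ i))

section Lyapunov

variable {p : ℕ} {A B : Matrix (Fin p) (Fin p) ℝ} {N : Seminorm ℝ (Fin p → ℝ)} {β c : ℝ}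

lemma lyap_vecMulVec (u v : Fin p → ℝ) : lyap A B (Matrix.vecMulVec u v) =
    (1 / 2 : ℝ) • Matrix.vecMulVec (A *ᵥ u) (A *ᵥ v) +
      (1 / 2 : ℝ) • Matrix.vecMulVec (B *ᵥ u) (B *ᵥ v) := by
  simp only [lyap_apply, Matrix.mul_vecMulVec, Matrix.vecMulVec_mul, Matrix.vecMul_transpose,
    smul_add]

/-- Iterates of `lyap A B` decay geometrically on rank one matrices, hence on all matrices. -/
lemma entrySum_lyap_pow_le (hβ0 : 0 ≤ β) (hA : ∀ u, N (A *ᵥ u) ≤ β * N u)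
    (hB : ∀ u, N (B *ᵥ u) ≤ β * N u) (hc0 : 0 ≤ c) (hc : ∀ u i, |u i| ≤ c * N u) :
    ∃ D, 0 ≤ D ∧ ∀ k x, entrySum ((lyap A B ^ k) x) ≤ D * (β ^ 2) ^ k * entrySum x := by
  have h1 : ∀ k u v i j, |(lyap A B ^ k) (Matrix.vecMulVec u v) i j| ≤
      c ^ 2 * (β ^ 2) ^ k * (N u * N v) := by
    intro k
    induction k with
    | zero =>
      intro u v i j
      simp only [pow_zero, Module.End.one_apply, Matrix.vecMulVec_apply, abs_mul]
      have := mul_le_mul (hc u i) (hc v j) (abs_nonneg _) (mul_nonneg hc0 (apply_nonneg N u))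
      linarith
    | succ k ih =>
      intro u v i j
      rw [pow_succ, Module.End.mul_apply, lyap_vecMulVec, map_add, map_smul, map_smul]
      simp only [Matrix.add_apply, Matrix.smul_apply, smul_eq_mul]
      have hAA := mul_le_mul (hA u) (hA v) (apply_nonneg N _) (mul_nonneg hβ0 (apply_nonneg N u))
      have hBB := mul_le_mul (hB u) (hB v) (apply_nonneg N _) (mul_nonneg hβ0 (apply_nonneg N u))
      have hcc : 0 ≤ c ^ 2 * (β ^ 2) ^ k := by positivity
      have hAA' := (ih (A *ᵥ u) (A *ᵥ v) i j).trans (mul_le_mul_of_nonneg_left hAA hcc)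
      have hBB' := (ih (B *ᵥ u) (B *ᵥ v) i j).trans (mul_le_mul_of_nonneg_left hBB hcc)
      refine (abs_add_le _ _).trans ?_
      rw [abs_mul, abs_mul, abs_of_pos (by norm_num : (0 : ℝ) < 1 / 2), pow_succ (β ^ 2)]
      linarith
  set m := ∑ i : Fin p, N (Pi.single i 1) with hm
  have hm0 : 0 ≤ m := Finset.sum_nonneg fun i _ => apply_nonneg N _
  have hmi : ∀ i : Fin p, N (Pi.single i 1) ≤ m := fun i =>
    Finset.single_le_sum (f := fun i => N (Pi.single i (1 : ℝ))) (fun _ _ => apply_nonneg N _)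
      (Finset.mem_univ i)
  refine ⟨p * p * (c ^ 2 * (m * m)), by positivity, fun k x => ?_⟩
  have hx : x = ∑ i, ∑ j, x i j • Matrix.vecMulVec (Pi.single i 1) (Pi.single j 1) := by
    conv_lhs => rw [Matrix.matrix_eq_sum_single x]
    refine Finset.sum_congr rfl fun i _ => Finset.sum_congr rfl fun j _ => ?_
    ext i' j'
    rw [Matrix.single_apply, Matrix.smul_apply, Matrix.vecMulVec_apply, Pi.single_apply,
      Pi.single_apply, smul_eq_mul]
    rcases eq_or_ne i i' with rfl | hi <;> rcases eq_or_ne j j' with rfl | hj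
    · simp
    · simp [hj, hj.symm]
    · simp [hi, hi.symm]
    · simp [hi, hi.symm]
  have hentry : ∀ i' j', |(lyap A B ^ k) x i' j'| ≤
      c ^ 2 * (β ^ 2) ^ k * (m * m) * entrySum x := by
    intro i' j'
    have e : (lyap A B ^ k) x i' j' = ∑ i, ∑ j, x i j *
        (lyap A B ^ k) (Matrix.vecMulVec (Pi.single i 1) (Pi.single j 1)) i' j' := by
      conv_lhs => rw [hx]
      simp only [map_sum, map_smul, Matrix.sum_apply, Matrix.smul_apply, smul_eq_mul]
    rw [e, entrySum, Finset.mul_sum]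
    refine (Finset.abs_sum_le_sum_abs _ _).trans (Finset.sum_le_sum fun i _ => ?_)
    rw [Finset.mul_sum]
    refine (Finset.abs_sum_le_sum_abs _ _).trans (Finset.sum_le_sum fun j _ => ?_)
    rw [abs_mul, mul_comm]
    refine mul_le_mul_of_nonneg_right ((h1 k _ _ i' j').trans ?_) (abs_nonneg _)
    exact mul_le_mul_of_nonneg_left (mul_le_mul (hmi i) (hmi j) (apply_nonneg N _) hm0)
      (by positivity)
  calc entrySum ((lyap A B ^ k) x)
      ≤ ∑ _i : Fin p, ∑ _j : Fin p, c ^ 2 * (β ^ 2) ^ k * (m * m) * entrySum x :=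
        Finset.sum_le_sum fun i _ => Finset.sum_le_sum fun j _ => hentry i j
    _ = _ := by simp; ring

lemma isUnit_one_sub_half (hβ : β < 1) (hN : ∀ u, N u = 0 → u = 0)
    (hA : ∀ u, N (A *ᵥ u) ≤ β * N u) (hB : ∀ u, N (B *ᵥ u) ≤ β * N u) :
    IsUnit (1 - (1 / 2 : ℝ) • (A + B)) := by
  rw [← Matrix.mulVec_injective_iff_isUnit]
  intro x y hxy
  have h : (1 - (1 / 2 : ℝ) • (A + B)) *ᵥ (x - y) = 0 := by
    rw [Matrix.mulVec_sub, hxy, sub_self]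
  set u := x - y
  rw [Matrix.sub_mulVec, Matrix.one_mulVec, Matrix.smul_mulVec, Matrix.add_mulVec,
    sub_eq_zero] at h
  have h1 : N u ≤ β * N u := by
    have h2 : N u = 1 / 2 * N (A *ᵥ u + B *ᵥ u) := by
      conv_lhs => rw [h]
      rw [map_smul_eq_mul]; norm_num
    have := map_add_le_add N (A *ᵥ u) (B *ᵥ u)
    linarith [hA u, hB u]
  have : N u = 0 := le_antisymm (by nlinarith [apply_nonneg N u]) (apply_nonneg N u)
  exact sub_eq_zero.1 (hN u this)

end Lyapunov

/-- The constants attached to a contracting pair: an adapted norm, its contraction constant and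
a bound of the coordinates by the norm. -/
lemma Contracting.exists_norm {p : ℕ} {A B : Matrix (Fin p) (Fin p) ℝ} (h : Contracting A B) :
    ∃ (N : Seminorm ℝ (Fin p → ℝ)) (β c : ℝ), 0 ≤ β ∧ β < 1 ∧ 0 ≤ c ∧ (∀ u, N u = 0 → u = 0) ∧
      (∀ u i, |u i| ≤ c * N u) ∧ (∀ u, N (A *ᵥ u) ≤ β * N u) ∧ (∀ u, N (B *ᵥ u) ≤ β * N u) := by
  obtain ⟨N, β, hN, hβ, hAB⟩ := h
  obtain ⟨c, hc0, hc⟩ := exists_abs_le_mul_seminorm N hN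
  refine ⟨N, max β 0, c, le_max_right _ _, max_lt hβ one_pos, hc0, hN, hc, fun u => ?_, fun u => ?_⟩
  · exact (hAB u).1.trans (mul_le_mul_of_nonneg_right (le_max_left _ _) (apply_nonneg N u))
  · exact (hAB u).2.trans (mul_le_mul_of_nonneg_right (le_max_left _ _) (apply_nonneg N u))

section Limits

variable {p : ℕ} {a b : Fin (p + 1) → ℝ}

lemma lam_eq (h : Contracting (companion a) (companion b)) :
    lam a b = (1 / 2 : ℝ) • (companion a *ᵥ lam a b + companion b *ᵥ lam a b) +
      ((a 0 + b 0) / 2) • e1 p := by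
  obtain ⟨N, β, c, -, hβ, -, hN, -, hA, hB⟩ := h.exists_norm
  have hu := isUnit_one_sub_half hβ hN hA hB
  have h1 : (1 - (1 / 2 : ℝ) • (companion a + companion b)) *ᵥ lam a b =
      ((a 0 + b 0) / 2) • e1 p := by
    rw [lam, Matrix.mulVec_smul, Matrix.mulVec_mulVec,
      Matrix.mul_nonsing_inv _ ((Matrix.isUnit_iff_isUnit_det _).1 hu), Matrix.one_mulVec]
  rw [Matrix.sub_mulVec, Matrix.one_mulVec, Matrix.smul_mulVec, Matrix.add_mulVec] at h1
  rw [← h1]; abel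

lemma isEll_iff {σ : ℝ} {ℓ : Matrix (Fin p) (Fin p) ℝ} :
    IsEll a b σ ℓ ↔ ℓ = T a b σ + lyap (companion a) (companion b) ℓ := Iff.rfl

lemma eq_zero_of_lyap_eq {A B : Matrix (Fin p) (Fin p) ℝ} (h : Contracting A B)
    {x : Matrix (Fin p) (Fin p) ℝ} (hx : lyap A B x = x) : x = 0 := by
  obtain ⟨N, β, c, hβ0, hβ, hc0, hN, hc, hA, hB⟩ := h.exists_norm
  obtain ⟨D, hD, hle⟩ := entrySum_lyap_pow_le hβ0 hA hB hc0 hc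
  have hpow : ∀ k, (lyap A B ^ k) x = x := fun k => by
    induction k with
    | zero => simp
    | succ k ih => rw [pow_succ, Module.End.mul_apply, hx, ih]
  have hlim : Tendsto (fun k => D * (β ^ 2) ^ k * entrySum x) atTop (𝓝 0) := by
    have := (tendsto_pow_atTop_nhds_zero_of_lt_one (sq_nonneg β)
      (by nlinarith : β ^ 2 < 1)).const_mul D |>.mul_const (entrySum x)
    simpa using this
  have h0 : entrySum x ≤ 0 := ge_of_tendsto' hlim fun k => by simpa [hpow k] using hle k x
  ext i j
  have := (abs_le_entrySum x i j).trans h0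
  simpa using this

lemma existsUnique_isEll (h : Contracting (companion a) (companion b)) (σ : ℝ) :
    ∃ ℓ, IsEll a b σ ℓ ∧ ∀ ℓ', IsEll a b σ ℓ' → ℓ' = ℓ := by
  set F := lyap (companion a) (companion b)
  have hinj : Function.Injective (LinearMap.id - F : _ →ₗ[ℝ] _) := by
    rw [← LinearMap.ker_eq_bot, LinearMap.ker_eq_bot']
    intro x hx
    exact eq_zero_of_lyap_eq h (sub_eq_zero.1 hx).symm
  obtain ⟨ℓ, hℓ⟩ := LinearMap.injective_iff_surjective.1 hinj (T a b σ)
  have hiff : ∀ ℓ', IsEll a b σ ℓ' ↔ (LinearMap.id - F : _ →ₗ[ℝ] _) ℓ' = T a b σ := fun ℓ' => by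
    rw [isEll_iff, LinearMap.sub_apply, LinearMap.id_apply, sub_eq_iff_eq_add]
  exact ⟨ℓ, (hiff ℓ).2 hℓ, fun ℓ' h' => hinj (((hiff ℓ').1 h').trans hℓ.symm)⟩

lemma isEll_transpose (h : Contracting (companion a) (companion b)) {σ : ℝ}
    {ℓ : Matrix (Fin p) (Fin p) ℝ} (hℓ : IsEll a b σ ℓ) : ℓᵀ = ℓ := by
  obtain ⟨ℓ₀, h₀, huniq⟩ := existsUnique_isEll h σ
  have hT : (T a b σ)ᵀ = T a b σ := by
    simp only [T, Matrix.transpose_add, Matrix.transpose_smul, Matrix.transpose_vecMulVec]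
    rw [add_comm (Matrix.vecMulVec (e1 p) (companion a *ᵥ lam a b)),
      add_comm (Matrix.vecMulVec (e1 p) (companion b *ᵥ lam a b))]
  have : IsEll a b σ ℓᵀ := by
    unfold IsEll
    conv_lhs => rw [hℓ]
    rw [Matrix.transpose_add, hT]
    simp only [Matrix.transpose_add, Matrix.transpose_smul, Matrix.transpose_mul,
      Matrix.transpose_transpose, Matrix.mul_assoc]
  rw [huniq _ this, huniq _ hℓ]

/-- The covariance `C = ℓ - λ λᵗ` of the limiting second moments solves an equation with a positive
semidefinite constant term. -/
lemma isEll_sub_eq (h : Contracting (companion a) (companion b)) {σ : ℝ}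
    {ℓ : Matrix (Fin p) (Fin p) ℝ} (hℓ : IsEll a b σ ℓ) :
    ℓ - Matrix.vecMulVec (lam a b) (lam a b) =
      (σ ^ 2 • Matrix.vecMulVec (e1 p) (e1 p) + (1 / 4 : ℝ) • Matrix.vecMulVec
        ((companion a *ᵥ lam a b + a 0 • e1 p) - (companion b *ᵥ lam a b + b 0 • e1 p))
        ((companion a *ᵥ lam a b + a 0 • e1 p) - (companion b *ᵥ lam a b + b 0 • e1 p))) +
      lyap (companion a) (companion b) (ℓ - Matrix.vecMulVec (lam a b) (lam a b)) := by
  rw [map_sub, lyap_vecMulVec]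
  have h1 := lam_eq h
  rw [isEll_iff, T] at hℓ
  set F := lyap (companion a) (companion b) ℓ
  set x := companion a *ᵥ lam a b
  set y := companion b *ᵥ lam a b
  set l := lam a b
  ext i j
  have hi := congrFun h1 i
  have hj := congrFun h1 j
  have hℓ' := congrFun (congrFun hℓ i) j
  simp only [Matrix.add_apply, Matrix.sub_apply, Matrix.smul_apply, Matrix.vecMulVec_apply,
    Pi.add_apply, Pi.sub_apply, Pi.smul_apply, smul_eq_mul] at hi hj hℓ' ⊢
  rw [hℓ', hi, hj]
  ring

/-- The quadratic form of `lyap A B ℓ`. -/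
lemma dotProduct_lyap_mulVec (A B ℓ : Matrix (Fin p) (Fin p) ℝ) (y : Fin p → ℝ) :
    y ⬝ᵥ lyap A B ℓ *ᵥ y =
      1 / 2 * ((Aᵀ *ᵥ y) ⬝ᵥ ℓ *ᵥ (Aᵀ *ᵥ y)) + 1 / 2 * ((Bᵀ *ᵥ y) ⬝ᵥ ℓ *ᵥ (Bᵀ *ᵥ y)) := by
  have h : ∀ A : Matrix (Fin p) (Fin p) ℝ, y ⬝ᵥ (A * ℓ * Aᵀ) *ᵥ y =
      (Aᵀ *ᵥ y) ⬝ᵥ ℓ *ᵥ (Aᵀ *ᵥ y) := fun A => by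
    rw [← Matrix.mulVec_mulVec, ← Matrix.mulVec_mulVec, Matrix.dotProduct_mulVec,
      ← Matrix.mulVec_transpose]
  rw [lyap_apply, Matrix.smul_mulVec, dotProduct_smul, Matrix.add_mulVec, dotProduct_add, h, h,
    smul_eq_mul]
  ring

lemma dotProduct_vecMulVec_self_mulVec (d y : Fin p → ℝ) :
    y ⬝ᵥ Matrix.vecMulVec d d *ᵥ y = (d ⬝ᵥ y) ^ 2 := by
  rw [Matrix.vecMulVec_mulVec, dotProduct_comm y, op_smul_eq_smul, smul_dotProduct,
    smul_eq_mul, sq]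

/-- Iterating `C = R + lyap A B C` shows that `C` is nonnegative if `R` is. -/
lemma dotProduct_mulVec_nonneg_of_eq {A B R C : Matrix (Fin p) (Fin p) ℝ} (h : Contracting A B)
    (hR : ∀ y : Fin p → ℝ, 0 ≤ y ⬝ᵥ R *ᵥ y) (hC : C = R + lyap A B C) (y : Fin p → ℝ) :
    0 ≤ y ⬝ᵥ C *ᵥ y := by
  obtain ⟨N, β, c, hβ0, hβ, hc0, hN, hc, hA, hB⟩ := h.exists_norm
  obtain ⟨D, hD, hle⟩ := entrySum_lyap_pow_le hβ0 hA hB hc0 hc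
  have hmono : ∀ n (y : Fin p → ℝ), 0 ≤ y ⬝ᵥ (C - (lyap A B ^ n) C) *ᵥ y := by
    intro n
    induction n with
    | zero => intro y; simp
    | succ n ih =>
      intro y
      have e : C - (lyap A B ^ (n + 1)) C = R + lyap A B (C - (lyap A B ^ n) C) := by
        rw [map_sub, pow_succ', Module.End.mul_apply]
        have : C - lyap A B C = R := sub_eq_of_eq_add hC
        rw [← this]; abel
      rw [e, Matrix.add_mulVec, dotProduct_add, dotProduct_lyap_mulVec]
      have := hR y
      have := ih (Aᵀ *ᵥ y)
      have := ih (Bᵀ *ᵥ y)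
      positivity
  have hz : Tendsto (fun n => D * (β ^ 2) ^ n * entrySum C) atTop (𝓝 0) := by
    have := (tendsto_pow_atTop_nhds_zero_of_lt_one (sq_nonneg β)
      (by nlinarith : β ^ 2 < 1)).const_mul D |>.mul_const (entrySum C)
    simpa using this
  have hij : ∀ i j, Tendsto (fun n => ((lyap A B ^ n) C) i j) atTop (𝓝 0) := fun i j =>
    squeeze_zero_norm (fun n => (abs_le_entrySum _ i j).trans (hle n C)) hz
  have hq : Tendsto (fun n => y ⬝ᵥ ((lyap A B ^ n) C) *ᵥ y) atTop (𝓝 0) := by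
    have : Tendsto (fun n => ∑ i, y i * ∑ j, ((lyap A B ^ n) C) i j * y j) atTop
        (𝓝 (∑ i, y i * ∑ j, 0 * y j)) :=
      tendsto_finsetSum _ fun i _ => (tendsto_finsetSum _ fun j _ =>
        (hij i j).mul_const _).const_mul _
    simpa [dotProduct, Matrix.mulVec] using this
  refine le_of_tendsto' hq fun n => ?_
  have := hmono n y
  rw [Matrix.sub_mulVec, dotProduct_sub] at this
  linarith

lemma companion_transpose_mulVec {i j : Fin p} (h : (i : ℕ) = j + 1) {y : Fin p → ℝ}
    (hy : ∀ k : Fin p, (k : ℕ) = 0 → y k = 0) : ((companion a)ᵀ *ᵥ y) j = y i := by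
  rw [Matrix.mulVec, dotProduct, Finset.sum_eq_single i]
  · simp [companion, h]
  · intro k _ hk
    simp only [Matrix.transpose_apply, companion, Matrix.of_apply]
    by_cases h0 : (k : ℕ) = 0
    · simp [hy k h0]
    · have : (k : ℕ) ≠ j + 1 := fun h' => hk (Fin.ext (h'.trans h.symm))
      simp [h0, this]
  · simp

/-- The matrix `L` is positive definite: the kernel of `ℓ - λ λᵗ` is stable under the transposed
companion matrix, which shifts coordinates, and lies in the hyperplane orthogonal to `e₁`. -/
theorem posDef_L (h : Contracting (companion a) (companion b)) {σ : ℝ} (hσ : 0 < σ ^ 2)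
    {ℓ : Matrix (Fin p) (Fin p) ℝ} (hℓ : IsEll a b σ ℓ) : (L a b ℓ).PosDef := by
  set l := lam a b with hl
  set d := (companion a *ᵥ lam a b + a 0 • e1 p) - (companion b *ᵥ lam a b + b 0 • e1 p) with hd
  set C := ℓ - Matrix.vecMulVec l l with hCdef
  have hC := isEll_sub_eq h hℓ
  rw [← hl, ← hCdef, ← hd] at hC
  have hRq : ∀ y : Fin p → ℝ, y ⬝ᵥ (σ ^ 2 • Matrix.vecMulVec (e1 p) (e1 p) +
      (1 / 4 : ℝ) • Matrix.vecMulVec d d) *ᵥ y = σ ^ 2 * (e1 p ⬝ᵥ y) ^ 2 + 1 / 4 * (d ⬝ᵥ y) ^ 2 :=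
    fun y => by
      rw [Matrix.add_mulVec, dotProduct_add, Matrix.smul_mulVec, Matrix.smul_mulVec,
        dotProduct_smul, dotProduct_smul, dotProduct_vecMulVec_self_mulVec,
        dotProduct_vecMulVec_self_mulVec, smul_eq_mul, smul_eq_mul]
  have hnn : ∀ y : Fin p → ℝ, 0 ≤ y ⬝ᵥ C *ᵥ y :=
    dotProduct_mulVec_nonneg_of_eq h (fun y => by rw [hRq]; positivity) hC
  have hstep : ∀ y : Fin p → ℝ, y ⬝ᵥ C *ᵥ y = 0 → (∀ k : Fin p, (k : ℕ) = 0 → y k = 0) ∧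
      ((companion a)ᵀ *ᵥ y) ⬝ᵥ C *ᵥ ((companion a)ᵀ *ᵥ y) = 0 := by
    intro y hy
    rw [hC, Matrix.add_mulVec, dotProduct_add, hRq, dotProduct_lyap_mulVec] at hy
    have h1 := hnn ((companion a)ᵀ *ᵥ y)
    have h2 := hnn ((companion b)ᵀ *ᵥ y)
    have h3 : 0 ≤ σ ^ 2 * (e1 p ⬝ᵥ y) ^ 2 := by positivity
    have h4 := sq_nonneg (d ⬝ᵥ y)
    refine ⟨fun k hk => ?_, by linarith⟩
    have h5 : σ ^ 2 * (e1 p ⬝ᵥ y) ^ 2 = 0 := by linarith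
    have h6 : e1 p ⬝ᵥ y = 0 := by
      rcases mul_eq_zero.1 h5 with h | h
      · exact absurd h hσ.ne'
      · exact pow_eq_zero_iff (two_ne_zero) |>.1 h
    rw [dotProduct, Finset.sum_eq_single k] at h6
    · simpa [e1, hk] using h6
    · intro j _ hj
      have : (j : ℕ) ≠ 0 := fun h' => hj (Fin.ext (h'.trans hk.symm))
      simp [e1, this]
    · simp
  have hker : ∀ n (y : Fin p → ℝ), y ⬝ᵥ C *ᵥ y = 0 → ∀ i : Fin p, (i : ℕ) = n → y i = 0 := by
    intro n
    induction n with
    | zero => intro y hy i hi; exact (hstep y hy).1 i hi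
    | succ n ih =>
      intro y hy i hi
      obtain ⟨h0, h1⟩ := hstep y hy
      have h2 := ih _ h1 ⟨n, by omega⟩ rfl
      rwa [companion_transpose_mulVec (i := i) (by simpa using hi) h0] at h2
  have hLq : ∀ x : Fin (p + 1) → ℝ, x ⬝ᵥ L a b ℓ *ᵥ x =
      (x 0 + l ⬝ᵥ Fin.tail x) ^ 2 + Fin.tail x ⬝ᵥ C *ᵥ Fin.tail x := by
    intro x
    have e1' : (L a b ℓ *ᵥ x) 0 = x 0 + l ⬝ᵥ Fin.tail x := by
      simp [Matrix.mulVec, dotProduct, L, Fin.sum_univ_succ, Fin.tail, hl]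
    have e2 : ∀ i : Fin p, (L a b ℓ *ᵥ x) i.succ = l i * x 0 + (ℓ *ᵥ Fin.tail x) i := fun i => by
      simp [Matrix.mulVec, dotProduct, L, Fin.sum_univ_succ, Fin.tail, hl]
    have e3 : x ⬝ᵥ L a b ℓ *ᵥ x = x 0 * (x 0 + l ⬝ᵥ Fin.tail x) +
        (x 0 * (l ⬝ᵥ Fin.tail x) + Fin.tail x ⬝ᵥ ℓ *ᵥ Fin.tail x) := by
      rw [dotProduct, Fin.sum_univ_succ, e1']
      congr 1
      simp only [e2, mul_add, Finset.sum_add_distrib, dotProduct, Fin.tail, Finset.mul_sum]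
      congr 1
      exact Finset.sum_congr rfl fun i _ => by ring
    rw [e3, hCdef, Matrix.sub_mulVec, dotProduct_sub, dotProduct_vecMulVec_self_mulVec]
    ring
  refine Matrix.PosDef.of_dotProduct_mulVec_pos ?_ fun x hx => ?_
  · have hsym := isEll_transpose h hℓ
    ext i j
    rw [Matrix.conjTranspose_apply, star_trivial]
    refine Fin.cases ?_ (fun i' => ?_) i <;> refine Fin.cases ?_ (fun j' => ?_) j
    · rfl
    · simp [L]
    · simp [L]
    · have := congrFun (congrFun hsym i') j'
      simpa [L] using this
  · rw [star_trivial, hLq]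
    refine lt_of_le_of_ne (add_nonneg (sq_nonneg _) (hnn _)) fun h0 => hx ?_
    have hq := hnn (Fin.tail x)
    have hs := sq_nonneg (x 0 + l ⬝ᵥ Fin.tail x)
    have ht : ∀ i, Fin.tail x i = 0 := fun i => hker i _ (by linarith) i rfl
    have ht' : Fin.tail x = 0 := funext ht
    have hs0 : (x 0 + l ⬝ᵥ Fin.tail x) ^ 2 = 0 := by linarith
    rw [ht', dotProduct_zero, add_zero] at hs0
    ext i
    refine Fin.cases ?_ (fun i' => ?_) i
    · exact pow_eq_zero_iff two_ne_zero |>.1 hs0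
    · exact ht i'

end Limits

/-! ### Moments of the process -/

/-- The standing assumptions: a bifurcating autoregressive process with contracting companion
matrices, initial states in `L⁸` and noise satisfying (H.1)–(H.3). -/
structure Setting {Ω : Type*} [MeasurableSpace Ω] (μ : Measure Ω) (p : ℕ)
    (a b : Fin (p + 1) → ℝ) (X ε : ℕ → Ω → ℝ) (σ ρ : ℝ) : Prop where
  one_le : 1 ≤ p
  meas : ∀ k, 1 ≤ k → Measurable (X k)
  bar : IsBAR p a b X ε
  init : ∀ k, 1 ≤ k → k ≤ 2 ^ p - 1 → MemLp (X k) 8 μ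
  contr : Contracting (companion a) (companion b)
  h1 : H1 p X ε μ σ
  h2 : H2 p X ε μ σ ρ
  h3 : H3 p X ε μ

section Autoregression

variable {Ω : Type*} {X ε : ℕ → Ω → ℝ} {p : ℕ} {a b : Fin (p + 1) → ℝ}

/-- The vector `(X_k, X_{⌊k/2⌋}, …, X_{⌊k/2^{p-1}⌋})`. -/
def state (p : ℕ) (X : ℕ → Ω → ℝ) (k : ℕ) (ω : Ω) : Fin p → ℝ := fun i => X (k / 2 ^ (i : ℕ)) ω

lemma companion_mulVec_succ (a : Fin (p + 1) → ℝ) (v : Fin p → ℝ) {i j : Fin p}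
    (h : (i : ℕ) = j + 1) : (companion a *ᵥ v) i = v j := by
  rw [Matrix.mulVec, dotProduct, Finset.sum_eq_single j]
  · simp [companion, h]
  · intro k _ hk
    have : (j : ℕ) ≠ k := fun h' => hk (Fin.ext h'.symm)
    simp [companion, h, this]
  · simp

lemma companion_mulVec_zero (a : Fin (p + 1) → ℝ) (v : Fin p → ℝ) {i : Fin p} (h : (i : ℕ) = 0) :
    (companion a *ᵥ v) i = ∑ j, a j.succ * v j := by
  rw [Matrix.mulVec, dotProduct]
  exact Finset.sum_congr rfl fun j _ => by simp [companion, h]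

/-- The autoregression of order `p` as an affine recursion of order one on the states. -/
lemma state_eq_of_double {a : Fin (p + 1) → ℝ} {k l : ℕ} {ω : Ω} {e : ℝ} (hl : l / 2 = k)
    (h : X l ω = a 0 + ∑ j : Fin p, a j.succ * X (k / 2 ^ (j : ℕ)) ω + e) :
    state p X l ω = companion a *ᵥ state p X k ω + (a 0 + e) • e1 p := by
  ext i
  rw [Pi.add_apply, Pi.smul_apply, smul_eq_mul]
  rcases Nat.eq_zero_or_pos (i : ℕ) with h0 | hpos
  · rw [companion_mulVec_zero _ _ h0]
    simp only [state, e1, h0, pow_zero, Nat.div_one, if_true, h]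
    ring
  · obtain ⟨j, hj⟩ : ∃ j : Fin p, (i : ℕ) = j + 1 := ⟨⟨i - 1, by omega⟩, by simp; omega⟩
    rw [companion_mulVec_succ _ _ hj]
    simp only [state, e1, hj, pow_succ']
    rw [← Nat.div_div_eq_div_mul, hl]
    simp

lemma state_two_mul (hBAR : IsBAR p a b X ε) {k : ℕ} (hk : 2 ^ (p - 1) ≤ k) (ω : Ω) :
    state p X (2 * k) ω = companion a *ᵥ state p X k ω + (a 0 + ε (2 * k) ω) • e1 p :=
  state_eq_of_double (by omega) (hBAR k hk ω).1

lemma state_two_mul_add_one (hBAR : IsBAR p a b X ε) {k : ℕ} (hk : 2 ^ (p - 1) ≤ k) (ω : Ω) :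
    state p X (2 * k + 1) ω = companion b *ᵥ state p X k ω + (b 0 + ε (2 * k + 1) ω) • e1 p :=
  state_eq_of_double (by omega) (hBAR k hk ω).2

lemma exists_mem_gen_succ (hp : 1 ≤ p) {k : ℕ} (hk : 2 ^ p ≤ k) :
    ∃ n, p - 1 ≤ n ∧ k ∈ gen (n + 1) := by
  have h0 : k ≠ 0 := (lt_of_lt_of_le (by positivity) hk).ne'
  have h1 := Nat.pow_log_le_self 2 h0
  have h2 := Nat.lt_pow_succ_log_self (b := 2) (by norm_num) k
  have h3 : p ≤ Nat.log 2 k := (Nat.le_log_iff_pow_le (by norm_num) h0).2 hk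
  refine ⟨Nat.log 2 k - 1, by omega, ?_⟩
  rw [Nat.sub_add_cancel (hp.trans h3), mem_gen]
  exact ⟨h1, h2⟩

variable [MeasurableSpace Ω] {μ : Measure Ω} [IsProbabilityMeasure μ]

lemma integral_noise_pow_eq {m : MeasurableSpace Ω} {mΩ : MeasurableSpace Ω} {μ : Measure Ω}
    [IsProbabilityMeasure μ] (hm : m ≤ mΩ) {f : Ω → ℝ} {r : ℝ} (h : μ[f | m] =ᵐ[μ] fun _ => r) :
    ∫ ω, f ω ∂μ = r := by
  rw [← integral_condExp hm, integral_congr_ae h]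
  simp

/-- A uniform bound of the moments of the noise gives a uniform bound of the moments of the states,
by convexity and contraction. -/
lemma exists_integral_seminorm_state_le (hp : 1 ≤ p) (hX : ∀ k, 1 ≤ k → Measurable (X k))
    (hBAR : IsBAR p a b X ε) {q : ℕ} (hq : q ≤ 8)
    (hinit : ∀ k, 1 ≤ k → k ≤ 2 ^ p - 1 → MemLp (X k) 8 μ)
    (N : Seminorm ℝ (Fin p → ℝ)) {β : ℝ} (hβ0 : 0 ≤ β) (hβ1 : β < 1)
    (hA : ∀ u, N (companion a *ᵥ u) ≤ β * N u) (hB : ∀ u, N (companion b *ᵥ u) ≤ β * N u)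
    {c : ℝ} (hε : ∀ k, 2 ^ p ≤ k → Integrable (fun ω => |ε k ω| ^ q) μ ∧ ∫ ω, |ε k ω| ^ q ∂μ ≤ c) :
    ∃ C, 0 ≤ C ∧ ∀ k, 2 ^ (p - 1) ≤ k →
      Integrable (fun ω => N (state p X k ω) ^ q) μ ∧ ∫ ω, N (state p X k ω) ^ q ∂μ ≤ C := by
  have hmN : ∀ k, 2 ^ (p - 1) ≤ k → Measurable fun ω => N (state p X k ω) := fun k hk =>
    (continuous_seminorm_pi N).measurable.comp (measurable_pi_lambda _ fun i =>
      hX _ (ancestor_pos hk i.2))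
  have hpp := two_pow_eq hp
  -- the finitely many initial states
  have hbase : ∀ k, 2 ^ (p - 1) ≤ k → k < 2 ^ p → Integrable (fun ω => N (state p X k ω) ^ q) μ := by
    intro k hk hk'
    have hmem : MemLp (fun ω => ∑ i : Fin p, |state p X k ω i| * N (Pi.single i 1)) q μ := by
      refine memLp_finsetSum _ fun i _ => ?_
      have h8 : MemLp (fun ω => state p X k ω i) 8 μ := by
        refine hinit _ (ancestor_pos hk i.2) ?_
        have := Nat.div_le_self k (2 ^ (i : ℕ))
        omega
      have hq8 : MemLp (fun ω => state p X k ω i) q μ := h8.mono_exponent (by exact_mod_cast hq)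
      exact (hq8.abs).mul_const _
    have hmem' : MemLp (fun ω => N (state p X k ω)) q μ :=
      hmem.mono' (hmN k hk).aestronglyMeasurable (Eventually.of_forall fun ω => by
        rw [Real.norm_of_nonneg (apply_nonneg N _)]
        exact seminorm_le_sum N _)
    refine hmem'.integrable_norm_pow'.congr (Eventually.of_forall fun ω => ?_)
    simp only [Real.norm_of_nonneg (apply_nonneg N _)]
  set C₀ := ∑ k ∈ gen (p - 1), ∫ ω, N (state p X k ω) ^ q ∂μ with hC₀
  have hpow0 : ∀ k, 0 ≤ ∫ ω, N (state p X k ω) ^ q ∂μ := fun k =>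
    integral_nonneg fun ω => pow_nonneg (apply_nonneg N _) q
  set d := max |a 0| |b 0| with hd
  set r := N (e1 p) / (1 - β) with hr
  have hβ' : 0 < 1 - β := by linarith
  have hr0 : 0 ≤ r := div_nonneg (apply_nonneg N _) hβ'.le
  have hc : 0 ≤ c := (integral_nonneg fun ω => by positivity).trans (hε (2 ^ p) le_rfl).2
  have hd0 : 0 ≤ d := (abs_nonneg _).trans (le_max_left _ _)
  set C₁ := r ^ q * (2 ^ (q - 1) * (d ^ q + c)) with hC₁
  have hC₁0 : 0 ≤ C₁ := by positivity
  have hstep : ∀ (a' : Fin (p + 1) → ℝ) (k l : ℕ), |a' 0| ≤ d → 2 ^ (p - 1) ≤ k → 2 ^ p ≤ l →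
      (∀ u, N (companion a' *ᵥ u) ≤ β * N u) →
      (∀ ω, state p X l ω = companion a' *ᵥ state p X k ω + (a' 0 + ε l ω) • e1 p) →
      Integrable (fun ω => N (state p X k ω) ^ q) μ →
      ∫ ω, N (state p X k ω) ^ q ∂μ ≤ max C₀ C₁ →
      Integrable (fun ω => N (state p X l ω) ^ q) μ ∧
        ∫ ω, N (state p X l ω) ^ q ∂μ ≤ max C₀ C₁ := by
    intro a' k l ha' hk hl hA' hs hint hle
    obtain ⟨hεi, hεc⟩ := hε l hl
    have hpt : ∀ ω, N (state p X l ω) ^ q ≤ β * N (state p X k ω) ^ q +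
        (1 - β) * (r ^ q * (2 ^ (q - 1) * (d ^ q + |ε l ω| ^ q))) := by
      intro ω
      have h1 : N (state p X l ω) ≤ β * N (state p X k ω) + (1 - β) * (r * (d + |ε l ω|)) := by
        have e : (1 - β) * (r * (d + |ε l ω|)) = (d + |ε l ω|) * N (e1 p) := by
          rw [hr]; field_simp
        rw [hs, e]
        refine (map_add_le_add N _ _).trans (add_le_add (hA' _) ?_)
        rw [map_smul_eq_mul, Real.norm_eq_abs]
        exact mul_le_mul_of_nonneg_right ((abs_add_le _ _).trans (by linarith)) (apply_nonneg N _)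
      have hy0 : 0 ≤ r * (d + |ε l ω|) := by positivity
      refine (pow_le_pow_left₀ (apply_nonneg N _) h1 q).trans ?_
      have h2 := (convexOn_pow q).2 (Set.mem_Ici.2 (apply_nonneg N (state p X k ω)))
        (Set.mem_Ici.2 hy0) hβ0 hβ'.le (by ring)
      simp only [smul_eq_mul] at h2
      refine h2.trans (add_le_add le_rfl (mul_le_mul_of_nonneg_left ?_ hβ'.le))
      rw [mul_pow]
      refine mul_le_mul_of_nonneg_left ?_ (by positivity)
      exact add_pow_le hd0 (abs_nonneg _) q
    have j0 : Integrable (fun ω => d ^ q + |ε l ω| ^ q) μ := (integrable_const _).add hεi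
    have j1 : Integrable (fun ω =>
        (1 - β) * (r ^ q * (2 ^ (q - 1) * (d ^ q + |ε l ω| ^ q)))) μ :=
      ((j0.const_mul _).const_mul _).const_mul _
    have hdom : Integrable (fun ω => β * N (state p X k ω) ^ q +
        (1 - β) * (r ^ q * (2 ^ (q - 1) * (d ^ q + |ε l ω| ^ q)))) μ :=
      (hint.const_mul _).add j1
    have hl' : 2 ^ (p - 1) ≤ l := by omega
    refine ⟨hdom.mono' ((hmN l hl').pow_const q).aestronglyMeasurable
      (Eventually.of_forall fun ω => ?_), ?_⟩
    · rw [Real.norm_of_nonneg (pow_nonneg (apply_nonneg N _) q)]; exact hpt ω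
    · refine (integral_mono_of_nonneg (Eventually.of_forall fun ω =>
        pow_nonneg (apply_nonneg N _) q) hdom (Eventually.of_forall hpt)).trans ?_
      rw [integral_add (hint.const_mul _) j1,
        integral_const_mul, integral_const_mul, integral_const_mul, integral_const_mul,
        integral_add (integrable_const _) hεi]
      simp only [integral_const, probReal_univ, smul_eq_mul, one_mul]
      have h1 : r ^ q * (2 ^ (q - 1) * (d ^ q + ∫ ω, |ε l ω| ^ q ∂μ)) ≤ C₁ := by
        rw [hC₁]; gcongr
      have h2 := le_max_right C₀ C₁
      have h3 := mul_le_mul_of_nonneg_left hle hβ0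
      have h4 := mul_le_mul_of_nonneg_left (h1.trans h2) hβ'.le
      nlinarith
  refine ⟨max C₀ C₁, hC₁0.trans (le_max_right _ _), fun k => ?_⟩
  induction k using Nat.strong_induction_on with
  | _ k ih =>
    intro hk
    rcases lt_or_ge k (2 ^ p) with hk' | hk'
    · refine ⟨hbase k hk hk', le_trans ?_ (le_max_left _ _)⟩
      refine Finset.single_le_sum (f := fun k => ∫ ω, N (state p X k ω) ^ q ∂μ)
        (fun k _ => hpow0 k) ?_
      rw [mem_gen, Nat.sub_add_cancel hp]
      exact ⟨hk, hk'⟩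
    · have h0 : 0 < 2 ^ (p - 1) := by positivity
      rcases Nat.even_or_odd' k with ⟨j, rfl | rfl⟩
      · have hj : 2 ^ (p - 1) ≤ j := by omega
        obtain ⟨i1, i2⟩ := ih j (by omega) hj
        exact hstep a j _ (le_max_left _ _) hj hk' hA (state_two_mul hBAR hj) i1 i2
      · have hj : 2 ^ (p - 1) ≤ j := by omega
        obtain ⟨i1, i2⟩ := ih j (by omega) hj
        exact hstep b j _ (le_max_right _ _) hj hk' hB (state_two_mul_add_one hBAR hj) i1 i2

lemma measurable_regressor (hX : ∀ k, 1 ≤ k → Measurable (X k)) {k : ℕ} (hk : 2 ^ (p - 1) ≤ k)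
    (j : Fin (p + 1)) : Measurable fun ω => regressor p X k ω j :=
  (measurable_regressor_filt (n := k) hk (k.lt_two_pow_self.trans_le
    (Nat.pow_le_pow_right (by norm_num) (by omega))) j).mono (filt_le hX k) le_rfl

variable {σ ρ : ℝ}

/-- The moments of the regressors are bounded as soon as those of the noise are. -/
lemma Setting.exists_integral_regressor_le (hs : Setting μ p a b X ε σ ρ) {q : ℕ}
    (hq : q ≤ 8) {c : ℝ}
    (hε : ∀ k, 2 ^ p ≤ k → Integrable (fun ω => |ε k ω| ^ q) μ ∧ ∫ ω, |ε k ω| ^ q ∂μ ≤ c) :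
    ∃ C, 0 ≤ C ∧ ∀ k, 2 ^ (p - 1) ≤ k → ∀ j, Integrable (fun ω => |regressor p X k ω j| ^ q) μ ∧
      ∫ ω, |regressor p X k ω j| ^ q ∂μ ≤ C := by
  obtain ⟨N, β, c', hβ0, hβ1, hc0, hN, hc, hA, hB⟩ := hs.contr.exists_norm
  obtain ⟨C, hC0, hC⟩ := exists_integral_seminorm_state_le hs.one_le hs.meas hs.bar hq hs.init
    N hβ0 hβ1 hA hB hε
  refine ⟨1 + c' ^ q * C, by positivity, fun k hk j => ?_⟩
  obtain ⟨hi, hle⟩ := hC k hk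
  have hcC : 0 ≤ c' ^ q * C := by positivity
  refine Fin.cases ?_ (fun i => ?_) j
  · simp [regressor, hcC]
  · have hpt : ∀ ω, |regressor p X k ω i.succ| ^ q ≤ c' ^ q * N (state p X k ω) ^ q := fun ω => by
      rw [← mul_pow]
      refine pow_le_pow_left₀ (abs_nonneg _) ?_ q
      exact hc (state p X k ω) i
    refine ⟨(hi.const_mul (c' ^ q)).mono'
      (((measurable_regressor hs.meas hk i.succ).abs.pow_const q).aestronglyMeasurable)
      (Eventually.of_forall fun ω => ?_), ?_⟩
    · rw [Real.norm_of_nonneg (by positivity)]; exact hpt ω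
    · refine (integral_mono_of_nonneg (Eventually.of_forall fun ω => by positivity)
        (hi.const_mul _) (Eventually.of_forall hpt)).trans ?_
      rw [integral_const_mul]
      have := mul_le_mul_of_nonneg_left hle (pow_nonneg hc0 q)
      linarith

lemma Setting.exists_integral_regressor_sq_le (hs : Setting μ p a b X ε σ ρ) :
    ∃ C, 0 ≤ C ∧ ∀ k, 2 ^ (p - 1) ≤ k → ∀ j, Integrable (fun ω => regressor p X k ω j ^ 2) μ ∧
      ∫ ω, regressor p X k ω j ^ 2 ∂μ ≤ C := by
  have hε : ∀ k, 2 ^ p ≤ k → Integrable (fun ω => |ε k ω| ^ 2) μ ∧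
      ∫ ω, |ε k ω| ^ 2 ∂μ ≤ σ ^ 2 := fun k hk => by
    obtain ⟨n, hn, hkn⟩ := exists_mem_gen_succ hs.one_le hk
    obtain ⟨i1, -, i3⟩ := hs.h1.2 n hn k hkn
    simp only [sq_abs]
    exact ⟨i1.integrable_sq, (integral_noise_pow_eq (filt_le hs.meas n) i3).le⟩
  simpa only [sq_abs] using hs.exists_integral_regressor_le (by norm_num) hε

lemma Setting.exists_integral_regressor_pow_four_le (hs : Setting μ p a b X ε σ ρ) {τ ν : ℝ}
    (h4 : H4 p X ε μ τ ν) :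
    ∃ C, 0 ≤ C ∧ ∀ k, 2 ^ (p - 1) ≤ k → ∀ j, Integrable (fun ω => regressor p X k ω j ^ 4) μ ∧
      ∫ ω, regressor p X k ω j ^ 4 ∂μ ≤ C := by
  have e4 : ∀ x : ℝ, |x| ^ 4 = x ^ 4 := fun x => Even.pow_abs (by decide) x
  have hε : ∀ k, 2 ^ p ≤ k → Integrable (fun ω => |ε k ω| ^ 4) μ ∧
      ∫ ω, |ε k ω| ^ 4 ∂μ ≤ τ ^ 4 := fun k hk => by
    obtain ⟨n, hn, hkn⟩ := exists_mem_gen_succ hs.one_le hk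
    have i1 : MemLp (ε k) 4 μ := by exact_mod_cast hs.h3.1 n hn k hkn
    simp only [e4]
    exact ⟨integrable_pow_of_memLp_four i1 le_rfl,
      (integral_noise_pow_eq (filt_le hs.meas n) ((h4.2.2 n hn).1 k hkn)).le⟩
  simpa only [e4] using hs.exists_integral_regressor_le (by norm_num) hε

end Autoregression

/-! ### Scalar martingales -/

section Autoregression

variable {Ω : Type*} {X ε : ℕ → Ω → ℝ} {p : ℕ} {a b : Fin (p + 1) → ℝ}

/-- The coefficient of the noise of daughter `i` of `k` in the linear combination `u ⬝ᵥ M`. -/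
def coef (p : ℕ) (X : ℕ → Ω → ℝ) (u : Fin 2 × Fin (p + 1) → ℝ) (i : Fin 2) (k : ℕ) (ω : Ω) : ℝ :=
  ∑ j, u (i, j) * regressor p X k ω j

/-- The increment of `u ⬝ᵥ M` due to the daughters of generation `n`. -/
def incr (p : ℕ) (X ε : ℕ → Ω → ℝ) (u : Fin 2 × Fin (p + 1) → ℝ) (n : ℕ) (ω : Ω) : ℝ :=
  ∑ k ∈ gen n, (coef p X u 0 k ω * ε (2 * k) ω + coef p X u 1 k ω * ε (2 * k + 1) ω)

/-- The conditional variance of `incr`. -/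
def incrVar (p : ℕ) (X : ℕ → Ω → ℝ) (σ ρ : ℝ) (u : Fin 2 × Fin (p + 1) → ℝ) (n : ℕ) (ω : Ω) : ℝ :=
  ∑ k ∈ gen n, quadΓ σ ρ (coef p X u 0 k ω) (coef p X u 1 k ω)

/-- The sum of the squares of the coefficients of `incr`. -/
def coefSq (p : ℕ) (X : ℕ → Ω → ℝ) (u : Fin 2 × Fin (p + 1) → ℝ) (n : ℕ) (ω : Ω) : ℝ :=
  ∑ k ∈ gen n, (coef p X u 0 k ω ^ 2 + coef p X u 1 k ω ^ 2)

/-- The linear combination `u ⬝ᵥ M_n` of the entries of the martingale, started from `0` at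
`n = p - 1` (where `M` itself has no meaning). -/
def mart (p : ℕ) (X ε : ℕ → Ω → ℝ) (u : Fin 2 × Fin (p + 1) → ℝ) (n : ℕ) (ω : Ω) : ℝ :=
  if n < p then 0 else u ⬝ᵥ M p X ε n ω

/-- The compensated increment of the square of `mart`, truncated to the event `A`. -/
noncomputable def sqIncr (p : ℕ) (X ε : ℕ → Ω → ℝ) (σ ρ : ℝ) (u : Fin 2 × Fin (p + 1) → ℝ) (A : Set Ω) (n : ℕ) :
    Ω → ℝ :=
  A.indicator fun ω => 2 * mart p X ε u n ω * incr p X ε u n ω +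
    (incr p X ε u n ω ^ 2 - incrVar p X σ ρ u n ω)

variable {u : Fin 2 × Fin (p + 1) → ℝ}

lemma mart_of_le {n : ℕ} (h : p ≤ n) (ω : Ω) : mart p X ε u n ω = u ⬝ᵥ M p X ε n ω :=
  if_neg (by omega)

lemma mart_of_lt {n : ℕ} (h : n < p) (ω : Ω) : mart p X ε u n ω = 0 := if_pos h

lemma dotProduct_sum_eq_incr (n : ℕ) (ω : Ω) :
    u ⬝ᵥ (fun i : Fin 2 × Fin (p + 1) =>
      ∑ k ∈ gen n, ε (2 * k + (i.1 : ℕ)) ω * regressor p X k ω i.2) = incr p X ε u n ω := by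
  unfold incr coef dotProduct
  simp_rw [Finset.mul_sum]
  rw [Finset.sum_comm]
  refine Finset.sum_congr rfl fun k _ => ?_
  rw [Fintype.sum_prod_type, Fin.sum_univ_two, Finset.sum_mul, Finset.sum_mul]
  simp only [Fin.val_zero, Fin.val_one, add_zero]
  congr 1 <;> exact Finset.sum_congr rfl fun j _ => by ring

lemma mart_succ (hp : 1 ≤ p) {n : ℕ} (hn : p - 1 ≤ n) (ω : Ω) :
    mart p X ε u (n + 1) ω = mart p X ε u n ω + incr p X ε u n ω := by
  rw [mart_of_le (by omega), ← dotProduct_sum_eq_incr]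
  rcases Nat.lt_or_ge n p with h | h
  · have hn' : n = p - 1 := by omega
    subst hn'
    have : subtree (p - 1) (p - 1) = gen (p - 1) := by
      ext k
      rw [mem_subtree, mem_gen]
      have := Nat.one_le_two_pow (n := p - 1)
      omega
    rw [mart_of_lt h, zero_add]
    unfold M
    simp only [Nat.add_sub_cancel, this]
  · rw [mart_of_le h, ← dotProduct_add]
    congr 1
    ext i
    obtain ⟨m, rfl⟩ : ∃ m, n = m + 1 := ⟨n - 1, by omega⟩
    simp only [M, Nat.add_sub_cancel, Pi.add_apply]
    exact sum_subtree_succ (by omega) _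

lemma measurable_coef_filt {n k : ℕ} (hk : 2 ^ (p - 1) ≤ k) (hkn : k < 2 ^ (n + 1)) (i : Fin 2) :
    Measurable[filt X n] (coef p X u i k) := by
  unfold coef
  exact Finset.measurable_sum _ fun j _ => (measurable_regressor_filt hk hkn j).const_mul _

lemma measurable_mart_filt (hp : 1 ≤ p) (hBAR : IsBAR p a b X ε) (n : ℕ) :
    Measurable[filt X n] (mart p X ε u n) := by
  rcases Nat.lt_or_ge n p with h | h
  · have : mart p X ε u n = fun _ => 0 := funext fun ω => mart_of_lt h ω
    rw [this]; exact measurable_const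
  · have : mart p X ε u n = fun ω => ∑ i, u i * M p X ε n ω i :=
      funext fun ω => mart_of_le h ω
    rw [this]
    exact Finset.measurable_sum _ fun i _ =>
      (measurable_M_filt hp hBAR (hp.trans h) i).const_mul _

lemma measurable_incrVar_filt {σ ρ : ℝ} {n : ℕ} (hn : p - 1 ≤ n) :
    Measurable[filt X n] (incrVar p X σ ρ u n) := by
  unfold incrVar quadΓ
  refine Finset.measurable_sum _ fun k hk => ?_
  have h0 := measurable_coef_filt (u := u) (X := X) (le_of_mem_gen hn hk) (mem_gen.1 hk).2 0
  have h1 := measurable_coef_filt (u := u) (X := X) (le_of_mem_gen hn hk) (mem_gen.1 hk).2 1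
  exact (((h0.pow_const 2).const_mul _).add ((h0.mul h1).const_mul _)).add
    ((h1.pow_const 2).const_mul _)

lemma measurable_coefSq_filt {n : ℕ} (hn : p - 1 ≤ n) :
    Measurable[filt X n] (coefSq p X u n) := by
  unfold coefSq
  refine Finset.measurable_sum _ fun k hk => ?_
  have h0 := measurable_coef_filt (u := u) (X := X) (le_of_mem_gen hn hk) (mem_gen.1 hk).2 0
  have h1 := measurable_coef_filt (u := u) (X := X) (le_of_mem_gen hn hk) (mem_gen.1 hk).2 1
  exact (h0.pow_const 2).add (h1.pow_const 2)

lemma measurable_incr_filt (hp : 1 ≤ p) (hBAR : IsBAR p a b X ε) {n : ℕ} (hn : p - 1 ≤ n) :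
    Measurable[filt X (n + 1)] (incr p X ε u n) := by
  have : incr p X ε u n = fun ω => mart p X ε u (n + 1) ω - mart p X ε u n ω :=
    funext fun ω => by rw [mart_succ hp hn]; ring
  rw [this]
  exact (measurable_mart_filt hp hBAR _).sub
    ((measurable_mart_filt hp hBAR n).mono (filt_mono n.le_succ) le_rfl)

lemma measurable_sqIncr_filt (hp : 1 ≤ p) (hBAR : IsBAR p a b X ε) {n : ℕ} (hn : p - 1 ≤ n)
    {σ ρ : ℝ} {A : Set Ω} (hA : MeasurableSet[filt X n] A) :
    Measurable[filt X (n + 1)] (sqIncr p X ε σ ρ u A n) := by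
  have hle := filt_mono (X := X) n.le_succ
  have h1 := (measurable_mart_filt (u := u) hp hBAR n).mono hle le_rfl
  have h2 := measurable_incr_filt (u := u) hp hBAR hn
  have h3 := (measurable_incrVar_filt (u := u) (X := X) (σ := σ) (ρ := ρ) hn).mono hle le_rfl
  exact (((h1.const_mul 2).mul h2).add ((h2.pow_const 2).sub h3)).indicator (hle _ hA)

lemma incrVar_nonneg {σ ρ : ℝ} (hρ : |ρ| < σ ^ 2) (n : ℕ) (ω : Ω) :
    0 ≤ incrVar p X σ ρ u n ω := Finset.sum_nonneg fun _ _ => quadΓ_nonneg hρ _ _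

lemma incrVar_le {σ ρ : ℝ} (hρ : |ρ| < σ ^ 2) (n : ℕ) (ω : Ω) :
    incrVar p X σ ρ u n ω ≤ 2 * σ ^ 2 * coefSq p X u n ω := by
  unfold incrVar coefSq
  rw [Finset.mul_sum]
  exact Finset.sum_le_sum fun _ _ => quadΓ_le hρ _ _

lemma coef_sq_le (i : Fin 2) (k : ℕ) (ω : Ω) :
    coef p X u i k ω ^ 2 ≤ (∑ j, u (i, j) ^ 2) * ∑ j, regressor p X k ω j ^ 2 :=
  Finset.sum_mul_sq_le_sq_mul_sq _ _ _

/-- The coefficients of the linear combination, as functions on `Past X n`. -/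
def pastCoef (p : ℕ) (X : ℕ → Ω → ℝ) (u : Fin 2 × Fin (p + 1) → ℝ) (i : Fin 2) (n : ℕ) :
    gen n → Past X n → ℝ := fun k ω => coef p X u i k ω

lemma linNoise_pastCoef (n : ℕ) (ω : Ω) :
    linNoise (pastCoef p X u 0 n) (pastCoef p X u 1 n) (toPast X n ω) (fun i => sisters ε i ω) =
      incr p X ε u n ω :=
  Finset.sum_coe_sort (gen n) fun k =>
    coef p X u 0 k ω * ε (2 * k) ω + coef p X u 1 k ω * ε (2 * k + 1) ω

lemma linVar_pastCoef (σ ρ : ℝ) (n : ℕ) (ω : Ω) :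
    linVar σ ρ (pastCoef p X u 0 n) (pastCoef p X u 1 n) (toPast X n ω) =
      incrVar p X σ ρ u n ω :=
  Finset.sum_coe_sort (gen n) fun k => quadΓ σ ρ (coef p X u 0 k ω) (coef p X u 1 k ω)

lemma measurable_pastCoef {n : ℕ} (hn : p - 1 ≤ n) (i : Fin 2) (k : gen n) :
    Measurable (pastCoef p X u i n k) :=
  measurable_coef_filt (le_of_mem_gen hn k.2) (mem_gen.1 k.2).2 i

/-- A function on `Ω`, seen as a function on `Past X n`. -/
def onPast {E : Type*} (X : ℕ → Ω → ℝ) (n : ℕ) (g : Ω → E) : Past X n → E := g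

@[simp]
lemma onPast_toPast {E : Type*} (n : ℕ) (g : Ω → E) (ω : Ω) :
    onPast X n g (toPast X n ω) = g ω := rfl

lemma mem_onPast {n : ℕ} {A : Set Ω} {ω : Ω} :
    toPast X n ω ∈ {x | onPast X n (· ∈ A) x} ↔ ω ∈ A := Iff.rfl

lemma measurable_onPast {E : Type*} [MeasurableSpace E] {n : ℕ} {g : Ω → E}
    (hg : Measurable[filt X n] g) : Measurable (onPast X n g) := hg

lemma measurableSet_onPast {n : ℕ} {A : Set Ω} (hA : MeasurableSet[filt X n] A) :
    MeasurableSet {x | onPast X n (· ∈ A) x} := hA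

lemma indicator_toPast (σ ρ : ℝ) (A : Set Ω) (n : ℕ) (ω : Ω) :
    {x | onPast X n (· ∈ A) x}.indicator (fun x => 2 * onPast X n (mart p X ε u n) x *
      linNoise (pastCoef p X u 0 n) (pastCoef p X u 1 n) x (fun i => sisters ε i ω) +
        (linNoise (pastCoef p X u 0 n) (pastCoef p X u 1 n) x (fun i => sisters ε i ω) ^ 2 -
          linVar σ ρ (pastCoef p X u 0 n) (pastCoef p X u 1 n) x)) (toPast X n ω) =
      sqIncr p X ε σ ρ u A n ω := by
  classical
  rw [Set.indicator_apply, linNoise_pastCoef, linVar_pastCoef, sqIncr, Set.indicator_apply]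
  exact if_congr mem_onPast rfl rfl

variable [MeasurableSpace Ω] {μ : Measure Ω} [IsProbabilityMeasure μ] {σ ρ : ℝ}

/-- The event, in the past of generation `n + 1`, that its conditional fourth moments are at most
`K`. -/
def fourthLE (X ε : ℕ → Ω → ℝ) (μ : Measure Ω) (K : ℝ) (n : ℕ) : Set Ω :=
  ⋂ k ∈ gen (n + 1), {ω | (μ[fun ω' => ε k ω' ^ 4 | filt X n]) ω ≤ K}

lemma measurableSet_fourthLE (K : ℝ) (n : ℕ) : MeasurableSet[filt X n] (fourthLE X ε μ K n) := by
  refine MeasurableSet.biInter (gen (n + 1)).countable_toSet fun k _ => ?_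
  exact (stronglyMeasurable_condExp (m := filt X n) (μ := μ)
    (f := fun ω' => ε k ω' ^ 4)).measurable measurableSet_Iic

lemma le_of_mem_fourthLE {K : ℝ} {n : ℕ} {ω : Ω} (h : ω ∈ fourthLE X ε μ K n) {k : ℕ}
    (hk : k ∈ gen (n + 1)) : (μ[fun ω' => ε k ω' ^ 4 | filt X n]) ω ≤ K :=
  Set.mem_iInter₂.1 h k hk

lemma Setting.rho_lt (hs : Setting μ p a b X ε σ ρ) : |ρ| < σ ^ 2 := hs.h2.1

lemma Setting.measurable_mart (hs : Setting μ p a b X ε σ ρ) (n : ℕ) :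
    Measurable (mart p X ε u n) :=
  (measurable_mart_filt hs.one_le hs.bar n).mono (filt_le hs.meas n) le_rfl

lemma Setting.exists_integral_coefSq_le (hs : Setting μ p a b X ε σ ρ)
    (u : Fin 2 × Fin (p + 1) → ℝ) : ∃ C, 0 ≤ C ∧ ∀ n, p - 1 ≤ n →
      Integrable (coefSq p X u n) μ ∧ ∫ ω, coefSq p X u n ω ∂μ ≤ C * 2 ^ n := by
  obtain ⟨C, hC0, hC⟩ := hs.exists_integral_regressor_sq_le
  have hk : ∀ k, 2 ^ (p - 1) ≤ k → Integrable
      (fun ω => coef p X u 0 k ω ^ 2 + coef p X u 1 k ω ^ 2) μ ∧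
      ∫ ω, (coef p X u 0 k ω ^ 2 + coef p X u 1 k ω ^ 2) ∂μ ≤ (∑ i, u i ^ 2) * ((p + 1) * C) := by
    intro k hk
    have hle : ∀ ω, coef p X u 0 k ω ^ 2 + coef p X u 1 k ω ^ 2 ≤
        (∑ i, u i ^ 2) * ∑ j, regressor p X k ω j ^ 2 := fun ω => by
      rw [Fintype.sum_prod_type, Fin.sum_univ_two, add_mul]
      exact add_le_add (coef_sq_le 0 k ω) (coef_sq_le 1 k ω)
    have hi : Integrable (fun ω => (∑ i, u i ^ 2) * ∑ j, regressor p X k ω j ^ 2) μ :=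
      (integrable_finsetSum _ fun j _ => (hC k hk j).1).const_mul _
    have hmeas : ∀ i, Measurable (coef p X u i k) := fun i =>
      Finset.measurable_sum _ fun j _ => (measurable_regressor hs.meas hk j).const_mul _
    refine ⟨hi.mono' (((hmeas 0).pow_const 2).add ((hmeas 1).pow_const 2)).aestronglyMeasurable
      (Eventually.of_forall fun ω => ?_), ?_⟩
    · rw [Real.norm_of_nonneg (by positivity)]; exact hle ω
    · refine (integral_mono_of_nonneg (Eventually.of_forall fun ω => by positivity) hi
        (Eventually.of_forall hle)).trans ?_
      rw [integral_const_mul, integral_finsetSum _ fun j _ => (hC k hk j).1]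
      refine mul_le_mul_of_nonneg_left ?_ (Finset.sum_nonneg fun i _ => sq_nonneg _)
      refine (Finset.sum_le_sum fun j _ => (hC k hk j).2).trans (le_of_eq ?_)
      simp
  refine ⟨(∑ i, u i ^ 2) * ((p + 1) * C), by positivity, fun n hn => ?_⟩
  have hg : ∀ k ∈ gen n, 2 ^ (p - 1) ≤ k := fun k hk => le_of_mem_gen hn hk
  refine ⟨integrable_finsetSum _ fun k h => (hk k (hg k h)).1, ?_⟩
  unfold coefSq
  rw [integral_finsetSum _ fun k h => (hk k (hg k h)).1]
  refine (Finset.sum_le_sum fun k h => (hk k (hg k h)).2).trans (le_of_eq ?_)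
  rw [Finset.sum_const, card_gen]
  simp [mul_comm]

lemma Setting.integrable_incrVar (hs : Setting μ p a b X ε σ ρ) {n : ℕ} (hn : p - 1 ≤ n) :
    Integrable (incrVar p X σ ρ u n) μ := by
  obtain ⟨C, -, hC⟩ := hs.exists_integral_coefSq_le u
  refine ((hC n hn).1.const_mul (2 * σ ^ 2)).mono'
    ((measurable_incrVar_filt hn).mono (filt_le hs.meas n) le_rfl).aestronglyMeasurable
    (Eventually.of_forall fun ω => ?_)
  rw [Real.norm_of_nonneg (incrVar_nonneg hs.rho_lt n ω)]
  exact incrVar_le hs.rho_lt n ω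

lemma Setting.exists_integral_incrVar_le (hs : Setting μ p a b X ε σ ρ)
    (u : Fin 2 × Fin (p + 1) → ℝ) : ∃ C, 0 ≤ C ∧ ∀ n, p - 1 ≤ n →
      ∫ ω, incrVar p X σ ρ u n ω ∂μ ≤ C * 2 ^ n := by
  obtain ⟨C, hC0, hC⟩ := hs.exists_integral_coefSq_le u
  refine ⟨2 * σ ^ 2 * C, by positivity, fun n hn => ?_⟩
  refine (integral_mono (hs.integrable_incrVar hn) ((hC n hn).1.const_mul (2 * σ ^ 2))
    fun ω => incrVar_le hs.rho_lt n ω).trans ?_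
  rw [integral_const_mul, mul_assoc (2 * σ ^ 2)]
  exact mul_le_mul_of_nonneg_left (hC n hn).2 (by positivity)

lemma Setting.exists_integral_incr_sq_le (hs : Setting μ p a b X ε σ ρ)
    (u : Fin 2 × Fin (p + 1) → ℝ) : ∃ C, 0 ≤ C ∧ ∀ n, p - 1 ≤ n →
      Integrable (fun ω => incr p X ε u n ω ^ 2) μ ∧ ∫ ω, incr p X ε u n ω ^ 2 ∂μ ≤ C * 2 ^ n := by
  obtain ⟨C, hC0, hC⟩ := hs.exists_integral_incrVar_le u
  refine ⟨C, hC0, fun n hn => ?_⟩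
  obtain ⟨κ, hκm, hlaw, hm, -⟩ := exists_noiseKernel hs.one_le hs.meas hs.bar hs.h1 hs.h2 hs.h3 hn
  have := integral_linNoise_sq_le (measurable_toPast hs.meas n) (fun i : gen n =>
    measurable_sisters hs.one_le hs.meas hs.bar (le_of_mem_gen hn i.2)) hlaw hm
    (measurable_pastCoef (u := u) hn 0) (measurable_pastCoef hn 1)
    (σ := σ) (ρ := ρ) ((hs.integrable_incrVar hn).congr (Eventually.of_forall fun ω =>
      (linVar_pastCoef σ ρ n ω).symm))
  simp only [linVar_pastCoef, linNoise_pastCoef] at this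
  exact ⟨this.1, this.2.trans (hC n hn)⟩

/-- The recursion `(m + δ)² ≤ (3/2) m² + 3 δ²` gives a bound of the second moments of the right
order, with no need of orthogonality. -/
lemma Setting.exists_integral_mart_sq_le (hs : Setting μ p a b X ε σ ρ)
    (u : Fin 2 × Fin (p + 1) → ℝ) : ∃ C, 0 ≤ C ∧ ∀ n, p - 1 ≤ n →
      Integrable (fun ω => mart p X ε u n ω ^ 2) μ ∧ ∫ ω, mart p X ε u n ω ^ 2 ∂μ ≤ C * 2 ^ n := by
  obtain ⟨C, hC0, hC⟩ := hs.exists_integral_incr_sq_le u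
  refine ⟨6 * C, by positivity, fun n hn => ?_⟩
  have hp := hs.one_le
  induction n, hn using Nat.le_induction with
  | base =>
    have h : p - 1 < p := by omega
    simp only [mart_of_lt h]
    simp; positivity
  | succ n hn ih =>
    obtain ⟨i1, i2⟩ := ih
    obtain ⟨j1, j2⟩ := hC n hn
    have hle : ∀ ω, mart p X ε u (n + 1) ω ^ 2 ≤
        3 / 2 * mart p X ε u n ω ^ 2 + 3 * incr p X ε u n ω ^ 2 := fun ω => by
      rw [mart_succ hp hn]
      nlinarith [sq_nonneg (mart p X ε u n ω - 2 * incr p X ε u n ω)]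
    have hi : Integrable (fun ω => 3 / 2 * mart p X ε u n ω ^ 2 + 3 * incr p X ε u n ω ^ 2) μ :=
      (i1.const_mul _).add (j1.const_mul _)
    refine ⟨hi.mono' ((hs.measurable_mart _).pow_const 2).aestronglyMeasurable
      (Eventually.of_forall fun ω => ?_), ?_⟩
    · rw [Real.norm_of_nonneg (by positivity)]; exact hle ω
    · refine (integral_mono_of_nonneg (Eventually.of_forall fun ω => by positivity) hi
        (Eventually.of_forall hle)).trans ?_
      rw [integral_add (i1.const_mul _) (j1.const_mul _), integral_const_mul, integral_const_mul,
        pow_succ]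
      linarith

lemma Setting.integral_sqIncr_sq_le (hs : Setting μ p a b X ε σ ρ) {n : ℕ} (hn : p - 1 ≤ n)
    {A : Set Ω} (hA : MeasurableSet[filt X n] A) {K C : ℝ} (hK : 0 ≤ K)
    (hAK : A ⊆ fourthLE X ε μ K n) (hC0 : 0 ≤ C) (hAC : ∀ ω ∈ A, coefSq p X u n ω ≤ C) :
    Integrable (fun ω => sqIncr p X ε σ ρ u A n ω ^ 2) μ ∧
      ∫ ω, sqIncr p X ε σ ρ u A n ω ^ 2 ∂μ ≤
        16 * σ ^ 2 * C * (∫ ω, mart p X ε u n ω ^ 2 ∂μ) + 48 * K * C ^ 2 := by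
  obtain ⟨κ, hκm, hlaw, hm, h4⟩ := exists_noiseKernel hs.one_le hs.meas hs.bar hs.h1 hs.h2 hs.h3 hn
  obtain ⟨C', -, hC'⟩ := hs.exists_integral_mart_sq_le u
  have := integral_sq_increment_indicator_le (measurable_toPast hs.meas n) (fun i : gen n =>
    measurable_sisters hs.one_le hs.meas hs.bar (le_of_mem_gen hn i.2)) hlaw hm
    (measurable_pastCoef (u := u) hn 0) (measurable_pastCoef hn 1) hs.rho_lt (measurableSet_onPast hA) hK
    (by
      filter_upwards [h4] with ω h hω i
      rw [(h i).1, (h i).2]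
      exact ⟨le_of_mem_fourthLE (hAK hω) (daughters_mem_gen i.2).1,
        le_of_mem_fourthLE (hAK hω) (daughters_mem_gen i.2).2⟩) hC0
    (fun x hx => (Finset.sum_coe_sort (gen n) fun k =>
      coef p X u 0 k x ^ 2 + coef p X u 1 k x ^ 2).trans_le (hAC x hx))
    (measurable_onPast (measurable_mart_filt hs.one_le hs.bar n)) (hC' n hn).1
  simp only [indicator_toPast] at this
  exact this

lemma Setting.integral_mul_sqIncr_eq_zero (hs : Setting μ p a b X ε σ ρ) {n : ℕ} (hn : p - 1 ≤ n)
    {A : Set Ω} (hA : MeasurableSet[filt X n] A) {g : Ω → ℝ} (hg : Measurable[filt X n] g)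
    (hint : Integrable (fun ω => g ω * sqIncr p X ε σ ρ u A n ω) μ) :
    ∫ ω, g ω * sqIncr p X ε σ ρ u A n ω ∂μ = 0 := by
  obtain ⟨κ, hκm, hlaw, hm, -⟩ := exists_noiseKernel hs.one_le hs.meas hs.bar hs.h1 hs.h2 hs.h3 hn
  have := integral_mul_increment_indicator_eq_zero (measurable_toPast hs.meas n) (fun i : gen n =>
    measurable_sisters hs.one_le hs.meas hs.bar (le_of_mem_gen hn i.2)) hlaw hm
    (measurable_pastCoef (u := u) hn 0) (measurable_pastCoef (u := u) hn 1) (measurableSet_onPast hA)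
    (measurable_onPast (measurable_mart_filt (ε := ε) (u := u) hs.one_le hs.bar n))
    (measurable_onPast hg) (σ := σ) (ρ := ρ)
    (hint.congr (Eventually.of_forall fun ω => by
      simp only [indicator_toPast, onPast_toPast]))
  simp only [indicator_toPast, onPast_toPast] at this
  exact this

/-- The truncated sums of the centred squares of the noise of the daughters `i` of a generation. -/
lemma Setting.integral_sum_noise_sq_le (hs : Setting μ p a b X ε σ ρ) {n : ℕ} (hn : p - 1 ≤ n)
    {K : ℝ} (hK : 0 ≤ K) (i : Fin 2) :
    Integrable (fun ω => ((fourthLE X ε μ K n).indicator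
      (fun ω => ∑ k ∈ gen n, (ε (2 * k + (i : ℕ)) ω ^ 2 - σ ^ 2)) ω) ^ 2) μ ∧
    ∫ ω, ((fourthLE X ε μ K n).indicator
      (fun ω => ∑ k ∈ gen n, (ε (2 * k + (i : ℕ)) ω ^ 2 - σ ^ 2)) ω) ^ 2 ∂μ ≤ K * 2 ^ n := by
  classical
  obtain ⟨κ, hκm, hlaw, hm, h4⟩ := exists_noiseKernel hs.one_le hs.meas hs.bar hs.h1 hs.h2 hs.h3 hn
  have hξ := fun i : gen n =>
    measurable_sisters hs.one_le hs.meas hs.bar (le_of_mem_gen hn i.2)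
  have hcard : (Fintype.card (gen n) : ℝ) * K = K * 2 ^ n := by
    rw [Fintype.card_coe, card_gen]; push_cast; ring
  have key : ∀ (π : ℝ × ℝ → ℝ), (∀ k ω, π (sisters ε k ω) = ε (2 * k + (i : ℕ)) ω) → ∀ ω,
      {x | onPast X n (· ∈ fourthLE X ε μ K n) x}.indicator
        (fun _ => ∑ k : gen n, (π (sisters ε k ω) ^ 2 - σ ^ 2)) (toPast X n ω) =
      (fourthLE X ε μ K n).indicator
        (fun ω => ∑ k ∈ gen n, (ε (2 * k + (i : ℕ)) ω ^ 2 - σ ^ 2)) ω := by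
    intro π hπ ω
    simp only [hπ]
    rw [Set.indicator_apply, Set.indicator_apply,
      Finset.sum_coe_sort (gen n) fun k => ε (2 * k + (i : ℕ)) ω ^ 2 - σ ^ 2]
    exact if_congr mem_onPast rfl rfl
  fin_cases i
  · have := integral_sum_sq_sub_indicator_le (measurable_toPast hs.meas n) hξ hlaw hm
      (measurableSet_onPast (measurableSet_fourthLE K n)) hK (π := Prod.fst) measurable_fst
      (by filter_upwards [hm] with ω h i using ⟨(h i).fst4, (h i).fst2⟩)
      (by
        filter_upwards [h4] with ω h hω i
        rw [(h i).1]
        exact le_of_mem_fourthLE hω (daughters_mem_gen i.2).1)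
    simp only [key Prod.fst (fun k ω => rfl), hcard] at this
    exact this
  · have := integral_sum_sq_sub_indicator_le (measurable_toPast hs.meas n) hξ hlaw hm
      (measurableSet_onPast (measurableSet_fourthLE K n)) hK (π := Prod.snd) measurable_snd
      (by filter_upwards [hm] with ω h i using ⟨(h i).snd4, (h i).snd2⟩)
      (by
        filter_upwards [h4] with ω h hω i
        rw [(h i).2]
        exact le_of_mem_fourthLE hω (daughters_mem_gen i.2).2)
    simp only [key Prod.snd (fun k ω => rfl), hcard] at this
    exact this

end Autoregression

/-! ### Almost sure limits of averages over a generation -/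

section BorelCantelli

variable {Ω : Type*} [MeasurableSpace Ω] {μ : Measure Ω}

/-- A form of the Borel–Cantelli lemma: if the second moments are summable then so are, almost
surely, the squares. -/
lemma ae_tendsto_zero_of_summable_integral_sq {f : ℕ → Ω → ℝ}
    (hf : ∀ n, Integrable (fun ω => f n ω ^ 2) μ) (hs : Summable fun n => ∫ ω, f n ω ^ 2 ∂μ) :
    ∀ᵐ ω ∂μ, Tendsto (fun n => f n ω) atTop (𝓝 0) := by
  have hm : ∀ n, AEMeasurable (fun ω => ENNReal.ofReal (f n ω ^ 2)) μ := fun n =>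
    (hf n).aestronglyMeasurable.aemeasurable.ennreal_ofReal
  have hfin : ∫⁻ ω, ∑' n, ENNReal.ofReal (f n ω ^ 2) ∂μ ≠ ⊤ := by
    rw [lintegral_tsum hm]
    have : ∀ n, ∫⁻ ω, ENNReal.ofReal (f n ω ^ 2) ∂μ = ENNReal.ofReal (∫ ω, f n ω ^ 2 ∂μ) := fun n =>
      (ofReal_integral_eq_lintegral_ofReal (hf n) (Eventually.of_forall fun ω => sq_nonneg _)).symm
    simp_rw [this]
    rw [← ENNReal.ofReal_tsum_of_nonneg (fun n => integral_nonneg fun ω => sq_nonneg _) hs]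
    exact ENNReal.ofReal_ne_top
  filter_upwards [ae_lt_top' (AEMeasurable.tsum hm) hfin] with ω hω
  have h0 := ENNReal.tendsto_atTop_zero_of_tsum_ne_top hω.ne
  have h1 : Tendsto (fun n => f n ω ^ 2) atTop (𝓝 0) := by
    have := (ENNReal.tendsto_toReal ENNReal.zero_ne_top).comp h0
    refine this.congr fun n => ?_
    simp [ENNReal.toReal_ofReal (sq_nonneg (f n ω))]
  have h2 : Tendsto (fun n => Real.sqrt (f n ω ^ 2)) atTop (𝓝 0) := by
    have := (Real.continuous_sqrt.tendsto 0).comp h1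
    rwa [Real.sqrt_zero] at this
  simp_rw [Real.sqrt_sq_eq_abs] at h2
  exact (tendsto_zero_iff_abs_tendsto_zero _).2 h2

lemma ae_tendsto_div_two_pow {g : ℕ → Ω → ℝ} {q : ℕ} {C : ℝ}
    (hg : ∀ n, q ≤ n → Integrable (fun ω => g n ω ^ 2) μ ∧ ∫ ω, g n ω ^ 2 ∂μ ≤ C * 2 ^ n) :
    ∀ᵐ ω ∂μ, Tendsto (fun n => g n ω / 2 ^ n) atTop (𝓝 0) := by
  have e : ∀ n ω, (g n ω / 2 ^ n) ^ 2 = (1 / (2 ^ n) ^ 2) * g n ω ^ 2 := fun n ω => by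
    rw [div_pow]; ring
  have hi : ∀ n, Integrable (fun ω => (g (n + q) ω / 2 ^ (n + q)) ^ 2) μ := fun n => by
    simp_rw [e]; exact (hg _ (by omega)).1.const_mul _
  have hC : 0 ≤ C := by
    have h1 := (integral_nonneg fun ω => sq_nonneg (g q ω)).trans (hg q le_rfl).2
    exact nonneg_of_mul_nonneg_left h1 (by positivity)
  have hs : Summable fun n => ∫ ω, (g (n + q) ω / 2 ^ (n + q)) ^ 2 ∂μ := by
    refine Summable.of_nonneg_of_le (fun n => integral_nonneg fun ω => sq_nonneg _) (fun n => ?_)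
      ((summable_geometric_two).mul_left C)
    simp_rw [e]
    rw [integral_const_mul]
    refine (mul_le_mul_of_nonneg_left (hg _ (by omega)).2 (by positivity)).trans ?_
    have h2 : (2 : ℝ) ^ n ≤ 2 ^ (n + q) := pow_le_pow_right₀ (by norm_num) (by omega)
    have h3 : 1 / (2 ^ (n + q)) ^ 2 * (C * 2 ^ (n + q)) = C * (1 / (2 : ℝ) ^ (n + q)) := by
      field_simp
    rw [h3, one_div_pow]
    exact mul_le_mul_of_nonneg_left (one_div_le_one_div_of_le (by positivity) h2) hC
  filter_upwards [ae_tendsto_zero_of_summable_integral_sq hi hs] with ω hω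
  exact (tendsto_add_atTop_iff_nat q).1 hω

end BorelCantelli

section Autoregression

variable {Ω : Type*} {X ε : ℕ → Ω → ℝ} {p : ℕ} {a b : Fin (p + 1) → ℝ}

section Pathwise

variable {ω : Ω} {σ : ℝ}

/-- The average of a family over generation `n`. -/
noncomputable def genAvg (f : ℕ → ℝ) (n : ℕ) : ℝ := (∑ k ∈ gen n, f k) / 2 ^ n

lemma genAvg_add (f g : ℕ → ℝ) (n : ℕ) :
    genAvg (fun k => f k + g k) n = genAvg f n + genAvg g n := by
  simp [genAvg, Finset.sum_add_distrib, add_div]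

lemma genAvg_const_mul (c : ℝ) (f : ℕ → ℝ) (n : ℕ) :
    genAvg (fun k => c * f k) n = c * genAvg f n := by
  simp [genAvg, ← Finset.mul_sum, mul_div_assoc]

lemma genAvg_const (c : ℝ) (n : ℕ) : genAvg (fun _ => c) n = c := by
  simp [genAvg, card_gen]

lemma genAvg_sum {ι : Type*} (s : Finset ι) (f : ι → ℕ → ℝ) (n : ℕ) :
    genAvg (fun k => ∑ i ∈ s, f i k) n = ∑ i ∈ s, genAvg (f i) n := by
  unfold genAvg
  rw [Finset.sum_comm, Finset.sum_div]

lemma genAvg_succ (f : ℕ → ℝ) (n : ℕ) : genAvg f (n + 1) =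
    1 / 2 * (genAvg (fun k => f (2 * k)) n + genAvg (fun k => f (2 * k + 1)) n) := by
  unfold genAvg
  rw [sum_gen_succ, Finset.sum_add_distrib, pow_succ]
  field_simp

lemma genAvg_congr {f g : ℕ → ℝ} {n : ℕ} (h : ∀ k ∈ gen n, f k = g k) : genAvg f n = genAvg g n := by
  unfold genAvg
  rw [Finset.sum_congr rfl h]

lemma regressor_zero (k : ℕ) : regressor p X k ω 0 = 1 := rfl

lemma regressor_succ (k : ℕ) (i : Fin p) : regressor p X k ω i.succ = state p X k ω i := rfl

variable (hη : ∀ (i : Fin 2) (j : Fin (p + 1)), Tendsto (genAvg fun k =>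
    regressor p X k ω j * ε (2 * k + (i : ℕ)) ω) atTop (𝓝 0))
include hη

/-- If the noise averages out, then the averages of the states converge to the fixed point
`λ` of the averaged recursion. -/
lemma tendsto_genAvg_state (hBAR : IsBAR p a b X ε)
    (h : Contracting (companion a) (companion b)) (i : Fin p) :
    Tendsto (genAvg fun k => state p X k ω i) atTop (𝓝 (lam a b i)) := by
  obtain ⟨N, β, c, hβ0, hβ, hc0, -, hc, hA, hB⟩ := h.exists_norm
  set y : ℕ → Fin p → ℝ := fun n i => genAvg (fun k => state p X k ω i) n with hy
  set η : Fin 2 → ℕ → ℝ := fun i => genAvg fun k => ε (2 * k + (i : ℕ)) ω with hηdef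
  have hη0 : ∀ i, Tendsto (η i) atTop (𝓝 0) := fun i => by
    simpa [regressor_zero] using hη i 0
  have hmul : ∀ (A : Matrix (Fin p) (Fin p) ℝ) n i,
      genAvg (fun k => (A *ᵥ state p X k ω) i) n = (A *ᵥ y n) i := fun A n i => by
    simp only [Matrix.mulVec, dotProduct, genAvg_sum, genAvg_const_mul, hy]
  have hrec : ∀ n, p - 1 ≤ n → y (n + 1) = (1 / 2 : ℝ) • (companion a *ᵥ y n + companion b *ᵥ y n) +
      ((a 0 + b 0) / 2 + 1 / 2 * (η 0 n + η 1 n)) • e1 p := by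
    intro n hn
    ext i
    have e0 : genAvg (fun k => state p X (2 * k) ω i) n =
        (companion a *ᵥ y n) i + (a 0 + η 0 n) * e1 p i := by
      rw [genAvg_congr (g := fun k => (companion a *ᵥ state p X k ω) i +
        (e1 p i * a 0 + e1 p i * ε (2 * k + ((0 : Fin 2) : ℕ)) ω)) fun k hk => by
          rw [state_two_mul hBAR (le_of_mem_gen hn hk)]; simp; ring, genAvg_add, genAvg_add,
        genAvg_const, genAvg_const_mul, hmul]
      ring
    have e1' : genAvg (fun k => state p X (2 * k + 1) ω i) n =
        (companion b *ᵥ y n) i + (b 0 + η 1 n) * e1 p i := by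
      rw [genAvg_congr (g := fun k => (companion b *ᵥ state p X k ω) i +
        (e1 p i * b 0 + e1 p i * ε (2 * k + ((1 : Fin 2) : ℕ)) ω)) fun k hk => by
          rw [state_two_mul_add_one hBAR (le_of_mem_gen hn hk)]; simp; ring, genAvg_add, genAvg_add,
        genAvg_const, genAvg_const_mul, hmul]
      ring
    simp only [hy, genAvg_succ, Pi.add_apply, Pi.smul_apply, smul_eq_mul] at e0 e1' ⊢
    rw [e0, e1']
    ring
  have hlam := lam_eq h
  have hN : Tendsto (fun n => N (y (n + (p - 1)) - lam a b)) atTop (𝓝 0) := by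
    refine tendsto_zero_of_contraction (β := β)
      (e := fun n => |1 / 2 * (η 0 (n + (p - 1)) + η 1 (n + (p - 1)))| * N (e1 p)) hβ0 hβ
      (fun n => apply_nonneg N _) (fun n => ?_) ?_
    · have e : y (n + 1 + (p - 1)) - lam a b =
          (1 / 2 : ℝ) • (companion a *ᵥ (y (n + (p - 1)) - lam a b)) +
          (1 / 2 : ℝ) • (companion b *ᵥ (y (n + (p - 1)) - lam a b)) +
          (1 / 2 * (η 0 (n + (p - 1)) + η 1 (n + (p - 1)))) • e1 p := by
        conv_lhs => rw [hlam]
        rw [show n + 1 + (p - 1) = (n + (p - 1)) + 1 by ring, hrec _ (by omega),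
          Matrix.mulVec_sub, Matrix.mulVec_sub]
        module
      rw [e]
      refine (map_add_le_add N _ _).trans ?_
      rw [map_smul_eq_mul N _ (e1 p), Real.norm_eq_abs]
      refine add_le_add ((map_add_le_add N _ _).trans ?_) le_rfl
      rw [map_smul_eq_mul, map_smul_eq_mul, Real.norm_of_nonneg (by norm_num)]
      have h1 := hA (y (n + (p - 1)) - lam a b)
      have h2 := hB (y (n + (p - 1)) - lam a b)
      linarith
    · have h1 : Tendsto (fun n => |1 / 2 * (η 0 n + η 1 n)| * N (e1 p)) atTop (𝓝 0) := by
        have := ((((hη0 0).add (hη0 1)).const_mul (1 / 2)).abs).mul_const (N (e1 p))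
        rwa [add_zero, mul_zero, abs_zero, zero_mul] at this
      exact (tendsto_add_atTop_iff_nat (p - 1)).2 h1
  have hN' := (tendsto_add_atTop_iff_nat (f := fun n => N (y n - lam a b)) (p - 1)).1 hN
  rw [← tendsto_sub_nhds_zero_iff]
  refine squeeze_zero_norm (fun n => ?_) (by simpa using hN'.const_mul c)
  exact hc (y n - lam a b) i

/-- If moreover the squares of the noise average to `σ²`, then the averages of the outer squares of
the states converge to the solution of the Lyapunov equation. -/
lemma tendsto_genAvg_state_mul (hBAR : IsBAR p a b X ε)
    (h : Contracting (companion a) (companion b))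
    (hη2 : ∀ i : Fin 2, Tendsto (genAvg fun k => ε (2 * k + (i : ℕ)) ω ^ 2) atTop (𝓝 (σ ^ 2)))
    {ℓ : Matrix (Fin p) (Fin p) ℝ} (hℓ : IsEll a b σ ℓ) (i j : Fin p) :
    Tendsto (genAvg fun k => state p X k ω i * state p X k ω j) atTop (𝓝 (ℓ i j)) := by
  obtain ⟨N, β, c, hβ0, hβ, hc0, -, hc, hA, hB⟩ := h.exists_norm
  obtain ⟨D, hD, hle⟩ := entrySum_lyap_pow_le hβ0 hA hB hc0 hc
  have hlim := tendsto_genAvg_state hη hBAR h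
  set y : ℕ → Matrix (Fin p) (Fin p) ℝ := fun n => Matrix.of fun i j =>
    genAvg (fun k => state p X k ω i * state p X k ω j) n with hy
  set r : Fin 2 → ℝ → ℕ → Fin p → ℝ := fun i c n j =>
    genAvg (fun k => (c + ε (2 * k + (i : ℕ)) ω) * state p X k ω j) n with hr
  set t : Fin 2 → ℝ → ℕ → ℝ := fun i c n => genAvg (fun k => (c + ε (2 * k + (i : ℕ)) ω) ^ 2) n
    with ht
  have hrlim : ∀ i c, Tendsto (r i c) atTop (𝓝 (c • lam a b)) := fun i c => by
    rw [tendsto_pi_nhds]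
    intro j
    have : (fun n => r i c n j) = fun n => c * genAvg (fun k => state p X k ω j) n +
        genAvg (fun k => regressor p X k ω j.succ * ε (2 * k + (i : ℕ)) ω) n := by
      ext n
      rw [← genAvg_const_mul, ← genAvg_add]
      exact genAvg_congr fun k _ => by rw [regressor_succ]; ring
    rw [this]
    simpa using ((hlim j).const_mul c).add (hη i j.succ)
  have htlim : ∀ i c, Tendsto (t i c) atTop (𝓝 (c ^ 2 + σ ^ 2)) := fun i c => by
    have : t i c = fun n => c ^ 2 + 2 * c * genAvg (fun k => regressor p X k ω 0 *
        ε (2 * k + (i : ℕ)) ω) n + genAvg (fun k => ε (2 * k + (i : ℕ)) ω ^ 2) n := by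
      ext n
      rw [← genAvg_const_mul, ← genAvg_const (c ^ 2) n, ← genAvg_add, ← genAvg_add]
      exact genAvg_congr fun k _ => by rw [regressor_zero]; ring
    rw [this]
    simpa using ((tendsto_const_nhds (x := c ^ 2)).add ((hη i 0).const_mul (2 * c))).add (hη2 i)
  -- the contribution of the two daughters
  let G : Matrix (Fin p) (Fin p) ℝ → (Fin p → ℝ) → ℝ → Matrix (Fin p) (Fin p) ℝ := fun A r t =>
    Matrix.vecMulVec (A *ᵥ r) (e1 p) + Matrix.vecMulVec (e1 p) (A *ᵥ r) +
      t • Matrix.vecMulVec (e1 p) (e1 p)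
  have hmul : ∀ (A : Matrix (Fin p) (Fin p) ℝ) n i' j',
      genAvg (fun k => (A *ᵥ state p X k ω) i' * (A *ᵥ state p X k ω) j') n =
        (A * y n * Aᵀ) i' j' := fun A n i' j' => by
    simp only [Matrix.mulVec, dotProduct, Matrix.mul_apply, Matrix.transpose_apply, hy,
      Matrix.of_apply, Finset.sum_mul_sum]
    simp only [genAvg_sum, Finset.sum_mul]
    rw [Finset.sum_comm]
    refine Finset.sum_congr rfl fun x _ => ?_
    refine Finset.sum_congr rfl fun z _ => ?_
    rw [mul_right_comm, ← genAvg_const_mul]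
    exact genAvg_congr fun k _ => by ring
  have hmul1 : ∀ (A : Matrix (Fin p) (Fin p) ℝ) n i' c j',
      genAvg (fun k => (c + ε (2 * k + ((i' : Fin 2) : ℕ)) ω) * (A *ᵥ state p X k ω) j') n =
        (A *ᵥ r i' c n) j' := fun A n i' c j' => by
    simp only [Matrix.mulVec, dotProduct, Finset.mul_sum, hr]
    rw [genAvg_sum]
    refine Finset.sum_congr rfl fun z _ => ?_
    rw [← genAvg_const_mul]
    exact genAvg_congr fun k _ => by ring
  have hdaughter : ∀ (d : Fin 2) (a' : Fin (p + 1) → ℝ) n i' j', (∀ k ∈ gen n,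
      state p X (2 * k + (d : ℕ)) ω =
        companion a' *ᵥ state p X k ω + (a' 0 + ε (2 * k + (d : ℕ)) ω) • e1 p) →
      genAvg (fun k => state p X (2 * k + (d : ℕ)) ω i' * state p X (2 * k + (d : ℕ)) ω j') n =
        (companion a' * y n * (companion a')ᵀ) i' j' +
          G (companion a') (r d (a' 0) n) (t d (a' 0) n) i' j' := by
    intro d a' n i' j' hs
    rw [genAvg_congr (g := fun k => (companion a' *ᵥ state p X k ω) i' *
        (companion a' *ᵥ state p X k ω) j' +
        (e1 p j' * ((a' 0 + ε (2 * k + (d : ℕ)) ω) * (companion a' *ᵥ state p X k ω) i') +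
        (e1 p i' * ((a' 0 + ε (2 * k + (d : ℕ)) ω) * (companion a' *ᵥ state p X k ω) j') +
        (e1 p i' * e1 p j') * (a' 0 + ε (2 * k + (d : ℕ)) ω) ^ 2))) fun k hk => by
          rw [hs k hk]; simp only [Pi.add_apply, Pi.smul_apply, smul_eq_mul]; ring,
      genAvg_add, genAvg_add, genAvg_add, genAvg_const_mul, genAvg_const_mul, genAvg_const_mul,
      hmul, hmul1, hmul1]
    simp only [G, Matrix.add_apply, Matrix.smul_apply, Matrix.vecMulVec_apply, smul_eq_mul, ht]
    ring
  have hrec : ∀ n, p - 1 ≤ n → y (n + 1) = lyap (companion a) (companion b) (y n) +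
      (1 / 2 : ℝ) • (G (companion a) (r 0 (a 0) n) (t 0 (a 0) n) +
        G (companion b) (r 1 (b 0) n) (t 1 (b 0) n)) := by
    intro n hn
    ext i' j'
    have e0 := hdaughter 0 a n i' j' fun k hk => by
      simpa using state_two_mul hBAR (le_of_mem_gen hn hk) ω
    have e1' := hdaughter 1 b n i' j' fun k hk => by
      simpa using state_two_mul_add_one hBAR (le_of_mem_gen hn hk) ω
    simp only [Fin.val_zero, Fin.val_one, add_zero] at e0 e1'
    rw [lyap_apply]
    simp only [Matrix.add_apply, Matrix.smul_apply, smul_eq_mul]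
    rw [show y (n + 1) i' j' = genAvg (fun k => state p X k ω i' * state p X k ω j') (n + 1) from
      rfl, genAvg_succ, e0, e1']
    ring
  have hG : ∀ A, Continuous fun z : (Fin p → ℝ) × ℝ => G A z.1 z.2 := fun A => by
    have h1 : Continuous fun z : (Fin p → ℝ) × ℝ => A *ᵥ z.1 :=
      continuous_const.matrix_mulVec continuous_fst
    exact ((h1.matrix_vecMulVec continuous_const).add (continuous_const.matrix_vecMulVec h1)).add
      (continuous_snd.smul continuous_const)
  have hGlim : Tendsto (fun n => (1 / 2 : ℝ) • (G (companion a) (r 0 (a 0) n) (t 0 (a 0) n) +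
      G (companion b) (r 1 (b 0) n) (t 1 (b 0) n)) - T a b σ) atTop (𝓝 0) := by
    rw [tendsto_sub_nhds_zero_iff]
    have h0 := ((hG (companion a)).tendsto _).comp ((hrlim 0 (a 0)).prodMk_nhds (htlim 0 (a 0)))
    have h1 := ((hG (companion b)).tendsto _).comp ((hrlim 1 (b 0)).prodMk_nhds (htlim 1 (b 0)))
    have hT : T a b σ = (1 / 2 : ℝ) • (G (companion a) (a 0 • lam a b) (a 0 ^ 2 + σ ^ 2) +
        G (companion b) (b 0 • lam a b) (b 0 ^ 2 + σ ^ 2)) := by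
      simp only [T, G, Matrix.mulVec_smul, Matrix.smul_vecMulVec, Matrix.vecMulVec_smul]
      module
    rw [hT]
    exact (h0.add h1).const_smul (1 / 2 : ℝ)
  have hcont : Continuous (entrySum (p := p)) := by
    unfold entrySum
    exact continuous_finsetSum _ fun i _ => continuous_finsetSum _ fun j _ =>
      (continuous_apply_apply i j).abs
  have hfin := tendsto_zero_of_linear_recursion (lyap (companion a) (companion b)) entrySum
    entrySum_nonneg entrySum_add (sq_nonneg β) (by nlinarith) hle hD
    (x := fun n => y (n + (p - 1)) - ℓ) (e := fun n => (1 / 2 : ℝ) •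
      (G (companion a) (r 0 (a 0) (n + (p - 1))) (t 0 (a 0) (n + (p - 1))) +
      G (companion b) (r 1 (b 0) (n + (p - 1))) (t 1 (b 0) (n + (p - 1)))) - T a b σ)
    (fun n => by
      have hℓ' := isEll_iff.1 hℓ
      conv_lhs => rw [hℓ']
      rw [show n + 1 + (p - 1) = (n + (p - 1)) + 1 by ring, hrec _ (by omega), map_sub]
      abel)
    (by
      have := (hcont.tendsto 0).comp hGlim
      have h0 : entrySum (0 : Matrix (Fin p) (Fin p) ℝ) = 0 := by simp [entrySum]
      rw [h0] at this
      exact (tendsto_add_atTop_iff_nat (p - 1)).2 this)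
  have hfin' := (tendsto_add_atTop_iff_nat (f := fun n => entrySum (y n - ℓ)) (p - 1)).1 hfin
  rw [← tendsto_sub_nhds_zero_iff]
  exact squeeze_zero_norm (fun n => abs_le_entrySum (y n - ℓ) i j) hfin'

lemma tendsto_genAvg_regressor_mul (hBAR : IsBAR p a b X ε)
    (h : Contracting (companion a) (companion b))
    (hη2 : ∀ i : Fin 2, Tendsto (genAvg fun k => ε (2 * k + (i : ℕ)) ω ^ 2) atTop (𝓝 (σ ^ 2)))
    {ℓ : Matrix (Fin p) (Fin p) ℝ} (hℓ : IsEll a b σ ℓ) (i j : Fin (p + 1)) :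
    Tendsto (genAvg fun k => regressor p X k ω i * regressor p X k ω j) atTop
      (𝓝 (L a b ℓ i j)) := by
  refine Fin.cases ?_ (fun i => ?_) i <;> refine Fin.cases ?_ (fun j => ?_) j
  · have : (genAvg fun k => regressor p X k ω 0 * regressor p X k ω 0) = fun _ => 1 := by
      ext n; simp [regressor_zero, genAvg_const]
    rw [this]
    exact tendsto_const_nhds
  · simp only [regressor_zero, one_mul, regressor_succ]
    exact tendsto_genAvg_state hη hBAR h j
  · simp only [regressor_zero, mul_one, regressor_succ]
    exact tendsto_genAvg_state hη hBAR h i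
  · simp only [regressor_succ]
    exact tendsto_genAvg_state_mul hη hBAR h hη2 hℓ i j

end Pathwise

variable [MeasurableSpace Ω] {μ : Measure Ω} [IsProbabilityMeasure μ] {σ ρ : ℝ}

lemma incr_single (i : Fin 2) (j : Fin (p + 1)) (n : ℕ) (ω : Ω) :
    incr p X ε (Pi.single (i, j) 1) n ω / 2 ^ n =
      genAvg (fun k => regressor p X k ω j * ε (2 * k + (i : ℕ)) ω) n := by
  rw [← dotProduct_sum_eq_incr, single_one_dotProduct, genAvg]
  simp only [mul_comm]

/-- Almost surely, the conditional fourth moments of the noise are bounded. -/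
lemma Setting.ae_exists_mem_fourthLE (hs : Setting μ p a b X ε σ ρ) :
    ∀ᵐ ω ∂μ, ∃ K : ℕ, ∀ n, p - 1 ≤ n → ω ∈ fourthLE X ε μ K n := by
  filter_upwards [hs.h3.2] with ω ⟨C, hC⟩
  refine ⟨⌈C⌉₊, fun n hn => Set.mem_iInter₂.2 fun k hk => ?_⟩
  exact (hC n hn k hk).trans (Nat.le_ceil C)

/-- The averages of `Y_k Y_kᵗ` over a generation converge to `L`. The averages of the centred
squares of the noise are only controlled on events on which the conditional fourth moments are at
most an integer `K`; almost surely one of these events occurs for all generations. -/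
theorem Setting.ae_tendsto_genAvg (hs : Setting μ p a b X ε σ ρ)
    {ℓ : Matrix (Fin p) (Fin p) ℝ} (hℓ : IsEll a b σ ℓ) : ∀ᵐ ω ∂μ, ∀ i j,
    Tendsto (genAvg fun k => regressor p X k ω i * regressor p X k ω j) atTop
      (𝓝 (L a b ℓ i j)) := by
  have h1 : ∀ᵐ ω ∂μ, ∀ (i : Fin 2) (j : Fin (p + 1)), Tendsto (genAvg fun k =>
      regressor p X k ω j * ε (2 * k + (i : ℕ)) ω) atTop (𝓝 0) := by
    rw [ae_all_iff]; intro i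
    rw [ae_all_iff]; intro j
    obtain ⟨C, -, hC⟩ := hs.exists_integral_incr_sq_le (Pi.single (i, j) 1)
    filter_upwards [ae_tendsto_div_two_pow hC] with ω hω
    simpa only [incr_single] using hω
  have h2 : ∀ᵐ ω ∂μ, ∀ (K : ℕ) (i : Fin 2), Tendsto (fun n =>
      ((fourthLE X ε μ K n).indicator
        (fun ω => ∑ k ∈ gen n, (ε (2 * k + (i : ℕ)) ω ^ 2 - σ ^ 2)) ω) / 2 ^ n) atTop (𝓝 0) := by
    rw [ae_all_iff]; intro K
    rw [ae_all_iff]; intro i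
    exact ae_tendsto_div_two_pow fun n hn => hs.integral_sum_noise_sq_le hn K.cast_nonneg i
  filter_upwards [h1, h2, hs.ae_exists_mem_fourthLE] with ω hω1 hω2 ⟨K, hK⟩
  refine tendsto_genAvg_regressor_mul hω1 hs.bar hs.contr (fun i => ?_) hℓ
  rw [← tendsto_sub_nhds_zero_iff]
  refine (hω2 K i).congr' ?_
  filter_upwards [eventually_ge_atTop (p - 1)] with n hn
  rw [Set.indicator_of_mem (hK n hn), Finset.sum_sub_distrib, sub_div, genAvg]
  congr 1
  simp [card_gen]

end Autoregression

/-! ### Cesàro averages -/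

section Orthogonal

variable {Ω : Type*} [MeasurableSpace Ω] {μ : Measure Ω}

/-- The strong law of large numbers for orthogonal random variables with bounded second moments.
The averages converge along the squares, and the gaps between squares are negligible. -/
theorem ae_tendsto_average_of_orthogonal {D : ℕ → Ω → ℝ} (hL : ∀ n, MemLp (D n) 2 μ) {C : ℝ}
    (hC : ∀ n, ∫ ω, D n ω ^ 2 ∂μ ≤ C) (ho : ∀ i j, i < j → ∫ ω, D i ω * D j ω ∂μ = 0) :
    ∀ᵐ ω ∂μ, Tendsto (fun n : ℕ => (n : ℝ)⁻¹ * ∑ i ∈ Finset.range n, D i ω) atTop (𝓝 0) := by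
  have hC0 : 0 ≤ C := (integral_nonneg fun ω => sq_nonneg _).trans (hC 0)
  have ho' : ∀ i j, i ≠ j → ∫ ω, D i ω * D j ω ∂μ = 0 := fun i j hij => by
    rcases lt_or_gt_of_ne hij with h | h
    · exact ho i j h
    · rw [← ho j i h]; exact integral_congr_ae (Eventually.of_forall fun ω => mul_comm _ _)
  have hS : ∀ s : Finset ℕ, ∫ ω, (∑ i ∈ s, D i ω) ^ 2 ∂μ ≤ s.card * C := fun s => by
    have hij : ∀ i j, Integrable (fun ω => D i ω * D j ω) μ := fun i j =>
      (hL i).integrable_mul (hL j)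
    simp_rw [sq, Finset.sum_mul_sum]
    rw [integral_finsetSum _ fun i _ => integrable_finsetSum _ fun j _ => hij i j]
    rw [← nsmul_eq_mul]
    refine Finset.sum_le_card_nsmul _ _ _ fun i hi => ?_
    rw [integral_finsetSum _ fun j _ => hij i j, Finset.sum_eq_single i
      (fun j _ hj => ho' i j hj.symm) (fun h => absurd hi h)]
    simpa only [sq] using hC i
  have hG : ∀ s : Finset ℕ, ∫ ω, (∑ i ∈ s, |D i ω|) ^ 2 ∂μ ≤ s.card * (s.card * C) := fun s => by
    have hi : Integrable (fun ω => (s.card : ℝ) * ∑ i ∈ s, D i ω ^ 2) μ :=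
      (integrable_finsetSum _ fun i _ => (hL i).integrable_sq).const_mul _
    refine (integral_mono_of_nonneg (Eventually.of_forall fun ω => sq_nonneg _) hi
      (Eventually.of_forall fun ω => ?_)).trans ?_
    · refine sq_sum_le_card_mul_sum_sq.trans (le_of_eq ?_)
      simp only [sq_abs]
    · rw [integral_const_mul, integral_finsetSum _ fun i _ => (hL i).integrable_sq,
        ← nsmul_eq_mul s.card C]
      exact mul_le_mul_of_nonneg_left (Finset.sum_le_card_nsmul _ _ _ fun i _ => hC i)
        (Nat.cast_nonneg _)
  have hsum : ∀ c : ℝ, Summable fun m : ℕ => c * (1 / (m : ℝ) ^ 2) := fun c =>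
    (Real.summable_one_div_nat_pow.2 (by norm_num)).mul_left c
  -- the partial sums up to a square
  have h1 : ∀ᵐ ω ∂μ, Tendsto (fun m : ℕ => (∑ i ∈ Finset.range (m ^ 2), D i ω) / (m : ℝ) ^ 2)
      atTop (𝓝 0) := by
    refine ae_tendsto_zero_of_summable_integral_sq (fun m => ?_) ?_
    · simp_rw [div_pow]
      exact (memLp_finsetSum _ fun i _ => hL i).integrable_sq.div_const _
    · refine Summable.of_nonneg_of_le (fun m => integral_nonneg fun ω => sq_nonneg _) (fun m => ?_)
        (hsum C)
      simp_rw [div_pow]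
      rw [integral_div]
      rcases Nat.eq_zero_or_pos m with rfl | hm
      · simp
      · have hm' : (0 : ℝ) < m := by exact_mod_cast hm
        have := hS (Finset.range (m ^ 2))
        rw [Finset.card_range] at this
        push_cast at this
        rw [div_le_iff₀ (by positivity)]
        refine this.trans (le_of_eq ?_)
        field_simp
  -- the gaps
  have h2 : ∀ᵐ ω ∂μ, Tendsto (fun m : ℕ =>
      (∑ i ∈ Finset.Ico (m ^ 2) ((m + 1) ^ 2), |D i ω|) / (m : ℝ) ^ 2) atTop (𝓝 0) := by
    refine ae_tendsto_zero_of_summable_integral_sq (fun m => ?_) ?_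
    · simp_rw [div_pow]
      exact (memLp_finsetSum _ fun i _ => (hL i).abs).integrable_sq.div_const _
    · refine Summable.of_nonneg_of_le (fun m => integral_nonneg fun ω => sq_nonneg _) (fun m => ?_)
        (hsum (9 * C))
      simp_rw [div_pow]
      rw [integral_div]
      rcases Nat.eq_zero_or_pos m with rfl | hm
      · simp
      · have hm' : (1 : ℝ) ≤ m := by exact_mod_cast hm
        have := hG (Finset.Ico (m ^ 2) ((m + 1) ^ 2))
        have hcard : ((Finset.Ico (m ^ 2) ((m + 1) ^ 2)).card : ℝ) = 2 * m + 1 := by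
          rw [Nat.card_Ico, Nat.cast_sub (Nat.pow_le_pow_left (by omega) 2)]
          push_cast; ring
        rw [hcard] at this
        rw [div_le_iff₀ (by positivity)]
        refine this.trans ?_
        have e : 9 * C * (1 / (m : ℝ) ^ 2) * ((m : ℝ) ^ 2) ^ 2 = (3 * m) * ((3 * m) * C) := by
          field_simp; ring
        rw [e]
        have h3 : (2 : ℝ) * m + 1 ≤ 3 * m := by linarith
        gcongr
  filter_upwards [h1, h2] with ω w1 w2
  have hsq : Tendsto Nat.sqrt atTop atTop :=
    tendsto_atTop_atTop.2 fun b => ⟨b * b, fun a ha => Nat.le_sqrt.2 ha⟩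
  have hlim := ((w1.abs).add w2).comp hsq
  rw [abs_zero, add_zero] at hlim
  refine squeeze_zero_norm' ?_ hlim
  filter_upwards [eventually_ge_atTop 1] with n hn
  set m := Nat.sqrt n with hm
  have hm1 : 1 ≤ m := Nat.le_sqrt.2 (by simpa using hn)
  have hmn : m ^ 2 ≤ n := Nat.sqrt_le' n
  have hnm : n < (m + 1) ^ 2 := Nat.lt_succ_sqrt' n
  have hm0 : (0 : ℝ) < (m : ℝ) ^ 2 := by
    have : (0 : ℝ) < m := by exact_mod_cast hm1
    positivity
  have hmn' : (m : ℝ) ^ 2 ≤ n := by exact_mod_cast hmn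
  have hle : |∑ i ∈ Finset.range n, D i ω| ≤ |∑ i ∈ Finset.range (m ^ 2), D i ω| +
      ∑ i ∈ Finset.Ico (m ^ 2) ((m + 1) ^ 2), |D i ω| := by
    rw [← Finset.sum_range_add_sum_Ico _ hmn]
    refine (abs_add_le _ _).trans (add_le_add le_rfl ?_)
    refine (Finset.abs_sum_le_sum_abs _ _).trans ?_
    exact Finset.sum_le_sum_of_subset_of_nonneg (Finset.Ico_subset_Ico le_rfl hnm.le)
      fun _ _ _ => abs_nonneg _
  rw [Real.norm_eq_abs, abs_mul, abs_of_nonneg (by positivity : (0 : ℝ) ≤ (n : ℝ)⁻¹)]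
  simp only [Function.comp_apply, abs_div, abs_of_pos hm0, ← add_div, ← hm]
  rw [inv_mul_eq_div]
  gcongr

end Orthogonal

lemma tendsto_div_of_cesaro {y : ℕ → ℝ} {v : ℝ}
    (hy : Tendsto (fun n : ℕ => (n : ℝ)⁻¹ * ∑ i ∈ Finset.range n, y i) atTop (𝓝 v)) :
    Tendsto (fun n : ℕ => y n / (n + 1)) atTop (𝓝 0) := by
  have h1 := (tendsto_add_atTop_iff_nat 1).2 hy
  have h2 := hy.mul (tendsto_natCast_div_add_atTop (1 : ℝ))
  have h3 := h1.sub h2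
  rw [mul_one, sub_self] at h3
  refine h3.congr fun n => ?_
  rw [Finset.sum_range_succ]
  rcases Nat.eq_zero_or_pos n with rfl | hn
  · simp
  · have : (n : ℝ) ≠ 0 := by positivity
    push_cast
    field_simp
    ring

/-- The averages of the solution of `x_{n+1} = (x_n + y_n) / 2` follow those of `y`. -/
lemma tendsto_cesaro_of_halving {x y : ℕ → ℝ} {v : ℝ} (hx : ∀ n, 0 ≤ x n)
    (hrec : ∀ n, x (n + 1) = 1 / 2 * x n + 1 / 2 * y n)
    (hy : Tendsto (fun n : ℕ => (n : ℝ)⁻¹ * ∑ i ∈ Finset.range n, y i) atTop (𝓝 v)) :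
    Tendsto (fun n : ℕ => (n : ℝ)⁻¹ * ∑ i ∈ Finset.range n, x i) atTop (𝓝 v) := by
  have hsum : ∀ n, ∑ i ∈ Finset.range n, x i =
      ∑ i ∈ Finset.range n, y i - 2 * (x n - x 0) := fun n => by
    induction n with
    | zero => simp
    | succ n ih => rw [Finset.sum_range_succ, Finset.sum_range_succ, ih, hrec]; ring
  have h1 : Tendsto (fun n : ℕ => x n / (n + 1)) atTop (𝓝 0) := by
    refine tendsto_zero_of_contraction (β := 1 / 2) (e := fun n => 1 / 2 * |y n / (n + 1)|)
      (by norm_num) (by norm_num) (fun n => div_nonneg (hx n) (by positivity)) (fun n => ?_) ?_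
    · push_cast
      have h2 : x (n + 1) ≤ 1 / 2 * x n + 1 / 2 * |y n| := by
        rw [hrec]; have := le_abs_self (y n); linarith
      have hn : (0 : ℝ) < (n : ℝ) + 1 := by positivity
      calc x (n + 1) / ((n : ℝ) + 1 + 1) ≤ x (n + 1) / ((n : ℝ) + 1) :=
            div_le_div_of_nonneg_left (hx _) hn (by linarith)
        _ ≤ (1 / 2 * x n + 1 / 2 * |y n|) / ((n : ℝ) + 1) := by gcongr
        _ = 1 / 2 * (x n / (n + 1)) + 1 / 2 * |y n / (n + 1)| := by
            rw [abs_div, abs_of_pos hn]; ring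
    · have := (tendsto_div_of_cesaro hy).abs.const_mul (1 / 2)
      rwa [abs_zero, mul_zero] at this
  have h2 : Tendsto (fun n : ℕ => (n : ℝ)⁻¹ * x n) atTop (𝓝 0) := by
    have := (h1.mul (tendsto_inv_atTop_nhds_zero_nat (𝕜 := ℝ))).add h1
    simp only [mul_zero, add_zero] at this
    refine this.congr' ?_
    filter_upwards [eventually_ge_atTop 1] with n hn
    have : (n : ℝ) ≠ 0 := by positivity
    field_simp
    ring
  have h3 : Tendsto (fun n : ℕ => (n : ℝ)⁻¹ * x 0) atTop (𝓝 0) := by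
    simpa using (tendsto_inv_atTop_nhds_zero_nat (𝕜 := ℝ)).mul_const (x 0)
  have h4 := hy.sub ((h2.sub h3).const_mul 2)
  simp only [sub_zero, mul_zero] at h4
  refine h4.congr fun n => ?_
  rw [hsum]; ring

/-- Convergent weights may be replaced by their limit in an average. -/
lemma tendsto_cesaro_mul {x w y : ℕ → ℝ} {l c v : ℝ}
    (hx : Tendsto (fun n : ℕ => (n : ℝ)⁻¹ * ∑ i ∈ Finset.range n, x i) atTop (𝓝 l))
    (hw : Tendsto w atTop (𝓝 c)) (hxy : ∀ n, |x n| ≤ y n)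
    (hy : Tendsto (fun n : ℕ => (n : ℝ)⁻¹ * ∑ i ∈ Finset.range n, y i) atTop (𝓝 v)) :
    Tendsto (fun n : ℕ => (n : ℝ)⁻¹ * ∑ i ∈ Finset.range n, x i * w i) atTop (𝓝 (l * c)) := by
  have hy0 : ∀ n, 0 ≤ y n := fun n => (abs_nonneg _).trans (hxy n)
  have ho : (fun n => x n * (w n - c)) =o[atTop] fun n => y n + 1 := by
    have h1 : (fun n => w n - c) =o[atTop] fun _ => (1 : ℝ) :=
      (Asymptotics.isLittleO_one_iff ℝ).2 (tendsto_sub_nhds_zero_iff.2 hw)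
    have h2 : x =O[atTop] fun n => y n + 1 := Asymptotics.IsBigO.of_bound 1
      (Eventually.of_forall fun n => by
        rw [Real.norm_eq_abs, Real.norm_of_nonneg (by linarith [hy0 n]), one_mul]
        linarith [hxy n])
    simpa using h2.mul_isLittleO h1
  have hsum : Tendsto (fun n => ∑ i ∈ Finset.range n, (y i + 1)) atTop atTop := by
    refine tendsto_atTop_mono (fun n => ?_) (tendsto_natCast_atTop_atTop (R := ℝ))
    rw [Finset.sum_add_distrib]
    have := Finset.sum_nonneg fun i (_ : i ∈ Finset.range n) => hy0 i
    simpa using this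
  have hos := ho.sum_range (fun n => add_nonneg (hy0 n) zero_le_one) hsum
  have h0 : Tendsto (fun n : ℕ => (n : ℝ)⁻¹ * ∑ i ∈ Finset.range n, x i * (w i - c)) atTop
      (𝓝 0) := by
    have hO : (fun n : ℕ => (n : ℝ)⁻¹ * ∑ i ∈ Finset.range n, (y i + 1)) =O[atTop]
        fun _ => (1 : ℝ) := by
      have h1 : Tendsto (fun n : ℕ => (n : ℝ)⁻¹ * ∑ i ∈ Finset.range n, (y i + 1)) atTop
          (𝓝 (v + 1)) := by
        refine (hy.add_const 1).congr' ?_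
        filter_upwards [eventually_ge_atTop 1] with n hn
        have : (n : ℝ) ≠ 0 := by positivity
        rw [Finset.sum_add_distrib, mul_add]
        simp [this]
      exact h1.isBigO_one ℝ
    have h2 := ((Asymptotics.isBigO_refl (fun n : ℕ => (n : ℝ)⁻¹) atTop).mul_isLittleO hos).trans_isBigO
      hO
    exact (Asymptotics.isLittleO_one_iff ℝ).1 h2
  have h1 := h0.add (hx.mul_const c)
  rw [zero_add] at h1
  refine h1.congr fun n => ?_
  rw [mul_assoc, ← mul_add, Finset.sum_mul, ← Finset.sum_add_distrib]
  congr 1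
  exact Finset.sum_congr rfl fun i _ => by ring

/-! ### Averages of the squares of the martingale -/

section Autoregression

variable {Ω : Type*} {X ε : ℕ → Ω → ℝ} {p : ℕ} {a b : Fin (p + 1) → ℝ}
  {u : Fin 2 × Fin (p + 1) → ℝ}

/-- The limit of the conditional variance of `incr`, per individual. -/
noncomputable def limVar (a b : Fin (p + 1) → ℝ) (σ ρ : ℝ) (ℓ : Matrix (Fin p) (Fin p) ℝ)
    (u : Fin 2 × Fin (p + 1) → ℝ) : ℝ := u ⬝ᵥ (Γ σ ρ ⊗ₖ L a b ℓ) *ᵥ u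

section Pathwise

variable {ω : Ω} {σ ρ : ℝ} {ℓ : Matrix (Fin p) (Fin p) ℝ}
  (hL : ∀ i j, Tendsto (genAvg fun k => regressor p X k ω i * regressor p X k ω j) atTop
      (𝓝 (L a b ℓ i j)))
include hL

lemma tendsto_genAvg_coef_mul (i i' : Fin 2) :
    Tendsto (genAvg fun k => coef p X u i k ω * coef p X u i' k ω) atTop
      (𝓝 (∑ j, ∑ j', u (i, j) * u (i', j') * L a b ℓ j j')) := by
  have e : (genAvg fun k => coef p X u i k ω * coef p X u i' k ω) = fun n =>
      ∑ j, ∑ j', u (i, j) * u (i', j') *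
        genAvg (fun k => regressor p X k ω j * regressor p X k ω j') n := by
    ext n
    simp only [coef, Finset.sum_mul_sum, genAvg_sum]
    refine Finset.sum_congr rfl fun j _ => Finset.sum_congr rfl fun j' _ => ?_
    rw [← genAvg_const_mul]
    exact genAvg_congr fun k _ => by ring
  rw [e]
  exact tendsto_finsetSum _ fun j _ => tendsto_finsetSum _ fun j' _ => (hL j j').const_mul _

lemma tendsto_incrVar : Tendsto (fun n => incrVar p X σ ρ u n ω / 2 ^ n) atTop
    (𝓝 (limVar a b σ ρ ℓ u)) := by
  have e : (fun n => incrVar p X σ ρ u n ω / 2 ^ n) = fun n =>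
      ∑ i, ∑ i', Γ σ ρ i i' * genAvg (fun k => coef p X u i k ω * coef p X u i' k ω) n := by
    ext n
    simp only [← genAvg_const_mul, ← genAvg_sum]
    rw [incrVar, genAvg]
    congr 1
    refine Finset.sum_congr rfl fun k _ => ?_
    simp [Fin.sum_univ_two, Γ, quadΓ]
    ring
  rw [e]
  have := tendsto_finsetSum (Finset.univ : Finset (Fin 2)) fun i _ =>
    tendsto_finsetSum (Finset.univ : Finset (Fin 2)) fun i' _ =>
      (tendsto_genAvg_coef_mul (u := u) hL i i').const_mul (Γ σ ρ i i')
  convert this using 2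
  simp only [limVar, dotProduct, Matrix.mulVec, Fintype.sum_prod_type, Matrix.kroneckerMap_apply,
    Finset.mul_sum]
  refine Finset.sum_congr rfl fun i _ => ?_
  rw [Finset.sum_comm]
  refine Finset.sum_congr rfl fun i' _ => Finset.sum_congr rfl fun j _ =>
    Finset.sum_congr rfl fun j' _ => by ring

lemma exists_coefSq_le : ∃ K : ℕ, ∀ n, coefSq p X u n ω ≤ K * 2 ^ n := by
  have h := (tendsto_genAvg_coef_mul (u := u) hL 0 0).add (tendsto_genAvg_coef_mul (u := u) hL 1 1)
  obtain ⟨C, hC⟩ := h.bddAbove_range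
  refine ⟨⌈C⌉₊, fun n => ?_⟩
  have h1 := (hC ⟨n, rfl⟩).trans (Nat.le_ceil C)
  have e : coefSq p X u n ω / 2 ^ n = genAvg (fun k => coef p X u 0 k ω * coef p X u 0 k ω) n +
      genAvg (fun k => coef p X u 1 k ω * coef p X u 1 k ω) n := by
    rw [← genAvg_add, genAvg, coefSq]
    simp only [sq]
  rw [← div_le_iff₀ (by positivity), e]
  exact h1

end Pathwise

variable [MeasurableSpace Ω] {μ : Measure Ω} [IsProbabilityMeasure μ] {σ ρ : ℝ}

/-- The event, in the past of generation `n`, on which the conditional fourth moments of the noise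
and the coefficients are under control. -/
def tameEvent (p : ℕ) (X ε : ℕ → Ω → ℝ) (μ : Measure Ω) (u : Fin 2 × Fin (p + 1) → ℝ) (K : ℕ)
    (n : ℕ) : Set Ω := fourthLE X ε μ K n ∩ {ω | coefSq p X u n ω ≤ K * 2 ^ n}

lemma measurableSet_tameEvent (K : ℕ) {n : ℕ} (hn : p - 1 ≤ n) :
    MeasurableSet[filt X n] (tameEvent p X ε μ u K n) :=
  (measurableSet_fourthLE _ _).inter (measurable_coefSq_filt hn measurableSet_Iic)

lemma Setting.ae_exists_mem_tameEvent (hs : Setting μ p a b X ε σ ρ) :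
    ∀ᵐ ω ∂μ, ∃ K : ℕ, ∀ n, p - 1 ≤ n → ω ∈ tameEvent p X ε μ u K n := by
  obtain ⟨ℓ, hℓ, -⟩ := existsUnique_isEll hs.contr σ
  filter_upwards [hs.ae_exists_mem_fourthLE, hs.ae_tendsto_genAvg hℓ] with ω ⟨K, hK⟩ hω
  obtain ⟨K', hK'⟩ := exists_coefSq_le (u := u) hω
  refine ⟨max K K', fun n hn => ⟨Set.mem_iInter₂.2 fun k hk => ?_, ?_⟩⟩
  · refine (le_of_mem_fourthLE (hK n hn) hk).trans ?_
    exact_mod_cast le_max_left K K'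
  · refine (hK' n).trans ?_
    have : (K' : ℝ) ≤ (max K K' : ℕ) := by exact_mod_cast le_max_right K K'
    gcongr

/-- The truncated compensated increments of the square of the martingale average to `0`. -/
lemma Setting.ae_tendsto_average_sqIncr (hs : Setting μ p a b X ε σ ρ) (K : ℕ) :
    ∀ᵐ ω ∂μ, Tendsto (fun n : ℕ => (n : ℝ)⁻¹ * ∑ i ∈ Finset.range n,
      if i < p - 1 then 0 else sqIncr p X ε σ ρ u (tameEvent p X ε μ u K i) i ω / 2 ^ i)
      atTop (𝓝 0) := by
  obtain ⟨C, hC0, hC⟩ := hs.exists_integral_mart_sq_le u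
  have hsq : ∀ n, p - 1 ≤ n →
      Integrable (fun ω => sqIncr p X ε σ ρ u (tameEvent p X ε μ u K n) n ω ^ 2) μ ∧
      ∫ ω, sqIncr p X ε σ ρ u (tameEvent p X ε μ u K n) n ω ^ 2 ∂μ ≤
        (16 * σ ^ 2 * K * C + 48 * K ^ 3) * (2 ^ n) ^ 2 := fun n hn => by
    have h := hs.integral_sqIncr_sq_le (u := u) hn (measurableSet_tameEvent (ε := ε) (μ := μ) K hn)
      (K := K) (C := K * 2 ^ n) K.cast_nonneg Set.inter_subset_left (by positivity)
      fun ω hω => hω.2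
    refine ⟨h.1, h.2.trans ?_⟩
    have := mul_le_mul_of_nonneg_left (hC n hn).2
      (by positivity : 0 ≤ 16 * σ ^ 2 * ((K : ℝ) * 2 ^ n))
    refine (add_le_add this le_rfl).trans (le_of_eq ?_)
    ring
  have hmeas : ∀ n, p - 1 ≤ n → Measurable[filt X (n + 1)]
      (sqIncr p X ε σ ρ u (tameEvent p X ε μ u K n) n) := fun n hn =>
    measurable_sqIncr_filt hs.one_le hs.bar hn (measurableSet_tameEvent K hn)
  have hL2 : ∀ n, p - 1 ≤ n → MemLp (sqIncr p X ε σ ρ u (tameEvent p X ε μ u K n) n) 2 μ :=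
    fun n hn => (memLp_two_iff_integrable_sq
      ((hmeas n hn).mono (filt_le hs.meas _) le_rfl).aestronglyMeasurable).2 (hsq n hn).1
  refine ae_tendsto_average_of_orthogonal (C := 16 * σ ^ 2 * K * C + 48 * K ^ 3)
    (fun n => ?_) (fun n => ?_) fun i j hij => ?_
  · by_cases hn : n < p - 1
    · simp only [hn, if_true]; exact MemLp.zero
    · simp only [hn, if_false, div_eq_mul_inv]; exact (hL2 n (by omega)).mul_const _
  · by_cases hn : n < p - 1
    · simp only [hn, if_true]; simp; positivity
    · simp only [hn, if_false, div_pow]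
      rw [integral_div, div_le_iff₀ (by positivity)]
      exact (hsq n (by omega)).2
  · by_cases hi : i < p - 1
    · simp [hi]
    have hj : ¬ j < p - 1 := by omega
    simp only [hi, hj, if_false]
    have e : ∀ ω, sqIncr p X ε σ ρ u (tameEvent p X ε μ u K i) i ω / 2 ^ i *
        (sqIncr p X ε σ ρ u (tameEvent p X ε μ u K j) j ω / 2 ^ j) = 1 / (2 ^ i * 2 ^ j) *
        (sqIncr p X ε σ ρ u (tameEvent p X ε μ u K i) i ω *
          sqIncr p X ε σ ρ u (tameEvent p X ε μ u K j) j ω) := fun ω => by field_simp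
    simp_rw [e]
    rw [integral_const_mul, hs.integral_mul_sqIncr_eq_zero (by omega)
      (measurableSet_tameEvent K (by omega)) ((hmeas i (by omega)).mono (filt_mono hij) le_rfl)
      ((hL2 i (by omega)).integrable_mul (hL2 j (by omega))), mul_zero]

/-- The squares of the normalised martingale satisfy `x_{n+1} = (x_n + y_n) / 2`, where `y_n` is the
sum of a compensated increment, which averages to `0`, and of the normalised conditional variance,
which converges. -/
theorem Setting.ae_tendsto_average_mart_sq (hs : Setting μ p a b X ε σ ρ)
    {ℓ : Matrix (Fin p) (Fin p) ℝ} (hℓ : IsEll a b σ ℓ) (u : Fin 2 × Fin (p + 1) → ℝ) :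
    ∀ᵐ ω ∂μ, Tendsto (fun n : ℕ => (n : ℝ)⁻¹ *
      ∑ i ∈ Finset.range n, mart p X ε u i ω ^ 2 / 2 ^ i) atTop (𝓝 (limVar a b σ ρ ℓ u)) := by
  have h1 : ∀ᵐ ω ∂μ, ∀ K : ℕ, Tendsto (fun n : ℕ => (n : ℝ)⁻¹ * ∑ i ∈ Finset.range n,
      if i < p - 1 then 0 else sqIncr p X ε σ ρ u (tameEvent p X ε μ u K i) i ω / 2 ^ i)
      atTop (𝓝 0) := ae_all_iff.2 fun K => hs.ae_tendsto_average_sqIncr K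
  filter_upwards [h1, hs.ae_exists_mem_tameEvent (u := u), hs.ae_tendsto_genAvg hℓ] with ω w1
    ⟨K, hK⟩ w3
  have w := (tendsto_incrVar (σ := σ) (ρ := ρ) (u := u) w3)
  have w' : Tendsto (fun n => if n < p - 1 then 0 else incrVar p X σ ρ u n ω / 2 ^ n) atTop
      (𝓝 (limVar a b σ ρ ℓ u)) := by
    refine w.congr' ?_
    filter_upwards [eventually_ge_atTop (p - 1)] with n hn
    rw [if_neg (by omega)]
  refine tendsto_cesaro_of_halving (fun n => by positivity) (y := fun n =>
    (if n < p - 1 then 0 else sqIncr p X ε σ ρ u (tameEvent p X ε μ u K n) n ω / 2 ^ n) +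
    (if n < p - 1 then 0 else incrVar p X σ ρ u n ω / 2 ^ n)) (fun n => ?_) ?_
  -- before generation `p - 1` everything vanishes
  · by_cases hn : n < p - 1
    · simp only [hn, if_true]
      rw [mart_of_lt (by omega), mart_of_lt (by omega)]
      simp
    · simp only [hn, if_false]
      rw [mart_succ hs.one_le (by omega), sqIncr, Set.indicator_of_mem (hK n (by omega)), pow_succ]
      field_simp
      ring
  · have := (w1 K).add w'.cesaro
    rw [zero_add] at this
    refine this.congr fun n => ?_
    rw [← mul_add, Finset.sum_add_distrib]

lemma mart_add (u w : Fin 2 × Fin (p + 1) → ℝ) (n : ℕ) (ω : Ω) :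
    mart p X ε (u + w) n ω = mart p X ε u n ω + mart p X ε w n ω := by
  unfold mart
  split_ifs
  · simp
  · rw [add_dotProduct]

lemma limVar_add {ℓ : Matrix (Fin p) (Fin p) ℝ} (h : (Γ σ ρ ⊗ₖ L a b ℓ)ᵀ = Γ σ ρ ⊗ₖ L a b ℓ)
    (u w : Fin 2 × Fin (p + 1) → ℝ) : limVar a b σ ρ ℓ (u + w) =
      limVar a b σ ρ ℓ u + limVar a b σ ρ ℓ w + 2 * (u ⬝ᵥ (Γ σ ρ ⊗ₖ L a b ℓ) *ᵥ w) := by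
  have : w ⬝ᵥ (Γ σ ρ ⊗ₖ L a b ℓ) *ᵥ u = u ⬝ᵥ (Γ σ ρ ⊗ₖ L a b ℓ) *ᵥ w := by
    rw [Matrix.dotProduct_mulVec, ← Matrix.mulVec_transpose, h, dotProduct_comm]
  unfold limVar
  rw [Matrix.mulVec_add, add_dotProduct, dotProduct_add, dotProduct_add, this]
  ring

lemma transpose_kronecker_eq {ℓ : Matrix (Fin p) (Fin p) ℝ} (hL : (L a b ℓ)ᵀ = L a b ℓ) :
    (Γ σ ρ ⊗ₖ L a b ℓ)ᵀ = Γ σ ρ ⊗ₖ L a b ℓ := by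
  ext ⟨i, j⟩ ⟨i', j'⟩
  have h1 : Γ σ ρ i' i = Γ σ ρ i i' := by fin_cases i <;> fin_cases i' <;> rfl
  have h2 : L a b ℓ j' j = L a b ℓ j j' := congrFun (congrFun hL j) j'
  rw [Matrix.transpose_apply, Matrix.kroneckerMap_apply, Matrix.kroneckerMap_apply, h1, h2]

/-- The averages of `M_n M_nᵗ / 2 ^ n` converge to `Γ ⊗ L`, by polarisation. -/
theorem Setting.ae_tendsto_average_mart_mul (hs : Setting μ p a b X ε σ ρ)
    {ℓ : Matrix (Fin p) (Fin p) ℝ} (hℓ : IsEll a b σ ℓ) (i j : Fin 2 × Fin (p + 1)) :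
    ∀ᵐ ω ∂μ, Tendsto (fun n : ℕ => (n : ℝ)⁻¹ * ∑ k ∈ Finset.range n,
      mart p X ε (Pi.single i 1) k ω * mart p X ε (Pi.single j 1) k ω / 2 ^ k) atTop
      (𝓝 ((Γ σ ρ ⊗ₖ L a b ℓ) i j)) := by
  have hsym : (L a b ℓ)ᵀ = L a b ℓ := by
    have := (posDef_L hs.contr hs.h1.1 hℓ).isHermitian
    rwa [Matrix.IsHermitian, Matrix.conjTranspose_eq_transpose_of_trivial] at this
  filter_upwards [hs.ae_tendsto_average_mart_sq hℓ (Pi.single i 1),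
    hs.ae_tendsto_average_mart_sq hℓ (Pi.single j 1),
    hs.ae_tendsto_average_mart_sq hℓ (Pi.single i 1 + Pi.single j 1)] with ω w1 w2 w3
  have := ((w3.sub w1).sub w2).const_mul (1 / 2)
  have e : 1 / 2 * (limVar a b σ ρ ℓ (Pi.single i 1 + Pi.single j 1) -
      limVar a b σ ρ ℓ (Pi.single i 1) - limVar a b σ ρ ℓ (Pi.single j 1)) =
      (Γ σ ρ ⊗ₖ L a b ℓ) i j := by
    rw [limVar_add (transpose_kronecker_eq hsym), single_one_dotProduct, Matrix.mulVec_single_one,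
      Matrix.col_apply]
    ring
  rw [e] at this
  refine this.congr fun n => ?_
  rw [← mul_sub, ← mul_sub, ← Finset.sum_sub_distrib, ← Finset.sum_sub_distrib, mul_left_comm,
    Finset.mul_sum]
  congr 1
  refine Finset.sum_congr rfl fun k _ => ?_
  rw [mart_add]
  ring

end Autoregression

/-! ### The quadratic strong law -/

section Autoregression

variable {Ω : Type*} {X ε : ℕ → Ω → ℝ} {p : ℕ} {a b : Fin (p + 1) → ℝ}

section Pathwise

variable {ω : Ω} {ℓ : Matrix (Fin p) (Fin p) ℝ} {c : ℕ → Ω → ℝ}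

lemma S_apply (n : ℕ) (i j : Fin (p + 1)) : S p X n ω i j =
    ∑ k ∈ subtree n (p - 1), regressor p X k ω i * regressor p X k ω j := by
  rw [S, Matrix.sum_apply]
  rfl

lemma tendsto_S (hL : ∀ i j, Tendsto (genAvg fun k => regressor p X k ω i * regressor p X k ω j)
    atTop (𝓝 (L a b ℓ i j))) (i j : Fin (p + 1)) :
    Tendsto (fun n => S p X n ω i j / 2 ^ n) atTop (𝓝 (2 * L a b ℓ i j)) := by
  set g := genAvg fun k => regressor p X k ω i * regressor p X k ω j with hg
  have hrec : ∀ n, p - 1 ≤ n → S p X (n + 1) ω i j / 2 ^ (n + 1) =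
      1 / 2 * (S p X n ω i j / 2 ^ n) + g (n + 1) := fun n hn => by
    rw [S_apply, S_apply, sum_subtree_succ (by omega), add_div, hg, genAvg, pow_succ]
    ring
  have h0 : Tendsto (fun n => |S p X (n + (p - 1)) ω i j / 2 ^ (n + (p - 1)) - 2 * L a b ℓ i j|)
      atTop (𝓝 0) := by
    refine tendsto_zero_of_contraction (β := 1 / 2)
      (e := fun n => |g (n + (p - 1) + 1) - L a b ℓ i j|) (by norm_num) (by norm_num)
      (fun n => abs_nonneg _) (fun n => ?_) ?_
    · rw [show n + 1 + (p - 1) = n + (p - 1) + 1 by ring, hrec _ (by omega)]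
      have e : 1 / 2 * (S p X (n + (p - 1)) ω i j / 2 ^ (n + (p - 1))) + g (n + (p - 1) + 1) -
          2 * L a b ℓ i j = 1 / 2 * (S p X (n + (p - 1)) ω i j / 2 ^ (n + (p - 1)) -
            2 * L a b ℓ i j) + (g (n + (p - 1) + 1) - L a b ℓ i j) := by ring
      rw [e]
      refine (abs_add_le _ _).trans ?_
      rw [abs_mul, abs_of_pos (by norm_num : (0 : ℝ) < 1 / 2)]
    · have := (tendsto_sub_nhds_zero_iff.2 (hL i j)).abs
      rw [abs_zero] at this
      exact (tendsto_add_atTop_iff_nat (f := fun n => |g n - L a b ℓ i j|) (p - 1 + 1)).2 this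
  rw [← tendsto_sub_nhds_zero_iff, tendsto_zero_iff_abs_tendsto_zero]
  exact (tendsto_add_atTop_iff_nat (p - 1)).1 h0

/-- The added identity matrices do not matter, as they are not multiplied by `2^n`. -/
lemma tendsto_smul_Sreg (hc : IsRegularisation p X c)
    (hL : ∀ i j, Tendsto (genAvg fun k => regressor p X k ω i * regressor p X k ω j)
      atTop (𝓝 (L a b ℓ i j))) :
    Tendsto (fun n => ((2 : ℝ) ^ (n + 1))⁻¹ • Sreg p X c n ω) atTop (𝓝 (L a b ℓ)) := by
  refine tendsto_pi_nhds.2 fun i => tendsto_pi_nhds.2 fun j => ?_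
  have h2 : Tendsto (fun n : ℕ => ((2 : ℝ) ^ (n + 1))⁻¹) atTop (𝓝 0) := by
    have := tendsto_pow_atTop_nhds_zero_of_lt_one (r := (2 : ℝ)⁻¹) (by norm_num) (by norm_num)
    simp_rw [← inv_pow]
    exact (tendsto_add_atTop_iff_nat 1).2 this
  have h3 : Tendsto (fun n : ℕ => ((2 : ℝ) ^ (n + 1))⁻¹ *
      (c n ω * (1 : Matrix (Fin (p + 1)) (Fin (p + 1)) ℝ) i j)) atTop (𝓝 0) := by
    refine squeeze_zero_norm' ?_ (by
      simpa using h2.mul_const |(1 : Matrix (Fin (p + 1)) (Fin (p + 1)) ℝ) i j|)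
    filter_upwards [eventually_ge_atTop (p - 1)] with n hn
    rw [Real.norm_eq_abs, abs_mul, abs_mul, abs_of_pos (by positivity : (0 : ℝ) < (2 ^ (n + 1))⁻¹)]
    refine mul_le_mul_of_nonneg_left ?_ (by positivity)
    rcases (hc n hn ω).1 with h | h <;> simp [h]
  have h4 := ((tendsto_S hL i j).const_mul (1 / 2)).add h3
  have e : 1 / 2 * (2 * L a b ℓ i j) + 0 = L a b ℓ i j := by ring
  rw [e] at h4
  refine h4.congr fun n => ?_
  simp only [Sreg, Matrix.smul_apply, Matrix.add_apply, smul_eq_mul, pow_succ]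
  field_simp

lemma tendsto_smul_Sreg_inv (hc : IsRegularisation p X c) (hLu : IsUnit (L a b ℓ))
    (hL : ∀ i j, Tendsto (genAvg fun k => regressor p X k ω i * regressor p X k ω j)
      atTop (𝓝 (L a b ℓ i j))) :
    Tendsto (fun n => (2 : ℝ) ^ (n + 1) • (Sreg p X c n ω)⁻¹) atTop (𝓝 (L a b ℓ)⁻¹) := by
  have h1 := tendsto_smul_Sreg hc hL
  have hdet : (L a b ℓ).det ≠ 0 := ((Matrix.isUnit_iff_isUnit_det _).1 hLu).ne_zero
  have hcd : Continuous fun A : Matrix (Fin (p + 1)) (Fin (p + 1)) ℝ => A.det :=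
    continuous_id.matrix_det
  have hca : Continuous fun A : Matrix (Fin (p + 1)) (Fin (p + 1)) ℝ => A.adjugate :=
    continuous_id.matrix_adjugate
  have h2 : Tendsto (fun n => (((2 : ℝ) ^ (n + 1))⁻¹ • Sreg p X c n ω)⁻¹) atTop
      (𝓝 (L a b ℓ)⁻¹) := by
    simp only [Matrix.inv_def, Ring.inverse_eq_inv']
    exact (((hcd.tendsto _).comp h1).inv₀ hdet).smul ((hca.tendsto _).comp h1)
  refine h2.congr' ?_
  filter_upwards [eventually_ge_atTop (p - 1)] with n hn
  refine Matrix.inv_eq_left_inv ?_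
  rw [Matrix.smul_mul, Matrix.mul_smul, smul_smul,
    Matrix.nonsing_inv_mul _ ((Matrix.isUnit_iff_isUnit_det _).1 (hc n hn ω).2)]
  simp

lemma posSemidef_S (n : ℕ) : (S p X n ω).PosSemidef := by
  unfold S
  refine Matrix.posSemidef_sum _ fun k _ => ?_
  simpa using Matrix.posSemidef_vecMulVec_self_star (regressor p X k ω)

lemma V_nonneg (hc : IsRegularisation p X c) {n : ℕ} (hn : p ≤ n) : 0 ≤ V p X ε c n ω := by
  have h1 : (Sreg p X c (n - 1) ω).PosSemidef := by
    unfold Sreg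
    refine (posSemidef_S _).add (Matrix.PosSemidef.one.smul ?_)
    rcases (hc (n - 1) (by omega) ω).1 with h | h <;> simp [h]
  have h2 := (Matrix.PosSemidef.one (n := Fin 2) (R := ℝ)).kronecker h1
  have h3 := h2.inv.dotProduct_mulVec_nonneg (M p X ε n ω)
  simpa [V, bigSigma] using h3

/-- `V_n` as a sum of products of the entries of `M_n M_nᵗ / 2 ^ n` with convergent weights. -/
lemma V_eq_sum {n : ℕ} (hn : p ≤ n) : V p X ε c n ω =
    ∑ i, ∑ j, mart p X ε (Pi.single i 1) n ω * mart p X ε (Pi.single j 1) n ω / 2 ^ n *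
      ((1 : Matrix (Fin 2) (Fin 2) ℝ) i.1 j.1 *
        ((2 : ℝ) ^ n • (Sreg p X c (n - 1) ω)⁻¹) i.2 j.2) := by
  rw [V, bigSigma, Matrix.inv_kronecker, inv_one]
  simp only [dotProduct, Matrix.mulVec, Finset.mul_sum]
  refine Finset.sum_congr rfl fun i _ => Finset.sum_congr rfl fun j _ => ?_
  rw [mart_of_le hn, mart_of_le hn, single_one_dotProduct, single_one_dotProduct,
    Matrix.kroneckerMap_apply, Matrix.smul_apply, smul_eq_mul]
  field_simp

end Pathwise

variable {σ ρ : ℝ}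

/-- The trace of `(Γ ⊗ L) (I ⊗ L⁻¹) = Γ ⊗ I`. -/
lemma sum_kronecker_mul_inv {ℓ : Matrix (Fin p) (Fin p) ℝ} (h : (L a b ℓ).PosDef) :
    ∑ i, ∑ j, (Γ σ ρ ⊗ₖ L a b ℓ) i j *
      ((1 : Matrix (Fin 2) (Fin 2) ℝ) i.1 j.1 * (L a b ℓ)⁻¹ i.2 j.2) =
      2 * ((p : ℝ) + 1) * σ ^ 2 := by
  have hsym : ∀ j j', (L a b ℓ)⁻¹ j j' = (L a b ℓ)⁻¹ j' j := fun j j' => by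
    have := h.isHermitian.inv.apply j j'
    simpa using this.symm
  have htr : ∑ j, ∑ j', L a b ℓ j j' * (L a b ℓ)⁻¹ j j' = (p : ℝ) + 1 := by
    have h1 : L a b ℓ * (L a b ℓ)⁻¹ = 1 :=
      Matrix.mul_nonsing_inv _ ((Matrix.isUnit_iff_isUnit_det _).1 h.isUnit)
    have h2 : ∀ j, ∑ j', L a b ℓ j j' * (L a b ℓ)⁻¹ j j' = 1 := fun j => by
      simp_rw [hsym j]
      rw [← Matrix.mul_apply, h1, Matrix.one_apply_eq]
    simp [h2]
  have e : ∀ i : Fin 2, ∑ j, ∑ y : Fin 2 × Fin (p + 1), (Γ σ ρ ⊗ₖ L a b ℓ) (i, j) y *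
      ((1 : Matrix (Fin 2) (Fin 2) ℝ) i y.1 * (L a b ℓ)⁻¹ j y.2) =
      σ ^ 2 * ∑ j, ∑ j', L a b ℓ j j' * (L a b ℓ)⁻¹ j j' := fun i => by
    rw [Finset.mul_sum]
    refine Finset.sum_congr rfl fun j _ => ?_
    rw [Fintype.sum_prod_type, Finset.sum_eq_single i, Finset.mul_sum]
    · refine Finset.sum_congr rfl fun j' _ => ?_
      rw [Matrix.kroneckerMap_apply, Matrix.one_apply_eq]
      have : Γ σ ρ i i = σ ^ 2 := by fin_cases i <;> rfl
      simp only [this]; ring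
    · intro i' _ hi'
      simp [Matrix.one_apply_ne' hi']
    · simp
  rw [Fintype.sum_prod_type]
  simp only [e, htr]
  simp; ring

variable [MeasurableSpace Ω] {μ : Measure Ω} [IsProbabilityMeasure μ]

theorem Setting.ae_tendsto_average_V (hs : Setting μ p a b X ε σ ρ) {c : ℕ → Ω → ℝ}
    (hc : IsRegularisation p X c) :
    ∀ᵐ ω ∂μ, Tendsto (fun n : ℕ => (1 / (n : ℝ)) * ∑ k ∈ Finset.Icc p n, V p X ε c k ω)
      atTop (𝓝 (2 * ((p : ℝ) + 1) * σ ^ 2)) := by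
  obtain ⟨ℓ, hℓ, -⟩ := existsUnique_isEll hs.contr σ
  have hpos := posDef_L hs.contr hs.h1.1 hℓ
  have h1 : ∀ᵐ ω ∂μ, ∀ i j, Tendsto (fun n : ℕ => (n : ℝ)⁻¹ * ∑ k ∈ Finset.range n,
      mart p X ε (Pi.single i 1) k ω * mart p X ε (Pi.single j 1) k ω / 2 ^ k) atTop
      (𝓝 ((Γ σ ρ ⊗ₖ L a b ℓ) i j)) :=
    ae_all_iff.2 fun i => ae_all_iff.2 fun j => hs.ae_tendsto_average_mart_mul hℓ i j
  filter_upwards [h1, hs.ae_tendsto_genAvg hℓ] with ω w1 w2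
  have hinv := tendsto_smul_Sreg_inv hc hpos.isUnit w2
  have hw : ∀ i j : Fin 2 × Fin (p + 1), Tendsto (fun n =>
      (1 : Matrix (Fin 2) (Fin 2) ℝ) i.1 j.1 *
        ((2 : ℝ) ^ n • (Sreg p X c (n - 1) ω)⁻¹) i.2 j.2) atTop
      (𝓝 ((1 : Matrix (Fin 2) (Fin 2) ℝ) i.1 j.1 * (L a b ℓ)⁻¹ i.2 j.2)) := fun i j => by
    refine Tendsto.const_mul _ ?_
    refine (tendsto_add_atTop_iff_nat 1).1 ?_
    exact tendsto_pi_nhds.1 (tendsto_pi_nhds.1 hinv i.2) j.2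
  have hdom : ∀ (i j : Fin 2 × Fin (p + 1)) (n : ℕ), |mart p X ε (Pi.single i 1) n ω *
      mart p X ε (Pi.single j 1) n ω / 2 ^ n| ≤
      1 / 2 * (mart p X ε (Pi.single i 1) n ω * mart p X ε (Pi.single i 1) n ω / 2 ^ n +
        mart p X ε (Pi.single j 1) n ω * mart p X ε (Pi.single j 1) n ω / 2 ^ n) := by
    intro i j n
    rw [abs_div, abs_of_pos (by positivity : (0 : ℝ) < 2 ^ n), ← add_div, ← mul_div_assoc]
    gcongr
    rw [abs_mul]
    nlinarith [sq_nonneg (|mart p X ε (Pi.single i 1) n ω| - |mart p X ε (Pi.single j 1) n ω|),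
      abs_mul_abs_self (mart p X ε (Pi.single i 1) n ω),
      abs_mul_abs_self (mart p X ε (Pi.single j 1) n ω)]
  have hterm := fun i j => tendsto_cesaro_mul (w1 i j) (hw i j) (hdom i j)
    (v := 1 / 2 * ((Γ σ ρ ⊗ₖ L a b ℓ) i i + (Γ σ ρ ⊗ₖ L a b ℓ) j j))
    ((((w1 i i).add (w1 j j)).const_mul (1 / 2)).congr fun n => by
      rw [← mul_add, ← Finset.sum_add_distrib, mul_left_comm, Finset.mul_sum])
  have hsum := tendsto_finsetSum Finset.univ fun i _ =>
    tendsto_finsetSum Finset.univ fun j _ => hterm i j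
  rw [sum_kronecker_mul_inv hpos] at hsum
  have hF : Tendsto (fun n : ℕ => (n : ℝ)⁻¹ * ∑ k ∈ Finset.range n,
      if k < p then 0 else V p X ε c k ω) atTop (𝓝 (2 * ((p : ℝ) + 1) * σ ^ 2)) := by
    refine hsum.congr fun n => ?_
    simp_rw [← Finset.mul_sum]
    congr 1
    simp_rw [Finset.sum_comm (s := Finset.univ) (t := Finset.range n)]
    refine Finset.sum_congr rfl fun k _ => ?_
    split_ifs with hk
    · refine Finset.sum_eq_zero fun i _ => Finset.sum_eq_zero fun j _ => ?_
      rw [mart_of_lt hk]; simp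
    · exact (V_eq_sum (by omega)).symm
  have h2 := (tendsto_add_atTop_iff_nat 1).2 hF
  have h3 : Tendsto (fun n : ℕ => ((n : ℝ) + 1) / n) atTop (𝓝 1) := by
    have := (tendsto_inv_atTop_nhds_zero_nat (𝕜 := ℝ)).const_add 1
    rw [add_zero] at this
    refine this.congr' ?_
    filter_upwards [eventually_ge_atTop 1] with n hn
    have : (n : ℝ) ≠ 0 := by positivity
    field_simp
  have h4 := h2.mul h3
  rw [mul_one] at h4
  refine h4.congr' ?_
  filter_upwards [eventually_ge_atTop 1] with n hn
  have hn0 : (n : ℝ) ≠ 0 := by positivity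
  have e : ∑ k ∈ Finset.range (n + 1), (if k < p then 0 else V p X ε c k ω) =
      ∑ k ∈ Finset.Icc p n, V p X ε c k ω := by
    rw [Finset.sum_ite, Finset.sum_const_zero, zero_add]
    refine Finset.sum_congr ?_ fun _ _ => rfl
    ext k
    simp only [Finset.mem_filter, Finset.mem_range, Finset.mem_Icc]
    omega
  rw [e]
  push_cast
  field_simp

/-- As `V ≥ 0`, convergence of the averages bounds every term by a multiple of `n`. -/
lemma V_isBigO_of_tendsto {c : ℕ → Ω → ℝ} (hc : IsRegularisation p X c) {ω : Ω} {l : ℝ}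
    (h : Tendsto (fun n : ℕ => (1 / (n : ℝ)) * ∑ k ∈ Finset.Icc p n, V p X ε c k ω)
      atTop (𝓝 l)) : (fun n : ℕ => V p X ε c n ω) =O[atTop] (fun n : ℕ => (n : ℝ)) := by
  have h1 : ∀ᶠ n : ℕ in atTop, (1 / (n : ℝ)) * ∑ k ∈ Finset.Icc p n, V p X ε c k ω ≤ l + 1 :=
    h.eventually_le_const (by linarith)
  refine Asymptotics.IsBigO.of_bound (l + 1) ?_
  filter_upwards [h1, eventually_ge_atTop (p + 1)] with n hn1 hn2
  have hn0 : (0 : ℝ) < n := by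
    have : 0 < n := by omega
    exact_mod_cast this
  rw [Real.norm_of_nonneg (V_nonneg hc (by omega)), Real.norm_of_nonneg hn0.le]
  have h2 : V p X ε c n ω ≤ ∑ k ∈ Finset.Icc p n, V p X ε c k ω :=
    Finset.single_le_sum (f := fun k => V p X ε c k ω)
      (fun k hk => V_nonneg hc (Finset.mem_Icc.1 hk).1) (Finset.mem_Icc.2 ⟨by omega, le_rfl⟩)
  rw [one_div, inv_mul_le_iff₀ hn0] at hn1
  linarith

end Autoregression

/-! ### The central limit theorem -/

/-- If the errors at scale `k` are controlled by those of the previous generation at scale `k + 1`,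
and those at scale `k` are uniformly small for large `k`, then the errors vanish. -/
lemma tendsto_zero_of_rescaling {E c : ℕ → ℕ → ℝ} {r : ℕ → ℝ} {q : ℕ} (hE0 : ∀ n k, 0 ≤ E n k)
    (hE : ∀ n k, q ≤ n → E (n + 1) k ≤ E n (k + 1) + c n k)
    (hc : ∀ k, Tendsto (fun n => c n k) atTop (𝓝 0)) (hr : ∀ n k, q ≤ n → E n k ≤ r k)
    (hr0 : Tendsto r atTop (𝓝 0)) : Tendsto (fun n => E n 0) atTop (𝓝 0) := by
  have key : ∀ j k, ∃ d : ℕ → ℝ, Tendsto d atTop (𝓝 0) ∧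
      ∀ n, q ≤ n → E (n + j) k ≤ E n (k + j) + d n := by
    intro j
    induction j with
    | zero => exact fun k => ⟨fun _ => 0, tendsto_const_nhds, fun n _ => by simp⟩
    | succ j ih =>
      intro k
      obtain ⟨d, hd, hle⟩ := ih (k + 1)
      refine ⟨fun n => d n + c (n + j) k, ?_, fun n hn => ?_⟩
      · simpa using hd.add ((tendsto_add_atTop_iff_nat j).2 (hc k))
      · have h1 := hE (n + j) k (by omega)
        have h2 := hle n hn
        rw [show k + 1 + j = k + (j + 1) by ring] at h2
        rw [show n + (j + 1) = n + j + 1 by ring]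
        linarith
  rw [Metric.tendsto_atTop]
  intro δ hδ
  obtain ⟨k, hk⟩ := (hr0.eventually_lt_const (half_pos hδ)).exists
  obtain ⟨d, hd, hle⟩ := key k 0
  obtain ⟨n₀, hn₀⟩ := eventually_atTop.1 (hd.eventually_lt_const (half_pos hδ))
  -- `k` steps back in time, at scale `k`
  refine ⟨max n₀ q + k, fun n hn => ?_⟩
  obtain ⟨m, rfl⟩ : ∃ m, n = m + k := ⟨n - k, by omega⟩
  have hm : max n₀ q ≤ m := by omega
  have h1 := hle m ((le_max_right _ _).trans hm)
  have h2 := hn₀ m ((le_max_left _ _).trans hm)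
  have h3 := hr m (0 + k) ((le_max_right _ _).trans hm)
  rw [zero_add] at h1 h3
  rw [Real.dist_eq, sub_zero, abs_of_nonneg (hE0 _ _)]
  linarith

lemma norm_cexp_I_mul_sub_cexp_le (x y : ℝ) :
    ‖Complex.exp (Complex.I * x) - Complex.exp (Complex.I * y)‖ ≤ |x - y| := by
  have e : Complex.exp (Complex.I * x) - Complex.exp (Complex.I * y) =
      Complex.exp (Complex.I * y) * (Complex.exp (Complex.I * ((x - y : ℝ) : ℂ)) - 1) := by
    rw [mul_sub, ← Complex.exp_add, mul_one]
    congr 2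
    push_cast; ring
  rw [e, norm_mul, mul_comm Complex.I (y : ℂ), Complex.norm_exp_ofReal_mul_I, one_mul]
  exact Real.norm_exp_I_mul_ofReal_sub_one_le

section CharFun

variable {Ω : Type*} [MeasurableSpace Ω] {μ : Measure Ω} [IsProbabilityMeasure μ]

lemma integrable_cexp_I_mul {f : Ω → ℝ} (hf : Measurable f) :
    Integrable (fun ω => Complex.exp (Complex.I * f ω)) μ := by
  refine Integrable.of_bound (C := 1) (by fun_prop) (Eventually.of_forall fun ω => ?_)
  rw [mul_comm, Complex.norm_exp_ofReal_mul_I]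

lemma norm_integral_cexp_sub_integral_le {f g : Ω → ℝ} (hf : Measurable f) (hg : Measurable g)
    (hfg : Integrable (fun ω => |f ω - g ω|) μ) :
    ‖∫ ω, Complex.exp (Complex.I * f ω) ∂μ - ∫ ω, Complex.exp (Complex.I * g ω) ∂μ‖ ≤
      ∫ ω, |f ω - g ω| ∂μ := by
  rw [← integral_sub (integrable_cexp_I_mul hf) (integrable_cexp_I_mul hg)]
  exact norm_integral_le_of_norm_le hfg
    (Eventually.of_forall fun ω => norm_cexp_I_mul_sub_cexp_le _ _)

/-- The first absolute moment is at most the square root of the second moment. -/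
lemma integral_abs_le_sqrt {f : Ω → ℝ} (hf : Measurable f) (hi : Integrable (fun ω => f ω ^ 2) μ)
    {C : ℝ} (hC : ∫ ω, f ω ^ 2 ∂μ ≤ C) : Integrable (fun ω => |f ω|) μ ∧ ∫ ω, |f ω| ∂μ ≤ √C := by
  have h2 : MemLp f 2 μ := (memLp_two_iff_integrable_sq hf.aestronglyMeasurable).2 hi
  have h1 : Integrable (fun ω => |f ω|) μ := (h2.integrable (by norm_num)).abs
  refine ⟨h1, Real.le_sqrt_of_sq_le (le_trans ?_ hC)⟩
  have hv : 0 ≤ ∫ ω, (|f ω| - ∫ ω', |f ω'| ∂μ) ^ 2 ∂μ := integral_nonneg fun ω => sq_nonneg _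
  set c := ∫ ω', |f ω'| ∂μ
  have j1 : Integrable (fun ω => f ω ^ 2 - 2 * c * |f ω|) μ := hi.sub (h1.const_mul _)
  have e : ∀ ω, (|f ω| - c) ^ 2 = f ω ^ 2 - 2 * c * |f ω| + c ^ 2 := fun ω => by
    rw [sub_sq, sq_abs]; ring
  simp_rw [e] at hv
  rw [integral_add j1 (integrable_const _), integral_sub hi (h1.const_mul _),
    integral_const_mul] at hv
  simp only [integral_const, probReal_univ, smul_eq_mul, one_mul] at hv
  nlinarith

end CharFun

section Autoregression

variable {Ω : Type*} {X ε : ℕ → Ω → ℝ} {p : ℕ} {a b : Fin (p + 1) → ℝ}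
  {u : Fin 2 × Fin (p + 1) → ℝ} {σ ρ : ℝ} {ℓ : Matrix (Fin p) (Fin p) ℝ}

lemma coef_smul (s : ℝ) (i : Fin 2) (k : ℕ) (ω : Ω) :
    coef p X (s • u) i k ω = s * coef p X u i k ω := by
  simp [coef, Finset.mul_sum, mul_assoc]

lemma mart_smul (s : ℝ) (n : ℕ) (ω : Ω) : mart p X ε (s • u) n ω = s * mart p X ε u n ω := by
  unfold mart
  split_ifs
  · simp
  · rw [smul_dotProduct, smul_eq_mul]

lemma incr_smul (s : ℝ) (n : ℕ) (ω : Ω) : incr p X ε (s • u) n ω = s * incr p X ε u n ω := by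
  simp only [incr, coef_smul, Finset.mul_sum]
  exact Finset.sum_congr rfl fun k _ => by ring

lemma incrVar_smul (s : ℝ) (n : ℕ) (ω : Ω) :
    incrVar p X σ ρ (s • u) n ω = s ^ 2 * incrVar p X σ ρ u n ω := by
  simp only [incrVar, coef_smul, Finset.mul_sum, quadΓ]
  exact Finset.sum_congr rfl fun k _ => by ring

lemma limVar_smul (s : ℝ) : limVar a b σ ρ ℓ (s • u) = s ^ 2 * limVar a b σ ρ ℓ u := by
  simp only [limVar, Matrix.mulVec_smul, dotProduct_smul, smul_dotProduct, smul_eq_mul]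
  ring

/-- The sum of the fourth powers of the norms of the coefficients of `incr`. -/
def coefFour (p : ℕ) (X : ℕ → Ω → ℝ) (u : Fin 2 × Fin (p + 1) → ℝ) (n : ℕ) (ω : Ω) : ℝ :=
  ∑ k ∈ gen n, (coef p X u 0 k ω ^ 2 + coef p X u 1 k ω ^ 2) ^ 2

lemma coefFour_smul (s : ℝ) (n : ℕ) (ω : Ω) :
    coefFour p X (s • u) n ω = s ^ 4 * coefFour p X u n ω := by
  simp only [coefFour, coef_smul, Finset.mul_sum]
  exact Finset.sum_congr rfl fun k _ => by ring

lemma posSemidef_Γ (hρ : |ρ| < σ ^ 2) : (Γ σ ρ).PosSemidef := by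
  refine .of_dotProduct_mulVec_nonneg ?_ fun x => ?_
  · ext i j; fin_cases i <;> fin_cases j <;> simp [Γ]
  · have := quadΓ_nonneg hρ (x 0) (x 1)
    simp only [dotProduct, Matrix.mulVec, Fin.sum_univ_two, Γ, quadΓ] at this ⊢
    simp
    linarith

variable [MeasurableSpace Ω] {μ : Measure Ω} [IsProbabilityMeasure μ]

lemma Setting.posSemidef_kronecker (hs : Setting μ p a b X ε σ ρ) (hℓ : IsEll a b σ ℓ) :
    (Γ σ ρ ⊗ₖ L a b ℓ).PosSemidef :=
  (posSemidef_Γ hs.rho_lt).kronecker (posDef_L hs.contr hs.h1.1 hℓ).posSemidef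

lemma Setting.limVar_nonneg (hs : Setting μ p a b X ε σ ρ) (hℓ : IsEll a b σ ℓ) :
    0 ≤ limVar a b σ ρ ℓ u := by
  simpa [limVar] using (hs.posSemidef_kronecker hℓ).dotProduct_mulVec_nonneg u

lemma Setting.exists_integral_coefFour_le (hs : Setting μ p a b X ε σ ρ) {τ ν : ℝ}
    (h4 : H4 p X ε μ τ ν) (u : Fin 2 × Fin (p + 1) → ℝ) : ∃ C, 0 ≤ C ∧ ∀ n, p - 1 ≤ n →
      Integrable (coefFour p X u n) μ ∧ ∫ ω, coefFour p X u n ω ∂μ ≤ C * 2 ^ n := by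
  obtain ⟨C, hC0, hC⟩ := hs.exists_integral_regressor_pow_four_le h4
  set U := ∑ i, u i ^ 2 with hU
  have hk : ∀ k, 2 ^ (p - 1) ≤ k → Integrable
      (fun ω => (coef p X u 0 k ω ^ 2 + coef p X u 1 k ω ^ 2) ^ 2) μ ∧
      ∫ ω, (coef p X u 0 k ω ^ 2 + coef p X u 1 k ω ^ 2) ^ 2 ∂μ ≤
        U ^ 2 * ((p + 1) * ((p + 1) * C)) := by
    intro k hk
    have hle : ∀ ω, (coef p X u 0 k ω ^ 2 + coef p X u 1 k ω ^ 2) ^ 2 ≤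
        U ^ 2 * ((p + 1) * ∑ j, regressor p X k ω j ^ 4) := fun ω => by
      have h1 : coef p X u 0 k ω ^ 2 + coef p X u 1 k ω ^ 2 ≤
          U * ∑ j, regressor p X k ω j ^ 2 := by
        rw [hU, Fintype.sum_prod_type, Fin.sum_univ_two, add_mul]
        exact add_le_add (coef_sq_le 0 k ω) (coef_sq_le 1 k ω)
      refine (pow_le_pow_left₀ (by positivity) h1 2).trans ?_
      rw [mul_pow]
      refine mul_le_mul_of_nonneg_left ?_ (by positivity)
      refine sq_sum_le_card_mul_sum_sq.trans (le_of_eq ?_)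
      simp only [← pow_mul, Finset.card_univ, Fintype.card_fin]
      push_cast; rfl
    have hi : Integrable (fun ω => U ^ 2 * ((p + 1) * ∑ j, regressor p X k ω j ^ 4)) μ :=
      ((integrable_finsetSum _ fun j _ => (hC k hk j).1).const_mul _).const_mul _
    have hmeas : ∀ i, Measurable (coef p X u i k) := fun i =>
      Finset.measurable_sum _ fun j _ => (measurable_regressor hs.meas hk j).const_mul _
    refine ⟨hi.mono' ((((hmeas 0).pow_const 2).add
      ((hmeas 1).pow_const 2)).pow_const 2).aestronglyMeasurable
      (Eventually.of_forall fun ω => ?_), ?_⟩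
    · rw [Real.norm_of_nonneg (by positivity)]; exact hle ω
    · refine (integral_mono_of_nonneg (Eventually.of_forall fun ω => by positivity) hi
        (Eventually.of_forall hle)).trans ?_
      rw [integral_const_mul, integral_const_mul,
        integral_finsetSum _ fun j _ => (hC k hk j).1]
      have : ∑ j, ∫ ω, regressor p X k ω j ^ 4 ∂μ ≤ (p + 1) * C :=
        (Finset.sum_le_sum fun j _ => (hC k hk j).2).trans (le_of_eq (by simp))
      gcongr
  refine ⟨U ^ 2 * ((p + 1) * ((p + 1) * C)), by positivity, fun n hn => ?_⟩
  have hg : ∀ k ∈ gen n, 2 ^ (p - 1) ≤ k := fun k hk => le_of_mem_gen hn hk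
  refine ⟨integrable_finsetSum _ fun k h => (hk k (hg k h)).1, ?_⟩
  unfold coefFour
  rw [integral_finsetSum _ fun k h => (hk k (hg k h)).1]
  refine (Finset.sum_le_sum fun k h => (hk k (hg k h)).2).trans (le_of_eq ?_)
  rw [Finset.sum_const, card_gen, nsmul_eq_mul, mul_comm]
  push_cast; rfl

/-- The distance between the characteristic function of `mart` at scale `√2 ^ n` and its Gaussian
limit. -/
noncomputable def charErr (p : ℕ) (X ε : ℕ → Ω → ℝ) (μ : Measure Ω) (v : ℝ)
    (u : Fin 2 × Fin (p + 1) → ℝ) (n : ℕ) : ℝ :=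
  ‖∫ ω, Complex.exp (Complex.I * ((√2 ^ n)⁻¹ * mart p X ε u n ω : ℝ)) ∂μ -
    (Real.exp (-v / 2) : ℂ)‖

/-- The error made when the characteristic function of an increment is replaced by its Gaussian
limit. The first two terms come from the Taylor expansion and the last one from the convergence of
the conditional variance. -/
noncomputable def stepErr (p : ℕ) (X : ℕ → Ω → ℝ) (μ : Measure Ω) (σ ρ K v : ℝ)
    (u : Fin 2 × Fin (p + 1) → ℝ) (n : ℕ) : ℝ :=
  2 * (√2 ^ n)⁻¹ * (∫ ω, incrVar p X σ ρ ((√2 ^ n)⁻¹ • u) n ω ∂μ) +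
    (2 / (√2 ^ n)⁻¹ + 1) * (8 * K) * (∫ ω, coefFour p X ((√2 ^ n)⁻¹ • u) n ω ∂μ) +
    ∫ ω, |Real.exp (-incrVar p X σ ρ ((√2 ^ n)⁻¹ • u) n ω / 2) - Real.exp (-v / 2)| ∂μ

lemma inv_sqrt_two_pow_sq (n : ℕ) : ((√2 ^ n)⁻¹) ^ 2 = (2 ^ n : ℝ)⁻¹ := by
  rw [inv_pow, ← pow_mul, mul_comm, pow_mul, Real.sq_sqrt (by norm_num)]

lemma tendsto_inv_sqrt_two_pow : Tendsto (fun n : ℕ => (√2 ^ n)⁻¹) atTop (𝓝 0) := by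
  simp_rw [← inv_pow]
  refine tendsto_pow_atTop_nhds_zero_of_lt_one (by positivity) (inv_lt_one_of_one_lt₀ ?_)
  rw [Real.lt_sqrt] <;> norm_num

lemma Setting.tendsto_stepErr (hs : Setting μ p a b X ε σ ρ) (hℓ : IsEll a b σ ℓ) {τ ν : ℝ}
    (h4 : H4 p X ε μ τ ν) {K : ℝ} (hK : 0 ≤ K) (u : Fin 2 × Fin (p + 1) → ℝ) :
    Tendsto (stepErr p X μ σ ρ K (limVar a b σ ρ ℓ u) u) atTop (𝓝 0) := by
  set v := limVar a b σ ρ ℓ u with hv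
  obtain ⟨C, hC0, hC⟩ := hs.exists_integral_incrVar_le u
  obtain ⟨D, hD0, hD⟩ := hs.exists_integral_coefFour_le h4 u
  have hh := tendsto_inv_sqrt_two_pow
  have hpos : ∀ n, 0 < (√2 ^ n)⁻¹ := fun n => by positivity
  have hgauss : Tendsto (fun n => ∫ ω, |Real.exp (-incrVar p X σ ρ ((√2 ^ n)⁻¹ • u) n ω / 2) -
      Real.exp (-v / 2)| ∂μ) atTop (𝓝 0) := by
    rw [← tendsto_add_atTop_iff_nat (p - 1)]
    have h0 : (0 : ℝ) = ∫ _, (0 : ℝ) ∂μ := by simp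
    rw [h0]
    refine tendsto_integral_of_dominated_convergence (fun _ => 2) (fun n => ?_)
      (integrable_const _) (fun n => Eventually.of_forall fun ω => ?_) ?_
    · have := (measurable_incrVar_filt (X := X) (σ := σ) (ρ := ρ)
        (u := (√2 ^ (n + (p - 1)))⁻¹ • u) (n := n + (p - 1)) (by omega)).mono
        (filt_le hs.meas _) le_rfl
      exact (by fun_prop : Measurable fun ω => |Real.exp (-incrVar p X σ ρ
        ((√2 ^ (n + (p - 1)))⁻¹ • u) (n + (p - 1)) ω / 2) -
          Real.exp (-v / 2)|).aestronglyMeasurable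
    · rw [Real.norm_eq_abs, abs_abs]
      have h1 : Real.exp (-incrVar p X σ ρ ((√2 ^ (n + (p - 1)))⁻¹ • u) (n + (p - 1)) ω / 2) ≤ 1 := by
        rw [Real.exp_le_one_iff]
        have := incrVar_nonneg (p := p) (X := X) (u := (√2 ^ (n + (p - 1)))⁻¹ • u) hs.rho_lt
          (n + (p - 1)) ω
        linarith
      have h2 : Real.exp (-v / 2) ≤ 1 := by
        rw [Real.exp_le_one_iff]
        have := hs.limVar_nonneg hℓ (u := u)
        linarith
      have h3 := Real.exp_pos (-v / 2)
      have h4 := Real.exp_pos (-incrVar p X σ ρ ((√2 ^ (n + (p - 1)))⁻¹ • u) (n + (p - 1)) ω / 2)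
      rw [abs_le]
      constructor <;> linarith
    · filter_upwards [hs.ae_tendsto_genAvg hℓ] with ω hω
      rw [tendsto_add_atTop_iff_nat (f := fun n => |Real.exp (-incrVar p X σ ρ
        ((√2 ^ n)⁻¹ • u) n ω / 2) - Real.exp (-v / 2)|) (p - 1)]
      have h1 : Tendsto (fun n => incrVar p X σ ρ ((√2 ^ n)⁻¹ • u) n ω) atTop (𝓝 v) := by
        refine (tendsto_incrVar (σ := σ) (ρ := ρ) (u := u) hω).congr fun n => ?_
        rw [incrVar_smul, inv_sqrt_two_pow_sq, inv_mul_eq_div]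
      have h2 := (((Real.continuous_exp.tendsto _).comp (h1.neg.div_const 2)).sub_const
        (Real.exp (-v / 2))).abs
      rw [sub_self, abs_zero] at h2
      exact h2
  -- the choice `δ = (√2 ^ n)⁻¹` in the Taylor bound makes both error terms of that order
  have hbound : Tendsto (fun n : ℕ => 2 * (√2 ^ n)⁻¹ * C + (16 * K * D * (√2 ^ n)⁻¹ +
      8 * K * D * (√2 ^ n)⁻¹ ^ 2)) atTop (𝓝 0) := by
    have := ((hh.const_mul 2).mul_const C).add ((hh.const_mul (16 * K * D)).add
      ((hh.pow 2).const_mul (8 * K * D)))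
    simpa using this
  have hsum := hbound.add hgauss
  rw [add_zero] at hsum
  have hnn : ∀ n, 0 ≤ stepErr p X μ σ ρ K v u n := fun n => by
    have i1 : 0 ≤ ∫ ω, incrVar p X σ ρ ((√2 ^ n)⁻¹ • u) n ω ∂μ :=
      integral_nonneg fun ω => incrVar_nonneg hs.rho_lt n ω
    have i2 : 0 ≤ ∫ ω, coefFour p X ((√2 ^ n)⁻¹ • u) n ω ∂μ :=
      integral_nonneg fun ω => Finset.sum_nonneg fun k _ => sq_nonneg _
    have i3 : 0 ≤ ∫ ω, |Real.exp (-incrVar p X σ ρ ((√2 ^ n)⁻¹ • u) n ω / 2) -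
      Real.exp (-v / 2)| ∂μ := integral_nonneg fun ω => abs_nonneg _
    unfold stepErr
    positivity
  refine squeeze_zero' (Eventually.of_forall hnn) ?_ hsum
  filter_upwards [eventually_ge_atTop (p - 1)] with n hn
  unfold stepErr
  refine add_le_add (add_le_add ?_ ?_) le_rfl
  · refine mul_le_mul_of_nonneg_left ?_ (by positivity)
    simp_rw [incrVar_smul]
    rw [integral_const_mul, inv_sqrt_two_pow_sq, inv_mul_le_iff₀ (by positivity), mul_comm]
    exact hC n hn
  · simp_rw [coefFour_smul]
    rw [integral_const_mul]
    have h1 : ((√2 ^ n)⁻¹) ^ 4 * ∫ ω, coefFour p X u n ω ∂μ ≤ D * ((√2 ^ n)⁻¹) ^ 2 := by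
      have h2 : ((√2 ^ n)⁻¹) ^ 2 * ∫ ω, coefFour p X u n ω ∂μ ≤ D := by
        rw [inv_sqrt_two_pow_sq, inv_mul_le_iff₀ (by positivity), mul_comm]
        exact (hD n hn).2
      have h3 := mul_le_mul_of_nonneg_left h2 (sq_nonneg (√2 ^ n)⁻¹)
      refine le_trans (le_of_eq ?_) (h3.trans (le_of_eq (mul_comm _ _)))
      ring
    refine (mul_le_mul_of_nonneg_left h1 (by have := hpos n; positivity)).trans (le_of_eq ?_)
    have := (hpos n).ne'
    generalize (√2 ^ n)⁻¹ = h at this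
    field_simp
    ring

/-- The increment of the martingale contributes, conditionally on the past, almost a Gaussian factor
`exp (-v / 2)`. -/
lemma Setting.charErr_succ_le (hs : Setting μ p a b X ε σ ρ) (hℓ : IsEll a b σ ℓ) {τ ν : ℝ}
    (h4 : H4 p X ε μ τ ν) (u : Fin 2 × Fin (p + 1) → ℝ) {n : ℕ} (hn : p - 1 ≤ n) :
    charErr p X ε μ (limVar a b σ ρ ℓ (√2 • u)) (√2 • u) (n + 1) ≤
      charErr p X ε μ (limVar a b σ ρ ℓ u) u n +
        stepErr p X μ σ ρ (τ ^ 4) (limVar a b σ ρ ℓ u) u n := by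
  set v := limVar a b σ ρ ℓ u with hv
  set h := (√2 ^ n)⁻¹ with hh
  obtain ⟨κ, hκm, hlaw, hm, hκ4⟩ :=
    exists_noiseKernel hs.one_le hs.meas hs.bar hs.h1 hs.h2 hs.h3 hn
  obtain ⟨D, hD0, hD⟩ := hs.exists_integral_coefFour_le h4 (h • u)
  have hH4 : ∀ᵐ ω ∂μ, ∀ k : gen (n + 1), μ[fun ω' => ε k ω' ^ 4 | filt X n] ω = τ ^ 4 :=
    ae_all_iff.2 fun k => (h4.2.2 n hn).1 k k.2
  have hfour : ∀ ω, ∑ i, (pastCoef p X (h • u) 0 n i (toPast X n ω) ^ 2 +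
      pastCoef p X (h • u) 1 n i (toPast X n ω) ^ 2) ^ 2 = coefFour p X (h • u) n ω := fun ω =>
    Finset.sum_coe_sort (gen n) fun k =>
      (coef p X (h • u) 0 k ω ^ 2 + coef p X (h • u) 1 k ω ^ 2) ^ 2
  have hmm : Measurable[filt X n] fun ω => h * mart p X ε u n ω :=
    (measurable_mart_filt hs.one_le hs.bar n).const_mul h
  have key := norm_integral_cexp_add_linNoise_sub_le (measurable_toPast hs.meas n)
    (fun i : gen n => measurable_sisters hs.one_le hs.meas hs.bar (le_of_mem_gen hn i.2)) hlaw hm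
    (measurable_pastCoef (u := h • u) hn 0) (measurable_pastCoef (u := h • u) hn 1) hs.rho_lt
    (K := τ ^ 4)
    (by
      filter_upwards [hκ4, hH4] with ω w1 w2 i
      rw [(w1 i).1, (w1 i).2]
      exact ⟨(w2 ⟨_, (daughters_mem_gen i.2).1⟩).le, (w2 ⟨_, (daughters_mem_gen i.2).2⟩).le⟩)
    ((hs.integrable_incrVar (u := h • u) hn).congr (Eventually.of_forall fun ω =>
      (linVar_pastCoef σ ρ n ω).symm))
    ((hD n hn).1.congr (Eventually.of_forall fun ω => (hfour ω).symm))
    (measurable_onPast hmm) (hs.limVar_nonneg hℓ (u := u)) (δ := h) (by positivity)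
  simp only [linNoise_pastCoef, linVar_pastCoef, hfour, onPast_toPast] at key
  rw [← hv] at key
  have e1 : ∀ ω, (√2 ^ (n + 1))⁻¹ * mart p X ε (√2 • u) (n + 1) ω =
      h * mart p X ε u n ω + incr p X ε (h • u) n ω := fun ω => by
    rw [mart_smul, mart_succ hs.one_le hn, incr_smul, pow_succ, mul_inv, hh]
    have : √2 ≠ 0 := by positivity
    field_simp
  have e2 : Real.exp (-(limVar a b σ ρ ℓ (√2 • u)) / 2) =
      Real.exp (-v / 2) * Real.exp (-v / 2) := by
    rw [← Real.exp_add, limVar_smul, Real.sq_sqrt (by norm_num), ← hv]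
    congr 1; ring
  unfold charErr
  simp_rw [e1]
  rw [e2]
  set Z := ∫ ω, Complex.exp (Complex.I * ((h * mart p X ε u n ω + incr p X ε (h • u) n ω : ℝ) : ℂ)) ∂μ
  set Y := ∫ ω, Complex.exp (Complex.I * ((h * mart p X ε u n ω : ℝ) : ℂ)) ∂μ with hY
  have e3 : Z - ((Real.exp (-v / 2) * Real.exp (-v / 2) : ℝ) : ℂ) =
      (Real.exp (-v / 2) : ℂ) * (Y - (Real.exp (-v / 2) : ℂ)) +
        (Z - (Real.exp (-v / 2) : ℂ) * Y) := by push_cast; ring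
  rw [e3]
  refine (norm_add_le _ _).trans (add_le_add ?_ ?_)
  · rw [norm_mul, Complex.norm_real, Real.norm_of_nonneg (Real.exp_pos _).le]
    refine mul_le_of_le_one_left (norm_nonneg _) ?_
    rw [Real.exp_le_one_iff]
    have := hs.limVar_nonneg hℓ (u := u)
    linarith
  · exact key

/-- The bounds of the second moments make the errors small near `0`, uniformly in `n`. -/
lemma Setting.exists_charErr_le (hs : Setting μ p a b X ε σ ρ) (hℓ : IsEll a b σ ℓ)
    (u : Fin 2 × Fin (p + 1) → ℝ) : ∃ C : ℝ, ∀ (s : ℝ) (n : ℕ), 0 ≤ s → p - 1 ≤ n →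
      charErr p X ε μ (limVar a b σ ρ ℓ (s • u)) (s • u) n ≤
        s * C + s ^ 2 * limVar a b σ ρ ℓ u / 2 := by
  obtain ⟨C, hC0, hC⟩ := hs.exists_integral_mart_sq_le u
  refine ⟨√C, fun s n hs0 hn => ?_⟩
  have hmm : Measurable fun ω => (√2 ^ n)⁻¹ * mart p X ε u n ω :=
    (hs.measurable_mart n).const_mul _
  obtain ⟨i1, i2⟩ := integral_abs_le_sqrt hmm (μ := μ) (C := C)
    (by simp_rw [mul_pow]; exact (hC n hn).1.const_mul _)
    (by
      simp_rw [mul_pow]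
      rw [integral_const_mul, inv_sqrt_two_pow_sq, inv_mul_le_iff₀ (by positivity), mul_comm]
      exact (hC n hn).2)
  have e : ∀ ω, |(√2 ^ n)⁻¹ * mart p X ε (s • u) n ω - 0| =
      s * |(√2 ^ n)⁻¹ * mart p X ε u n ω| := fun ω => by
    rw [mart_smul, sub_zero, mul_left_comm, abs_mul, abs_of_nonneg hs0]
  have h1 := norm_integral_cexp_sub_integral_le (μ := μ)
    (f := fun ω => (√2 ^ n)⁻¹ * mart p X ε (s • u) n ω) (g := fun _ => 0)
    ((hs.measurable_mart n).const_mul _) measurable_const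
    (by simp_rw [e]; exact i1.const_mul s)
  simp_rw [e] at h1
  rw [integral_const_mul] at h1
  simp only [Complex.ofReal_zero, mul_zero, Complex.exp_zero, integral_const, probReal_univ,
    one_smul] at h1
  have h2 : ‖(1 : ℂ) - (Real.exp (-(limVar a b σ ρ ℓ (s • u)) / 2) : ℂ)‖ ≤
      s ^ 2 * limVar a b σ ρ ℓ u / 2 := by
    have h0 := hs.limVar_nonneg hℓ (u := s • u)
    rw [← Complex.ofReal_one, ← Complex.ofReal_sub, Complex.norm_real, Real.norm_eq_abs,
      abs_of_nonneg (by rw [sub_nonneg, Real.exp_le_one_iff]; linarith)]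
    have := Real.add_one_le_exp (-(limVar a b σ ρ ℓ (s • u)) / 2)
    rw [limVar_smul] at this ⊢
    linarith
  unfold charErr
  refine (norm_sub_le_norm_sub_add_norm_sub _ 1 _).trans (add_le_add (h1.trans ?_) h2)
  exact mul_le_mul_of_nonneg_left i2 hs0

theorem Setting.tendsto_charErr (hs : Setting μ p a b X ε σ ρ) (hℓ : IsEll a b σ ℓ) {τ ν : ℝ}
    (h4 : H4 p X ε μ τ ν) (u : Fin 2 × Fin (p + 1) → ℝ) :
    Tendsto (charErr p X ε μ (limVar a b σ ρ ℓ u) u) atTop (𝓝 0) := by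
  obtain ⟨C, hC⟩ := hs.exists_charErr_le hℓ u
  have hh := tendsto_inv_sqrt_two_pow
  have := tendsto_zero_of_rescaling (q := p - 1)
    (E := fun n k => charErr p X ε μ (limVar a b σ ρ ℓ ((√2 ^ k)⁻¹ • u)) ((√2 ^ k)⁻¹ • u) n)
    (c := fun n k => stepErr p X μ σ ρ (τ ^ 4) (limVar a b σ ρ ℓ ((√2 ^ (k + 1))⁻¹ • u))
      ((√2 ^ (k + 1))⁻¹ • u) n)
    (r := fun k => (√2 ^ k)⁻¹ * C + (√2 ^ k)⁻¹ ^ 2 * limVar a b σ ρ ℓ u / 2)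
    (fun n k => norm_nonneg _) (fun n k hn => ?_)
    (fun k => hs.tendsto_stepErr hℓ h4 h4.1.le _) (fun n k hn => hC _ n (by positivity) hn) ?_
  · simpa using this
  · have e : (√2 ^ k)⁻¹ • u = √2 • (√2 ^ (k + 1))⁻¹ • u := by
      rw [smul_smul, pow_succ]
      congr 1
      have : √2 ≠ 0 := by positivity
      field_simp
    have h1 := hs.charErr_succ_le hℓ h4 ((√2 ^ (k + 1))⁻¹ • u) hn
    rw [← e] at h1
    exact h1
  · have := (hh.mul_const C).add (((hh.pow 2).mul_const (limVar a b σ ρ ℓ u)).div_const 2)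
    simpa using this

/-- The scaling by `√|T_{n-1}|` is asymptotically that by `√2 ^ n`. -/
lemma Setting.tendsto_integral_cexp_mart (hs : Setting μ p a b X ε σ ρ) (hℓ : IsEll a b σ ℓ)
    {τ ν : ℝ} (h4 : H4 p X ε μ τ ν) (u : Fin 2 × Fin (p + 1) → ℝ) :
    Tendsto (fun n => ∫ ω, Complex.exp (Complex.I *
      ((1 / √((tree (n - 1)).card : ℝ)) * mart p X ε u n ω : ℝ)) ∂μ) atTop
      (𝓝 (Real.exp (-(limVar a b σ ρ ℓ u) / 2) : ℂ)) := by
  obtain ⟨C, hC0, hC⟩ := hs.exists_integral_mart_sq_le u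
  have h1 : Tendsto (fun n => ∫ ω, Complex.exp (Complex.I *
      ((√2 ^ n)⁻¹ * mart p X ε u n ω : ℝ)) ∂μ) atTop
      (𝓝 (Real.exp (-(limVar a b σ ρ ℓ u) / 2) : ℂ)) :=
    tendsto_iff_norm_sub_tendsto_zero.2 (hs.tendsto_charErr hℓ h4 u)
  set t : ℕ → ℝ := fun n => 1 / √((tree (n - 1)).card : ℝ) with ht
  have hratio : Tendsto (fun n => |t n * √2 ^ n - 1| * √C) atTop (𝓝 0) := by
    have h2 : Tendsto (fun n : ℕ => (1 - (2 ^ n : ℝ)⁻¹)) atTop (𝓝 1) := by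
      have := (tendsto_inv_sqrt_two_pow.pow 2).const_sub 1
      simp_rw [inv_sqrt_two_pow_sq] at this
      simpa using this
    have h3 : Tendsto (fun n : ℕ => 1 / √(1 - (2 ^ n : ℝ)⁻¹)) atTop (𝓝 1) := by
      have := ((Real.continuous_sqrt.tendsto 1).comp h2).inv₀ (by simp)
      simpa using this
    have h4 : Tendsto (fun n : ℕ => |1 / √(1 - (2 ^ n : ℝ)⁻¹) - 1| * √C) atTop (𝓝 0) := by
      have := ((h3.sub_const 1).abs).mul_const (√C)
      simpa using this
    refine h4.congr' ?_
    filter_upwards [eventually_ge_atTop 1] with n hn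
    have e1 : √2 ^ n = √(2 ^ n : ℝ) := by
      refine ((Real.sqrt_eq_iff_mul_self_eq (by positivity) (by positivity)).2 ?_).symm
      rw [← mul_pow, Real.mul_self_sqrt (by norm_num)]
    have e2 : (1 - (2 ^ n : ℝ)⁻¹) = (2 ^ n - 1) / 2 ^ n := by field_simp
    rw [ht]
    simp only
    rw [card_tree, Nat.sub_add_cancel hn, e1, e2, Real.sqrt_div' _ (by positivity), one_div_div,
      one_div_mul_eq_div]
  have h2 : Tendsto (fun n => ∫ ω, Complex.exp (Complex.I * (t n * mart p X ε u n ω : ℝ)) ∂μ -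
      ∫ ω, Complex.exp (Complex.I * ((√2 ^ n)⁻¹ * mart p X ε u n ω : ℝ)) ∂μ) atTop (𝓝 0) := by
    refine squeeze_zero_norm' ?_ hratio
    filter_upwards [eventually_ge_atTop (p - 1)] with n hn
    have hmm : Measurable fun ω => (√2 ^ n)⁻¹ * mart p X ε u n ω :=
      (hs.measurable_mart n).const_mul _
    obtain ⟨i1, i2⟩ := integral_abs_le_sqrt hmm (μ := μ) (C := C)
      (by simp_rw [mul_pow]; exact (hC n hn).1.const_mul _)
      (by
        simp_rw [mul_pow]
        rw [integral_const_mul, inv_sqrt_two_pow_sq, inv_mul_le_iff₀ (by positivity), mul_comm]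
        exact (hC n hn).2)
    have e : ∀ ω, |t n * mart p X ε u n ω - (√2 ^ n)⁻¹ * mart p X ε u n ω| =
        |t n * √2 ^ n - 1| * |(√2 ^ n)⁻¹ * mart p X ε u n ω| := fun ω => by
      rw [← abs_mul]
      congr 1
      field_simp
    have h5 := norm_integral_cexp_sub_integral_le (μ := μ)
      (f := fun ω => t n * mart p X ε u n ω) (g := fun ω => (√2 ^ n)⁻¹ * mart p X ε u n ω)
      ((hs.measurable_mart n).const_mul _) hmm (by simp_rw [e]; exact i1.const_mul _)
    simp_rw [e] at h5
    rw [integral_const_mul] at h5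
    exact h5.trans (mul_le_mul_of_nonneg_left i2 (abs_nonneg _))
  have h3 := h2.add h1
  simp only [sub_add_cancel, zero_add] at h3
  exact h3

lemma Setting.measurable_M (hs : Setting μ p a b X ε σ ρ) (n : ℕ) : Measurable (M p X ε n) := by
  refine measurable_pi_lambda _ fun i => ?_
  -- with truncated subtraction, `M 0` is the same sum as `M 1`
  rcases n with _ | n
  · exact (measurable_M_filt hs.one_le hs.bar (n := 1) le_rfl i).mono (filt_le hs.meas _) le_rfl
  · exact (measurable_M_filt hs.one_le hs.bar (by omega) i).mono (filt_le hs.meas _) le_rfl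

theorem Setting.tendstoInDistribution (hs : Setting μ p a b X ε σ ρ) (hℓ : IsEll a b σ ℓ)
    {τ ν : ℝ} (h4 : H4 p X ε μ τ ν) :
    TendstoInDistribution
      (fun (n : ℕ) (ω : Ω) => (WithLp.toLp 2
          ((1 / Real.sqrt ((tree (n - 1)).card : ℝ)) • M p X ε n ω) :
          EuclideanSpace ℝ (Fin 2 × Fin (p + 1)))) atTop
      (id : EuclideanSpace ℝ (Fin 2 × Fin (p + 1)) → EuclideanSpace ℝ (Fin 2 × Fin (p + 1)))
      (fun _ => μ) (multivariateGaussian 0 (Γ σ ρ ⊗ₖ L a b ℓ)) := by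
  have hmeas : ∀ n, Measurable fun ω => (WithLp.toLp 2
      ((1 / Real.sqrt ((tree (n - 1)).card : ℝ)) • M p X ε n ω) :
      EuclideanSpace ℝ (Fin 2 × Fin (p + 1))) := fun n =>
    (WithLp.measurable_toLp 2 _).comp
      ((hs.measurable_M n).const_smul (1 / Real.sqrt ((tree (n - 1)).card : ℝ)) :
        Measurable fun ω => (1 / Real.sqrt ((tree (n - 1)).card : ℝ)) • M p X ε n ω)
  refine ⟨fun n => (hmeas n).aemeasurable, aemeasurable_id, ?_⟩
  refine ProbabilityMeasure.tendsto_iff_tendsto_charFun.2 fun t => ?_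
  have hlim : charFun ((multivariateGaussian 0 (Γ σ ρ ⊗ₖ L a b ℓ)).map id) t =
      (Real.exp (-(limVar a b σ ρ ℓ t.ofLp) / 2) : ℂ) := by
    rw [Measure.map_id, charFun_multivariateGaussian (hs.posSemidef_kronecker hℓ)]
    simp [limVar, neg_div]
  refine Tendsto.congr' (f₁ := fun n => ∫ ω, Complex.exp (Complex.I *
      ((1 / √((tree (n - 1)).card : ℝ)) * mart p X ε t.ofLp n ω : ℝ)) ∂μ) ?_ ?_
  · filter_upwards [eventually_ge_atTop p] with n hn
    simp only [ProbabilityMeasure.coe_mk]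
    rw [charFun_apply, integral_map (hmeas n).aemeasurable (by fun_prop)]
    refine integral_congr_ae (Eventually.of_forall fun ω => ?_)
    simp only
    rw [mul_comm, mart_of_le hn, EuclideanSpace.inner_eq_star_dotProduct]
    simp [dotProduct_smul]
  · simp only [ProbabilityMeasure.coe_mk]
    rw [hlim]
    exact hs.tendsto_integral_cexp_mart hℓ h4 t.ofLp

end Autoregression

end BAR

theorem theorem5p1 {Ω : Type*} [MeasurableSpace Ω] (μ : Measure Ω) [IsProbabilityMeasure μ]
    (p : ℕ) (hp : 1 ≤ p) (a b : Fin (p + 1) → ℝ) (X ε : ℕ → Ω → ℝ)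
    (hX : ∀ k, 1 ≤ k → Measurable (X k))
    (hBAR : BAR.IsBAR p a b X ε)
    (hinit : ∀ k, 1 ≤ k → k ≤ 2 ^ p - 1 → MemLp (X k) 8 μ)
    (hβ : BAR.Contracting (BAR.companion a) (BAR.companion b))
    (c : ℕ → Ω → ℝ) (hc : BAR.IsRegularisation p X c)
    (σ ρ : ℝ) (h1 : BAR.H1 p X ε μ σ) (h2 : BAR.H2 p X ε μ σ ρ) (h3 : BAR.H3 p X ε μ) :
    (∀ᵐ ω ∂μ, (fun n : ℕ => BAR.V p X ε c n ω) =O[atTop] (fun n : ℕ => (n : ℝ))) ∧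
    (∀ᵐ ω ∂μ, Tendsto (fun n : ℕ => (1 / (n : ℝ)) * ∑ k ∈ Finset.Icc p n, BAR.V p X ε c k ω)
      atTop (𝓝 (2 * ((p : ℝ) + 1) * σ ^ 2))) ∧
    (∀ τ ν : ℝ, BAR.H4 p X ε μ τ ν → BAR.H5 p X ε μ →
      ∃ ℓ : Matrix (Fin p) (Fin p) ℝ,
        BAR.IsEll a b σ ℓ ∧ (∀ ℓ', BAR.IsEll a b σ ℓ' → ℓ' = ℓ) ∧ (BAR.L a b ℓ).PosDef ∧
        TendstoInDistribution
          (fun (n : ℕ) (ω : Ω) =>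
            (WithLp.toLp 2
              ((1 / Real.sqrt ((BAR.tree (n - 1)).card : ℝ)) • BAR.M p X ε n ω) :
              EuclideanSpace ℝ (Fin 2 × Fin (p + 1))))
          atTop
          (id : EuclideanSpace ℝ (Fin 2 × Fin (p + 1)) → EuclideanSpace ℝ (Fin 2 × Fin (p + 1)))
          (fun _ => μ)
          (multivariateGaussian 0 (BAR.Γ σ ρ ⊗ₖ BAR.L a b ℓ))) := by
  have hs : BAR.Setting μ p a b X ε σ ρ := ⟨hp, hX, hBAR, hinit, hβ, h1, h2, h3⟩
  have hV := hs.ae_tendsto_average_V hc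
  refine ⟨?_, hV, fun τ ν h4 _ => ?_⟩
  · filter_upwards [hV] with ω hω using BAR.V_isBigO_of_tendsto hc hω
  · obtain ⟨ℓ, hℓ, huniq⟩ := BAR.existsUnique_isEll hβ σ
    exact ⟨ℓ, hℓ, huniq, BAR.posDef_L hβ h1.1 hℓ, hs.tendstoInDistribution hℓ h4⟩
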